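/- **Setting.** Let $h,a,b,q,l,p\in\mathbb Z$ with $h\ge 2$, $1\le a,b\le q$, $0\le l\le p\le 2h-1$, let $s>0$, $S(t)=st^{1+b/q}$, $\vartheta=s(1+b/q)$, and consider $$\frac{dx}{dt}=\partial_yH+t^{-a/q}f(x,y,S(t),t),\qquad \frac{dy}{dt}=-\partial_xH+t^{-a/q}g(x,y,S(t),t),\qquad t>0, \tag{1}$$ $$H(x,y)=\frac{y^2}{2}+U(x),\qquad U(x)=\frac{x^{2h}}{2h}+\sum_{i=1}^{2h-1}u_ix^i,\quad u_i=\mathrm{const}.$$ The functions $f,g$ are infinitely differentiable, $2\pi$-periodic in $S$, and as $t\to\infty$ have the asymptotic expansions $f=\sum_{k\ge0}t^{-k/q}f_k$, $g=\sum_{k\ge 0}t^{-k/q}g_k$ with $f_k=\sum_{i=0}^p\sum_{j=0}^{l-1}A_{k,i,j}(S)x^iy^j$, $g_k=\sum_{i=0}^p\sum_{j=0}^{l}B_{k,i,j}(S)x^iy^j$, where $A_{k,i,j},B_{k,i,j}$ are smooth, $2\pi$-periodic, and vanish identically if $i+j>p$. Assume $$-1\le\sigma<\frac bq,\qquad \sigma=\frac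 bq\Big(l-1+\frac{p-1}{h-1}\Big)-\frac aq, \tag{rc}$$ and put $\mu=\frac12(\frac bq-\sigma)$, $\nu=1+2\mu+\sigma$, $M=2\mu q(h-1)$, $N=2\nu q(h-1)$; then $M,N$ are integers, $M\ge1$, $N\ge 2M$. Fix an integer $\varkappa\ge1$. **Energy-angle variables.** For large $E$ let $T(E)$ be the period of the orbit $H=E$ of the unperturbed system, $\omega(E)=2\pi/T(E)$, and let $X(\phi,E),Y(\phi,E)$ be the $2\pi$-periodic functions of $\phi$ with $\omega\partial_\phi X=Y$, $\omega\partial_\phi Y=-U'(X)$, $H(X,Y)=E$, where $\phi=0$ is the right turning point ($Y=0$, $X>0$). As $E\to\infty$, $$X=E^{\frac1{2h}}\sum_{j\ge0}E^{-\frac j{2h}}X_j(\phi),\quad Y=E^{\frac12}\sum_{j\ge0}E^{-\frac j{2h}}Y_j(\phi),\quad \omega=E^{\frac{h-1}{2h}}\sum_{j\ge0}E^{-\frac j{2h}}\omega_j,$$ with $2\pi$-periodic $X_j,Y_j$ and constants $\omega_j$, $\omega_0=2\pi/\kappa$, $\kappa=\sqrt2(2h)^{\frac1{2h}}\int_{-1}^1\frac{d\varsigma}{\sqrt{1-\varsigma^{2h}}}$.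 In the variables $x=X(\phi,I)$, $y=Y(\phi,I)$ system (1) reads $\dot I=t^{-a/q}F$, $\dot\phi=\omega(I)+t^{-a/q}G$ with $F=fU'(X)+gY$, $G=\omega(I)(f\,\partial_EY-g\,\partial_EX)$. **Resonant variables.** For large $t$ let $I_*(t)$ be the solution of $\omega(I_*(t))=\varkappa^{-1}S'(t)$. The substitution $$I=I_*(t)\big(1+t^{-\mu}r(\tau)\big)^{2h},\qquad \phi=\theta(\tau)+\varkappa^{-1}S(t),\qquad \tau=t^\nu/\nu,$$ brings the system to the form (here $\zeta=S(t)=\vartheta\tau$) $$\frac{dr}{d\tau}\sim\tau^{-\frac MN}\sum_{K\ge0}\tau^{-\frac KN}\mathcal A_K(r,\theta,\zeta),\qquad \frac{d\theta}{d\tau}\sim\tau^{-\frac MN}\sum_{K\ge0}\tau^{-\frac KN}\mathcal B_K(r,\theta,\zeta),$$ where the coefficients $\mathcal A_K,\mathcal B_K$, obtained by inserting all the above expansions and collecting powers of $\tau^{-1/N}$, are polynomials in $r$, $2\pi$-periodic in $\theta$ and $2\pi\varkappa$-periodic in $\zeta$. **Averaging.** For every $K\ge0$ the functions $\Lambda_K(R,\Psi)$,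 $\Omega_K(R,\Psi)$ and the functions $\rho_K(r,\theta,\zeta)$, $\psi_K(r,\theta,\zeta)$, $2\pi\varkappa$-periodic in $\zeta$ with zero mean over $\zeta\in[0,2\pi\varkappa]$, are determined uniquely and recursively by requiring that the formal change of variables $$R=r+\sum_{K\ge0}\tau^{-\frac{M+K}N}\rho_K(r,\theta,\zeta),\qquad \Psi=\theta+\sum_{K\ge0}\tau^{-\frac{M+K}N}\psi_K(r,\theta,\zeta)$$ takes this system into $\frac{dR}{d\tau}=\sum_{K\ge0}\tau^{-\frac{M+K}N}\Lambda_K(R,\Psi)$, $\frac{d\Psi}{d\tau}=\sum_{K\ge0}\tau^{-\frac{M+K}N}\Omega_K(R,\Psi)$. In particular $\Lambda_K,\Omega_K$ are the means over $\zeta\in[0,2\pi\varkappa]$ of $\mathcal A_K,\mathcal B_K$ plus terms built from the functions of lower order. **Lemma.** Let $0\le L\le\min\{N-M,2M-1\}$ be an integer such that $\Lambda_K(\varrho,\varphi)\equiv0$ for all $0\le K<L$ and $\Lambda_L(\varrho,\varphi)\not\equiv0$. Put $\Lambda_L^0(\varphi)=\Lambda_L(0,\varphi)$ and suppose that there is $\varphi_0\in\mathbb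 R$ with $$\Lambda_L^0(\varphi_0)=0,\qquad \lambda_L=\partial_\varphi\Lambda_L^0(\varphi_0)\ne0 .$$ Then for every integer $n\ge L$ there is $\tau_0>0$ such that the truncated averaged system $$\frac{d\varrho}{d\tau}=\sum_{K=L}^n\tau^{-\frac{M+K}N}\Lambda_K(\varrho,\varphi),\qquad \frac{d\varphi}{d\tau}=\sum_{K=0}^n\tau^{-\frac{M+K}N}\Omega_K(\varrho,\varphi),\qquad \tau>\tau_0,$$ has a solution $\varrho_*(\tau),\varphi_*(\tau)$ on $(\tau_0,\infty)$ with asymptotic expansions to all orders $$\varrho_*(\tau)\sim\sum_{K=0}^\infty\varrho_K\tau^{-\frac{M+K}N},\qquad \varphi_*(\tau)\sim\varphi_0+\sum_{K=1}^\infty\varphi_K\tau^{-\frac KN},\qquad \tau\to\infty,$$ with constants $\varrho_K,\varphi_K$; that is, for every $m\ge0$ the difference between $\varrho_*$ (respectively $\varphi_*$) and the sum of the terms with $K<m$ of its series is $O(\tau^{-(M+m)/N})$ (respectively $O(\tau^{-m/N})$). In particular $\varphi_*(\tau)\to\varphi_0$: the phase difference is locked. -/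

import Mathlib

open Filter Topology Asymptotics
open scoped ContDiff PowerSeries

noncomputable section

namespace PhaseLocking

/-! ## The perturbed system -/

/-- The data of the planar system
`x' = ∂_y H + t^(-a/q) f(x, y, S(t), t)`, `y' = -∂_x H + t^(-a/q) g(x, y, S(t), t)`,
`H = y² / 2 + U(x)`, `U(x) = x^(2h) / (2h) + ∑_{1 ≤ i ≤ 2h-1} u_i x^i`, `S(t) = s t^(1 + b/q)`,
where `f` and `g` have expansions in powers of `t^(-1/q)` whose coefficients are polynomials in
`(x, y)` with coefficients `A k i j S` and `B k i j S`. -/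
structure Data where
  h : ℕ
  a : ℕ
  b : ℕ
  q : ℕ
  l : ℕ
  p : ℕ
  s : ℝ
  u : ℕ → ℝ
  f : ℝ → ℝ → ℝ → ℝ → ℝ
  g : ℝ → ℝ → ℝ → ℝ → ℝ
  A : ℕ → ℕ → ℕ → ℝ → ℝ
  B : ℕ → ℕ → ℕ → ℝ → ℝ

namespace Data

variable (D : Data)

/-- `f_k(x, y, S) = ∑_{i ≤ p} ∑_{j ≤ l - 1} A_{k,i,j}(S) x^i y^j` (zero if `l = 0`). -/
def fCoeff (k : ℕ) (x y S : ℝ) : ℝ :=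
  ∑ i ∈ Finset.range (D.p + 1), ∑ j ∈ Finset.range D.l, D.A k i j S * x ^ i * y ^ j

/-- `g_k(x, y, S) = ∑_{i ≤ p} ∑_{j ≤ l} B_{k,i,j}(S) x^i y^j`. -/
def gCoeff (k : ℕ) (x y S : ℝ) : ℝ :=
  ∑ i ∈ Finset.range (D.p + 1), ∑ j ∈ Finset.range (D.l + 1), D.B k i j S * x ^ i * y ^ j

/-- The standing assumptions on the system. -/
structure Admissible : Prop where
  two_le_h : 2 ≤ D.h
  one_le_a : 1 ≤ D.a
  a_le_q : D.a ≤ D.q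
  one_le_b : 1 ≤ D.b
  b_le_q : D.b ≤ D.q
  s_pos : 0 < D.s
  l_le_p : D.l ≤ D.p
  p_le : D.p ≤ 2 * D.h - 1
  f_smooth : ContDiffOn ℝ ∞ (fun w : ℝ × ℝ × ℝ × ℝ => D.f w.1 w.2.1 w.2.2.1 w.2.2.2)
    {w | 0 < w.2.2.2}
  g_smooth : ContDiffOn ℝ ∞ (fun w : ℝ × ℝ × ℝ × ℝ => D.g w.1 w.2.1 w.2.2.1 w.2.2.2)
    {w | 0 < w.2.2.2}
  f_periodic : ∀ x y S t, 0 < t → D.f x y (S + 2 * Real.pi) t = D.f x y S t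
  g_periodic : ∀ x y S t, 0 < t → D.g x y (S + 2 * Real.pi) t = D.g x y S t
  A_smooth : ∀ k i j, ContDiff ℝ ∞ (D.A k i j)
  B_smooth : ∀ k i j, ContDiff ℝ ∞ (D.B k i j)
  A_periodic : ∀ k i j, Function.Periodic (D.A k i j) (2 * Real.pi)
  B_periodic : ∀ k i j, Function.Periodic (D.B k i j) (2 * Real.pi)
  A_eq_zero : ∀ k i j, D.p < i + j → ∀ S, D.A k i j S = 0
  B_eq_zero : ∀ k i j, D.p < i + j → ∀ S, D.B k i j S = 0
  f_expansion : ∀ x y S (n : ℕ),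
    (fun t : ℝ => D.f x y S t
      - ∑ k ∈ Finset.range n, t ^ (-(k : ℝ) / D.q) * D.fCoeff k x y S)
      =O[atTop] fun t : ℝ => t ^ (-(n : ℝ) / D.q)
  g_expansion : ∀ x y S (n : ℕ),
    (fun t : ℝ => D.g x y S t
      - ∑ k ∈ Finset.range n, t ^ (-(k : ℝ) / D.q) * D.gCoeff k x y S)
      =O[atTop] fun t : ℝ => t ^ (-(n : ℝ) / D.q)

/-- `σ = (b/q) (l - 1 + (p - 1)/(h - 1)) - a/q`. -/
def sigma : ℝ :=
  (D.b : ℝ) / D.q * ((D.l : ℝ) - 1 + ((D.p : ℝ) - 1) / ((D.h : ℝ) - 1)) - (D.a : ℝ) / D.q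

/-- The assumption `-1 ≤ σ < b/q`. -/
def SigmaCondition : Prop := -1 ≤ D.sigma ∧ D.sigma < (D.b : ℝ) / D.q

def mu : ℝ := ((D.b : ℝ) / D.q - D.sigma) / 2

def nu : ℝ := 1 + 2 * D.mu + D.sigma

/-- `M = 2 μ q (h - 1)`; there is no rounding, see `cast_M`. -/
def M : ℕ := ⌊2 * D.mu * D.q * ((D.h : ℝ) - 1)⌋₊

/-- `N = 2 ν q (h - 1)`; there is no rounding, see `cast_N`. -/
def N : ℕ := ⌊2 * D.nu * D.q * ((D.h : ℝ) - 1)⌋₊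

/-- `ϑ = s (1 + b/q)`; the fast phase is `ζ(τ) = ϑ τ`. -/
def vartheta : ℝ := D.s * (1 + (D.b : ℝ) / D.q)

/-! ## Large-energy expansion of the periodic solutions of the limiting system

With `ε = E^(-1/(2h))` the functions of the angle `φ` and the energy `E` are written
`X = E^(1/(2h)) ∑ X_j(φ) ε^j`, `Y = E^(1/2) ∑ Y_j(φ) ε^j`, `ω = E^((h-1)/(2h)) ∑ ω_j ε^j`.
After division by the leading powers of `E` the system `ω ∂_φ X = Y`, `ω ∂_φ Y = -U'(X)`,
`Y²/2 + U(X) = E` becomes an identity between formal power series in `ε`,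
see `energyAngle_formal_solution`. -/

/-- `U` after the scaling: `x^(2h)/(2h) + ∑ u_i ε^(2h-i) x^i`. -/
def potSeries (x : ℝ⟦X⟧) : ℝ⟦X⟧ :=
  PowerSeries.C (1 / (2 * D.h : ℝ)) * x ^ (2 * D.h)
    + ∑ i ∈ Finset.Icc 1 (2 * D.h - 1),
        PowerSeries.C (D.u i) * PowerSeries.X ^ (2 * D.h - i) * x ^ i

/-- `U'` after the scaling: `x^(2h-1) + ∑ i u_i ε^(2h-i) x^(i-1)`. -/
def forceSeries (x : ℝ⟦X⟧) : ℝ⟦X⟧ :=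
  x ^ (2 * D.h - 1)
    + ∑ i ∈ Finset.Icc 1 (2 * D.h - 1),
        PowerSeries.C ((i : ℝ) * D.u i) * PowerSeries.X ^ (2 * D.h - i) * x ^ (i - 1)

/-- `κ = √2 (2h)^(1/(2h)) ∫_{-1}^{1} dς / √(1 - ς^(2h))`. -/
def kappa : ℝ :=
  √2 * (2 * D.h : ℝ) ^ (1 / (2 * D.h : ℝ)) * ∫ ς in (-1 : ℝ)..1, 1 / √(1 - ς ^ (2 * D.h))

/-- `ω_0 = 2π/κ`. -/
def omega0 : ℝ := 2 * Real.pi / D.kappa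

/-- The equations `ω_0 X_0' = Y_0`, `ω_0 Y_0' = -X_0^(2h-1)`, `Y_0²/2 + X_0^(2h)/(2h) = 1` of the
leading coefficients; the angle `φ` is counted from the right turning point. -/
def IsLeadingOrbit (z : (ℝ → ℝ) × (ℝ → ℝ)) : Prop :=
  z.1 0 = (2 * D.h : ℝ) ^ (1 / (2 * D.h : ℝ)) ∧ z.2 0 = 0 ∧
    ∀ φ, HasDerivAt z.1 (z.2 φ / D.omega0) φ ∧
      HasDerivAt z.2 (-z.1 φ ^ (2 * D.h - 1) / D.omega0) φ

/-- The leading coefficients `(X_0, Y_0)`: the solution of `IsLeadingOrbit`, which exists by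
`exists_isLeadingOrbit` (and is unique because the right-hand sides are smooth). -/
def leadingOrbit : (ℝ → ℝ) × (ℝ → ℝ) := Classical.epsilon D.IsLeadingOrbit

end Data

/-- The coefficients `X_j`, `Y_j`, `ω_j` of one order. -/
structure EnergyAngle where
  X : ℝ → ℝ
  Y : ℝ → ℝ
  omega : ℝ

namespace EnergyAngle

variable (c : ℕ → EnergyAngle) (j : ℕ)

/-- `∑_{i < j} X_i(φ) ε^i` -/
def xTrunc (φ : ℝ) : ℝ⟦X⟧ := PowerSeries.mk fun i => if i < j then (c i).X φ else 0

/-- `∑_{i < j} Y_i(φ) ε^i` -/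
def yTrunc (φ : ℝ) : ℝ⟦X⟧ := PowerSeries.mk fun i => if i < j then (c i).Y φ else 0

/-- `∑_{0 < i < j} ω_i X_{j-i}'(φ)` -/
def aTerm (φ : ℝ) : ℝ := ∑ i ∈ Finset.Ico 1 j, (c i).omega * deriv (c (j - i)).X φ

end EnergyAngle

namespace Data

open EnergyAngle

variable (D : Data)

/-- Minus the coefficient of `ε^j` in the energy of the truncated series. The identity
`Y²/2 + U = 1` at order `j` reads `Y_0 Y_j + X_0^(2h-1) X_j = J_j`. -/
def jTerm (c : ℕ → EnergyAngle) (j : ℕ) (φ : ℝ) : ℝ :=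
  -PowerSeries.coeff j
    (PowerSeries.C (1 / 2 : ℝ) * yTrunc c j φ ^ 2 + D.potSeries (xTrunc c j φ))

/-- `∑_{0 < i < j} ω_i Y_{j-i}'(φ)` plus the coefficient of `ε^j` in `U'` of the truncated
series. -/
def bTerm (c : ℕ → EnergyAngle) (j : ℕ) (φ : ℝ) : ℝ :=
  ∑ i ∈ Finset.Ico 1 j, (c i).omega * deriv (c (j - i)).Y φ
    + PowerSeries.coeff j (D.forceSeries (xTrunc c j φ))

/-- The right-hand side of `α_j' + ω_j / ω_0 = …`, see `energyAngleStep`. -/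
def phaseDensity (c : ℕ → EnergyAngle) (j : ℕ) (φ : ℝ) : ℝ :=
  ((D.h : ℝ) - 1) / (2 * D.h) * D.jTerm c j φ
    - (aTerm c j φ * (c 0).Y φ / 2 - D.bTerm c j φ * (c 0).X φ / (2 * D.h))

/-- The coefficients of order `j ≥ 1` in terms of those of lower order. At order `j` the system is
`ω_0 X_j' - Y_j = -ω_j X_0' - a_j`, `ω_0 Y_j' + (2h-1) X_0^(2h-2) X_j = -ω_j Y_0' - b_j`.
Its solution is `(X_j, Y_j) = α_j (X_0', Y_0') + J_j (X_0/(2h), Y_0/2)`, where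
`α_j' = phaseDensity - ω_j/ω_0`; here `ω_j` is the number for which `α_j` is `2π`-periodic, and
`α_j(0) = 0` (equivalently `Y_j(0) = 0`, or `α_j` has mean value zero, being odd). -/
def energyAngleStep (c : ℕ → EnergyAngle) (j : ℕ) : EnergyAngle :=
  let m : ℝ := (1 / (2 * Real.pi)) * ∫ φ in (0 : ℝ)..(2 * Real.pi), D.phaseDensity c j φ
  let α : ℝ → ℝ := fun φ => ∫ v in (0 : ℝ)..φ, (D.phaseDensity c j v - m)
  { X := fun φ => α φ * ((c 0).Y φ / (c 0).omega) + D.jTerm c j φ * ((c 0).X φ / (2 * D.h))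
    Y := fun φ => α φ * (-(c 0).X φ ^ (2 * D.h - 1) / (c 0).omega)
      + D.jTerm c j φ * ((c 0).Y φ / 2)
    omega := (c 0).omega * m }

/-- The coefficients `X_j`, `Y_j`, `ω_j` of the large-energy expansion. -/
def energyAngle : ℕ → EnergyAngle
  | 0 => ⟨D.leadingOrbit.1, D.leadingOrbit.2, D.omega0⟩
  | j + 1 => D.energyAngleStep
      (fun i => if _ : i < j + 1 then energyAngle i else ⟨0, 0, 0⟩) (j + 1)

/-- `∑ X_j(φ) ε^j` -/
def xSeries (φ : ℝ) : ℝ⟦X⟧ := PowerSeries.mk fun j => (D.energyAngle j).X φ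

/-- `∑ Y_j(φ) ε^j` -/
def ySeries (φ : ℝ) : ℝ⟦X⟧ := PowerSeries.mk fun j => (D.energyAngle j).Y φ

/-- `∑ ω_j ε^j` -/
def omegaSeries : ℝ⟦X⟧ := PowerSeries.mk fun j => (D.energyAngle j).omega

/-! ## Expansion at the resonance

Here `ϰ` is the resonance number, `δ = t^(-1/(2q(h-1)))`, and `x = δ^(2b) = t^(-b/((h-1)q))`. -/

/-- `c_ϰ = (ω_0 ϰ / ϑ)^(1/(h-1))`. -/
def resConst (ϰ : ℕ) : ℝ := (D.omega0 * ϰ / D.vartheta) ^ (1 / ((D.h : ℝ) - 1))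

/-- The coefficients of the formal series `y = 1/z`, where `z(t) = c_ϰ x I_*(t)^(1/(2h))` and
`ω(I_*(t)) = S'(t)/ϰ`. After the substitution `I_*^(-1/(2h)) = c_ϰ x y` the last equation becomes
`∑ ω_i (c_ϰ x y)^i = ω_0 y^(h-1)`, see `coeff_zInv_pow`. -/
def zInvCoeff (ϰ : ℕ) : ℕ → ℝ
  | 0 => 1
  | n + 1 =>
    let y : ℝ⟦X⟧ := PowerSeries.mk fun k => if _ : k < n + 1 then zInvCoeff ϰ k else 0
    (∑ i ∈ Finset.Icc 1 (n + 1), (D.energyAngle i).omega * D.resConst ϰ ^ i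
        * PowerSeries.coeff (n + 1) (PowerSeries.X ^ i * y ^ i)
      - D.omega0 * PowerSeries.coeff (n + 1) (y ^ (D.h - 1))) / (D.omega0 * ((D.h : ℝ) - 1))

/-- The series `1/z` in the variable `x`. -/
def zInv (ϰ : ℕ) : ℝ⟦X⟧ := PowerSeries.mk (D.zInvCoeff ϰ)

/-- `Z_{n,i}`: the coefficient of `x^i` in `z^n`, `n ∈ ℤ`. -/
def zPowCoeff (ϰ : ℕ) (n : ℤ) (i : ℕ) : ℝ :=
  PowerSeries.coeff i
    (if 0 ≤ n then (D.zInv ϰ)⁻¹ ^ n.toNat else D.zInv ϰ ^ (-n).toNat)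

/-- `C_{n,i}`: the coefficient of `v^i` in `(1 + v)^n`, `n ∈ ℤ`. -/
def binomCoeff (n : ℤ) (i : ℕ) : ℝ := (Ring.choose n i : ℤ)

/-- The number `p - 1 + (l - 1)(h - 1)`. -/
def expo : ℤ := (D.p : ℤ) - 1 + ((D.l : ℤ) - 1) * ((D.h : ℤ) - 1)

/-- The series `∑_d F̃_{k,d}(φ, S) ε^d`, `ε = I^(-1/(2h))`, of
`F̃_k = I^(-1-(p-1+(l-1)(h-1))/(2h)) (f_k(X, Y, S) U'(X) + g_k(X, Y, S) Y)`. -/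
def forcingSeries (k : ℕ) (φ S : ℝ) : ℝ⟦X⟧ :=
  (∑ i ∈ Finset.range (D.p + 1), ∑ j ∈ Finset.range D.l,
      PowerSeries.C (D.A k i j S) * PowerSeries.X ^ ((D.p - i - j) + (D.h - 1) * (D.l - 1 - j))
        * D.xSeries φ ^ i * D.ySeries φ ^ j) * D.forceSeries (D.xSeries φ)
  + (∑ i ∈ Finset.range (D.p + 1), ∑ j ∈ Finset.range (D.l + 1),
      PowerSeries.C (D.B k i j S) * PowerSeries.X ^ ((D.p - i - j) + (D.h - 1) * (D.l - j))
        * D.xSeries φ ^ i * D.ySeries φ ^ j) * D.ySeries φ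

/-- The series of `E ∂_E X / E^(1/(2h))`. -/
def dxSeries (φ : ℝ) : ℝ⟦X⟧ :=
  PowerSeries.mk fun j => (1 - (j : ℝ)) / (2 * D.h) * (D.energyAngle j).X φ

/-- The series of `E ∂_E Y / E^(1/2)`. -/
def dySeries (φ : ℝ) : ℝ⟦X⟧ :=
  PowerSeries.mk fun j => ((D.h : ℝ) - j) / (2 * D.h) * (D.energyAngle j).Y φ

/-- The series `∑_d G̃_{k,d}(φ, S) ε^d`, `ε = I^(-1/(2h))`, of
`G̃_k = I^(-(p-1+(l-1)(h-1))/(2h)) ω(I) (f_k(X, Y, S) ∂_E Y - g_k(X, Y, S) ∂_E X)`. -/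
def phaseForcingSeries (k : ℕ) (φ S : ℝ) : ℝ⟦X⟧ :=
  D.omegaSeries *
  ((∑ i ∈ Finset.range (D.p + 1), ∑ j ∈ Finset.range D.l,
      PowerSeries.C (D.A k i j S) * PowerSeries.X ^ ((D.p - i - j) + (D.h - 1) * (D.l - 1 - j))
        * D.xSeries φ ^ i * D.ySeries φ ^ j) * D.dySeries φ
  - (∑ i ∈ Finset.range (D.p + 1), ∑ j ∈ Finset.range (D.l + 1),
      PowerSeries.C (D.B k i j S) * PowerSeries.X ^ ((D.p - i - j) + (D.h - 1) * (D.l - j))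
        * D.xSeries φ ^ i * D.ySeries φ ^ j) * D.dxSeries φ)

/-- The set of `(k, d, i, ℓ)` with `2(h-1)k + 2b(d+i) + Mℓ = K`, i.e. of the contributions
`t^(-k/q) x^(d+i) (t^(-μ) r)^ℓ` of order `δ^K` (if `h ≥ 2`, `b ≥ 1`, `M ≥ 1`, then all four numbers
are at most `K`). -/
def indexSet (K : ℕ) : Finset (ℕ × ℕ × ℕ × ℕ) :=
  (Finset.range (K + 1) ×ˢ Finset.range (K + 1) ×ˢ Finset.range (K + 1) ×ˢ
    Finset.range (K + 1)).filter fun w =>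
      2 * (D.h - 1) * w.1 + 2 * D.b * (w.2.1 + w.2.2.1) + D.M * w.2.2.2 = K

/-- The coefficients of the function `𝓕`. -/
def hatF (ϰ k d i ℓ : ℕ) (θ ζ : ℝ) : ℝ :=
  1 / (2 * D.h) * PowerSeries.coeff d (D.forcingSeries k (θ + ζ / ϰ) ζ)
    * binomCoeff (D.expo + 1 - d) ℓ * D.zPowCoeff ϰ (D.expo - d) i * D.resConst ϰ ^ (-(D.expo - d))

/-- The coefficients of the function `𝓖`. -/
def hatG (ϰ k d i ℓ : ℕ) (θ ζ : ℝ) : ℝ :=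
  PowerSeries.coeff d (D.phaseForcingSeries k (θ + ζ / ϰ) ζ)
    * binomCoeff (D.expo - d) ℓ * D.zPowCoeff ϰ (D.expo - d) i * D.resConst ϰ ^ (-(D.expo - d))

/-- The coefficients of the function `𝓠`. -/
def hatQ (ϰ k d i ℓ : ℕ) : ℝ :=
  if k = 0 then
    (D.energyAngle i).omega * binomCoeff ((D.h : ℤ) - 1 - i) (ℓ + 1)
      * D.zPowCoeff ϰ ((D.h : ℤ) - 1 - i) d * D.resConst ϰ ^ (-((D.h : ℤ) - 1 - i))
  else 0

/-- The coefficients of the function `𝓟`, that is of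
`-(1 + t^(-μ) r) t I_*'(t) / (2h I_*(t))`, where `I_* = (z / (c_ϰ x))^(2h)`. -/
def hatP (ϰ k d i ℓ : ℕ) : ℝ :=
  if k = 0 then
    -((2 * D.h - (i : ℝ)) * D.b / (2 * D.h * ((D.h : ℝ) - 1) * D.q)) * binomCoeff 1 ℓ
      * D.zPowCoeff ϰ (2 * D.h) i * D.zPowCoeff ϰ (-(2 * D.h)) d
  else 0

/-- `𝓕_K(r, θ, ζ)` -/
def calF (ϰ K : ℕ) (r θ ζ : ℝ) : ℝ :=
  D.nu ^ (-((K : ℝ) + D.M) / D.N) *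
    ∑ w ∈ D.indexSet K, D.hatF ϰ w.1 w.2.1 w.2.2.1 w.2.2.2 θ ζ * r ^ w.2.2.2

/-- `𝓟_K(r)` -/
def calP (ϰ K : ℕ) (r : ℝ) : ℝ :=
  D.nu ^ (-((K : ℝ) + D.N - D.M) / D.N) *
    ∑ w ∈ D.indexSet K, D.hatP ϰ w.1 w.2.1 w.2.2.1 w.2.2.2 * r ^ w.2.2.2

/-- `𝓠_K(r)` -/
def calQ (ϰ K : ℕ) (r : ℝ) : ℝ :=
  D.nu ^ (-((K : ℝ) + D.M) / D.N) *
    ∑ w ∈ D.indexSet K, D.hatQ ϰ w.1 w.2.1 w.2.2.1 w.2.2.2 * r ^ w.2.2.2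

/-- `𝓖_K(r, θ, ζ)` -/
def calG (ϰ K : ℕ) (r θ ζ : ℝ) : ℝ :=
  D.nu ^ (-((K : ℝ) + 2 * D.M) / D.N) *
    ∑ w ∈ D.indexSet K, D.hatG ϰ w.1 w.2.1 w.2.2.1 w.2.2.2 θ ζ * r ^ w.2.2.2

/-- `𝓐_K = 𝓕_K + 𝓟_{K+2M-N} + δ_{K,N-M} (M/N) r`, with `𝓟_i = 0` for `i < 0`. -/
def calA (ϰ K : ℕ) (r θ ζ : ℝ) : ℝ :=
  D.calF ϰ K r θ ζ
    + (if D.N ≤ K + 2 * D.M then D.calP ϰ (K + 2 * D.M - D.N) r else 0)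
    + (if K + D.M = D.N then (D.M : ℝ) / D.N * r else 0)

/-- `𝓑_K = 𝓠_K r + 𝓖_{K-M}`, with `𝓖_i = 0` for `i < 0`. -/
def calB (ϰ K : ℕ) (r θ ζ : ℝ) : ℝ :=
  D.calQ ϰ K r * r + (if D.M ≤ K then D.calG ϰ (K - D.M) r θ ζ else 0)

end Data

/-! ## Averaging -/

/-- The functions `Λ_K(r, θ)`, `Ω_K(r, θ)`, `ρ_K(r, θ, ζ)`, `ψ_K(r, θ, ζ)` of one order. -/
structure AvgOrder where
  Lam : ℝ → ℝ → ℝ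
  Om : ℝ → ℝ → ℝ
  rho : ℝ → ℝ → ℝ → ℝ
  psi : ℝ → ℝ → ℝ → ℝ

/-- The mean value over `[0, 2πϰ]`. -/
def mean (ϰ : ℕ) (f : ℝ → ℝ) : ℝ :=
  1 / (2 * Real.pi * ϰ) * ∫ ζ in (0 : ℝ)..(2 * Real.pi * ϰ), f ζ

/-- The primitive with mean value zero of `f` minus its mean value. -/
def zeroMeanPrimitive (ϰ : ℕ) (f : ℝ → ℝ) (ζ : ℝ) : ℝ :=
  (∫ v in (0 : ℝ)..ζ, (f v - mean ϰ f))
    - mean ϰ fun ζ' => ∫ v in (0 : ℝ)..ζ', (f v - mean ϰ f)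

/-- The coefficient of `η^K` in
`T(r + ∑_i η^(M+i) ρ_i, θ + ∑_i η^(M+i) ψ_i, η) - T(r, θ, η)`, where `T = ∑_j η^j T_j(r, θ)`, by the
Taylor formula; only `T_j`, `ρ_j`, `ψ_j` with `j ≤ K - M` enter if `M ≥ 1`. -/
def taylorTerm (M K : ℕ) (T : ℕ → ℝ → ℝ → ℝ) (ρ ψ : ℕ → ℝ) (r θ : ℝ) : ℝ :=
  ∑ m ∈ Finset.Icc 1 K, ∑ j ∈ Finset.range (K + 1),
    if m * M + j ≤ K then
      ∑ ab ∈ Finset.HasAntidiagonal.antidiagonal m,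
        1 / ((ab.1.factorial : ℝ) * ab.2.factorial)
          * iteratedDeriv ab.1 (fun r' => iteratedDeriv ab.2 (fun θ' => T j r' θ') θ) r
          * PowerSeries.coeff (K - m * M - j)
              (PowerSeries.mk ρ ^ ab.1 * PowerSeries.mk ψ ^ ab.2)
    else 0

namespace Data

variable (D : Data)

/-- The coefficient of `τ^(-(M+K)/N)` in
`(τ^(-M/N) (𝓐 ∂_r + 𝓑 ∂_θ) + ∂_τ) ∑_i τ^(-(M+i)/N) χ_i`, where `∂_τ` acts on the powers only, minus
the Taylor contribution of the averaged right-hand side `T`. -/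
def correction (ϰ K : ℕ) (χ : ℕ → ℝ → ℝ → ℝ → ℝ) (T : ℕ → ℝ → ℝ → ℝ)
    (ρ ψ : ℕ → ℝ → ℝ → ℝ → ℝ) (r θ ζ : ℝ) : ℝ :=
  (if D.M ≤ K then
      ∑ ij ∈ Finset.HasAntidiagonal.antidiagonal (K - D.M),
        (D.calA ϰ ij.1 r θ ζ * deriv (fun r' => χ ij.2 r' θ ζ) r
          + D.calB ϰ ij.1 r θ ζ * deriv (fun θ' => χ ij.2 r θ' ζ) θ)
    else 0)
  + (if D.N ≤ K then ((D.N : ℝ) - D.M - K) / D.N * χ (K - D.N) r θ ζ else 0)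
  - taylorTerm D.M K T (fun i => ρ i r θ ζ) (fun i => ψ i r θ ζ) r θ

/-- The order `K` of the averaging procedure. The change of variables
`R = r + ∑ τ^(-(M+K)/N) ρ_K(r, θ, ζ)`, `Ψ = θ + ∑ τ^(-(M+K)/N) ψ_K(r, θ, ζ)`, `ζ = ϑ τ`, takes
`r' = τ^(-M/N) ∑ τ^(-K/N) 𝓐_K`, `θ' = τ^(-M/N) ∑ τ^(-K/N) 𝓑_K` into
`R' = ∑ τ^(-(M+K)/N) Λ_K(R, Ψ)`, `Ψ' = ∑ τ^(-(M+K)/N) Ω_K(R, Ψ)`. At order `K` this reads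
`ϑ ∂_ζ ρ_K = Λ_K - 𝓐_K - 𝔄_K`, `ϑ ∂_ζ ψ_K = Ω_K - 𝓑_K - 𝔅_K`, where `𝔄_K` and `𝔅_K` are given by
`correction`; `Λ_K`, `Ω_K` are the mean values of `𝓐_K + 𝔄_K`, `𝓑_K + 𝔅_K`, and `ρ_K`, `ψ_K` have
mean value zero. -/
def averagingStep (ϰ K : ℕ) (c : ℕ → AvgOrder) : AvgOrder :=
  let a : ℝ → ℝ → ℝ → ℝ := fun r θ ζ => D.calA ϰ K r θ ζ
    + D.correction ϰ K (fun i => (c i).rho) (fun i => (c i).Lam)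
        (fun i => (c i).rho) (fun i => (c i).psi) r θ ζ
  let b : ℝ → ℝ → ℝ → ℝ := fun r θ ζ => D.calB ϰ K r θ ζ
    + D.correction ϰ K (fun i => (c i).psi) (fun i => (c i).Om)
        (fun i => (c i).rho) (fun i => (c i).psi) r θ ζ
  { Lam := fun r θ => mean ϰ fun ζ => a r θ ζ
    Om := fun r θ => mean ϰ fun ζ => b r θ ζ
    rho := fun r θ ζ => -(1 / D.vartheta) * zeroMeanPrimitive ϰ (fun ζ' => a r θ ζ') ζ
    psi := fun r θ ζ => -(1 / D.vartheta) * zeroMeanPrimitive ϰ (fun ζ' => b r θ ζ') ζ }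

/-- The functions `Λ_K`, `Ω_K`, `ρ_K`, `ψ_K` for all `K`. -/
def averaging (ϰ : ℕ) (K : ℕ) : AvgOrder :=
  D.averagingStep ϰ K fun i => if _ : i < K then averaging ϰ i else ⟨0, 0, 0, 0⟩

/-- `Λ_K(ϱ, φ)` -/
def Lambda (ϰ K : ℕ) (ϱ φ : ℝ) : ℝ := (D.averaging ϰ K).Lam ϱ φ

/-- `Ω_K(ϱ, φ)` -/
def Omega (ϰ K : ℕ) (ϱ φ : ℝ) : ℝ := (D.averaging ϰ K).Om ϱ φ

/-- `(ϱ, φ)` solves the truncated averaged system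
`ϱ' = ∑_{L ≤ K ≤ n} τ^(-(M+K)/N) Λ_K(ϱ, φ)`, `φ' = ∑_{K ≤ n} τ^(-(M+K)/N) Ω_K(ϱ, φ)` for
`τ > τ₀`. -/
def IsTruncatedSolution (ϰ L n : ℕ) (τ₀ : ℝ) (ϱ φ : ℝ → ℝ) : Prop :=
  ∀ τ, τ₀ < τ →
    HasDerivAt ϱ (∑ K ∈ Finset.Icc L n,
      τ ^ (-((D.M : ℝ) + K) / D.N) * D.Lambda ϰ K (ϱ τ) (φ τ)) τ ∧
    HasDerivAt φ (∑ K ∈ Finset.range (n + 1),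
      τ ^ (-((D.M : ℝ) + K) / D.N) * D.Omega ϰ K (ϱ τ) (φ τ)) τ

end Data

/-! ## Facts about the definitions

The rest of the file is not used by any definition. It shows that `M` and `N` involve no rounding,
that the orbit of the leading coefficients exists, that the coefficients `X_j`, `Y_j`, `ω_j` are the
formal solution (`energyAngle_formal_solution`), and that `zInv` solves its equation. -/

def clamp (t : ℝ) : ℝ := max (-2) (min t 2)

theorem clamp_of_abs_le {t : ℝ} (ht : |t| ≤ 2) : clamp t = t := by
  have := abs_le.1 ht
  simp [clamp, min_eq_left this.2, max_eq_right this.1]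

theorem abs_clamp_le (t : ℝ) : |clamp t| ≤ 2 := by
  rw [abs_le]
  exact ⟨le_max_left _ _, max_le (by norm_num) (min_le_right _ _)⟩

theorem lipschitz_clamp : LipschitzWith 1 clamp := by
  unfold clamp
  exact (LipschitzWith.id.min_const 2).const_max (-2)

theorem exists_lipschitz_clamp_pow (m : ℕ) :
    ∃ K : NNReal, LipschitzWith K fun t => clamp t ^ m := by
  have h : LocallyLipschitz fun t : ℝ => t ^ m :=
    (contDiff_id.pow m : ContDiff ℝ 1 fun t : ℝ => t ^ m).locallyLipschitz
  obtain ⟨K, hK⟩ := (h.locallyLipschitzOn (s := Set.Icc (-2) 2)).exists_lipschitzOnWith_of_compact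
    isCompact_Icc
  refine ⟨K * 1, ?_⟩
  rw [← lipschitzOnWith_univ]
  exact LipschitzOnWith.comp hK lipschitz_clamp.lipschitzOnWith
    fun t _ => abs_le.1 (abs_clamp_le t)

def clampPot (m : ℕ) (x : ℝ) : ℝ := ∫ t in (0 : ℝ)..x, clamp t ^ m

theorem hasDerivAt_clampPot (m : ℕ) (x : ℝ) : HasDerivAt (clampPot m) (clamp x ^ m) x :=
  intervalIntegral.integral_hasDerivAt_right
    ((lipschitz_clamp.continuous.pow m).intervalIntegrable _ _)
    ((lipschitz_clamp.continuous.pow m).stronglyMeasurableAtFilter _ _)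
    (lipschitz_clamp.continuous.pow m).continuousAt

theorem clampPot_of_abs_le {m : ℕ} {x : ℝ} (hx : |x| ≤ 2) :
    clampPot m x = x ^ (m + 1) / (m + 1) := by
  have : clampPot m x = ∫ t in (0 : ℝ)..x, t ^ m := by
    refine intervalIntegral.integral_congr fun t ht => ?_
    have : |t| ≤ 2 := by
      rw [abs_le] at hx ⊢
      rcases Set.mem_uIcc.1 ht with h | h <;> constructor <;> linarith [h.1, h.2]
    simp only [clamp_of_abs_le this]
  rw [this, integral_pow]
  simp

theorem clampPot_le {m : ℕ} (hm : Odd m) {x : ℝ} (hx : 2 < |x|) :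
    (2 : ℝ) ^ (m + 1) / (m + 1) ≤ clampPot m x := by
  have hc : Continuous (clampPot m) :=
    continuous_iff_continuousAt.2 fun x => (hasDerivAt_clampPot m x).continuousAt
  rcases lt_abs.1 hx with h | h
  · have h2 : clampPot m 2 = (2 : ℝ) ^ (m + 1) / (m + 1) := clampPot_of_abs_le (by norm_num)
    rw [← h2]
    refine monotoneOn_of_deriv_nonneg (convex_Ici 0) hc.continuousOn
      (fun x _ => (hasDerivAt_clampPot m x).differentiableAt.differentiableWithinAt)
      (fun x hx => ?_) (by norm_num) (by simp; linarith) h.le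
    rw [(hasDerivAt_clampPot m x).deriv]
    rw [interior_Ici, Set.mem_Ioi] at hx
    exact pow_nonneg (le_max_of_le_right (le_min hx.le (by norm_num))) _
  · have h2 : clampPot m (-2) = (2 : ℝ) ^ (m + 1) / (m + 1) := by
      rw [clampPot_of_abs_le (by norm_num), (hm.add_one).neg_pow]
    rw [← h2]
    refine antitoneOn_of_deriv_nonpos (convex_Iic 0) hc.continuousOn
      (fun x _ => (hasDerivAt_clampPot m x).differentiableAt.differentiableWithinAt)
      (fun x hx => ?_) (by simp; linarith) (by norm_num) (by linarith)
    rw [(hasDerivAt_clampPot m x).deriv]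
    rw [interior_Iic, Set.mem_Iio] at hx
    exact hm.pow_nonpos (max_le (by norm_num) ((min_le_left _ _).trans hx.le))

theorem clampPot_nonneg {m : ℕ} (hm : Odd m) (x : ℝ) : 0 ≤ clampPot m x := by
  rcases le_or_gt |x| 2 with h | h
  · rw [clampPot_of_abs_le h]
    have := hm.add_one.pow_nonneg x
    positivity
  · exact le_trans (by positivity) (clampPot_le hm h)

theorem exists_bounded_orbit (m : ℕ) (hm : Odd m) (w x0 : ℝ) (hx0 : |x0| ≤ 2)
    (hE : x0 ^ (m + 1) / (m + 1) ≤ 1) (T : ℝ) (hT : 0 < T) :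
    ∃ z : ℝ → ℝ × ℝ, z 0 = (x0, 0) ∧ ∀ t ∈ Set.Ioo (-T) T,
      HasDerivAt z ((z t).2 / w, -(z t).1 ^ m / w) t ∧ ‖z t‖ ≤ 2 := by
  obtain ⟨K, hK⟩ := exists_lipschitz_clamp_pow m
  set v : ℝ × ℝ → ℝ × ℝ := fun z => (clamp z.2 / w, -(clamp z.1) ^ m / w) with hv
  have hvL : ∃ K', LipschitzWith K' v := by
    have h1 : LipschitzWith (‖w⁻¹‖₊ * (1 * 1)) fun z : ℝ × ℝ => w⁻¹ • clamp z.2 :=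
      (lipschitzWith_smul w⁻¹).comp (lipschitz_clamp.comp LipschitzWith.prod_snd)
    have h2 : LipschitzWith (‖w⁻¹‖₊ * (K * 1)) fun z : ℝ × ℝ => w⁻¹ • (clamp z.1) ^ m :=
      (lipschitzWith_smul w⁻¹).comp (hK.comp LipschitzWith.prod_fst)
    have h3 := h1.prodMk h2.neg
    have h4 : v = fun z => (w⁻¹ • clamp z.2, (-fun z : ℝ × ℝ => w⁻¹ • clamp z.1 ^ m) z) := by
      funext z
      simp [hv, div_eq_inv_mul]
    rw [← h4] at h3
    exact ⟨_, h3⟩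
  obtain ⟨K', hK'⟩ := hvL
  have hvb : ∀ z, ‖v z‖ ≤ ((2 + 2 ^ m) * ‖w⁻¹‖₊ : NNReal) := by
    intro z
    have h1 := abs_clamp_le z.2
    have h2 : |clamp z.1| ^ m ≤ 2 ^ m := pow_le_pow_left₀ (abs_nonneg _) (abs_clamp_le z.1) m
    have h3 : 0 ≤ |w|⁻¹ := by positivity
    have h4 : (0 : ℝ) ≤ 2 ^ m := by positivity
    simp only [hv, Prod.norm_def, Real.norm_eq_abs, div_eq_mul_inv, abs_mul, abs_neg, abs_pow,
      NNReal.coe_mul, NNReal.coe_add, NNReal.coe_pow, NNReal.coe_ofNat, coe_nnnorm, abs_inv]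
    refine max_le ?_ ?_ <;> refine mul_le_mul_of_nonneg_right ?_ h3 <;> linarith
  have hPL : IsPicardLindelof (fun _ => v) (tmin := -T) (tmax := T)
      ⟨0, by constructor <;> linarith⟩ (x0, (0 : ℝ))
      ((2 + 2 ^ m) * ‖w⁻¹‖₊ * ⟨T, hT.le⟩) 0 ((2 + 2 ^ m) * ‖w⁻¹‖₊) K' :=
    { lipschitzOnWith := fun _ _ => hK'.lipschitzOnWith
      continuousOn := fun _ _ => continuousOn_const
      norm_le := fun _ _ x _ => hvb x
      mul_max_le := by simp; exact le_rfl }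
  obtain ⟨z, hz0, hz⟩ := hPL.exists_eq_forall_mem_Icc_hasDerivWithinAt₀
  have hz' : ∀ t ∈ Set.Ioo (-T) T, HasDerivAt z (v (z t)) t := fun t ht =>
    (hz t (Set.Ioo_subset_Icc_self ht)).hasDerivAt (Icc_mem_nhds ht.1 ht.2)
  have h0 : (0 : ℝ) ∈ Set.Ioo (-T) T := by constructor <;> linarith
  have hH : ∀ t ∈ Set.Ioo (-T) T,
      HasDerivAt (fun t => clampPot 1 (z t).2 + clampPot m (z t).1) 0 t := by
    intro t ht
    have e1 := (hasDerivAt_clampPot 1 (z t).2).comp t (hz' t ht).snd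
    have e2 := (hasDerivAt_clampPot m (z t).1).comp t (hz' t ht).fst
    convert! e1.add e2 using 1
    simp only [hv]
    ring
  have hE' : ∀ t ∈ Set.Ioo (-T) T, clampPot 1 (z t).2 + clampPot m (z t).1 ≤ 1 := by
    intro t ht
    have := isOpen_Ioo.is_const_of_deriv_eq_zero (isPreconnected_Ioo)
      (fun t ht => (hH t ht).differentiableAt.differentiableWithinAt)
      (fun t ht => (hH t ht).deriv) ht h0
    rw [this, hz0]
    simp only [clampPot_of_abs_le hx0]
    simpa [clampPot] using hE
  have hbig : ∀ k : ℕ, (1 : ℝ) < 2 ^ (k + 1) / (k + 1) := by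
    intro k
    rw [lt_div_iff₀ (by positivity), one_mul]
    exact_mod_cast Nat.lt_two_pow_self
  refine ⟨z, hz0, fun t ht => ?_⟩
  have hy : |(z t).2| ≤ 2 := by
    by_contra! hlt
    linarith [clampPot_le odd_one hlt, clampPot_nonneg hm (z t).1, hE' t ht, hbig 1]
  have hx : |(z t).1| ≤ 2 := by
    by_contra! hlt
    linarith [clampPot_le hm hlt, clampPot_nonneg odd_one (z t).2, hE' t ht, hbig m]
  refine ⟨?_, max_le hx hy⟩
  have := hz' t ht
  simpa only [hv, clamp_of_abs_le hx, clamp_of_abs_le hy] using this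

theorem exists_global_orbit (m : ℕ) (hm : Odd m) (w x0 : ℝ) (hx0 : |x0| ≤ 2)
    (hE : x0 ^ (m + 1) / (m + 1) ≤ 1) :
    ∃ x y : ℝ → ℝ, x 0 = x0 ∧ y 0 = 0 ∧ ∀ t,
      HasDerivAt x (y t / w) t ∧ HasDerivAt y (-x t ^ m / w) t := by
  have hT : ∀ t : ℝ, 0 < |t| + 1 := fun t => by positivity
  choose! z hz0 hz using exists_bounded_orbit m hm w x0 hx0 hE
  -- two of these solutions agree where both are defined
  have hagree : ∀ T T' : ℝ, 0 < T → T ≤ T' → Set.EqOn (z T) (z T') (Set.Ioo (-T) T) := by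
    intro T T' hT hTT'
    have hT' := hT.trans_le hTT'
    have hsub : Set.Ioo (-T) T ⊆ Set.Ioo (-T') T' := Set.Ioo_subset_Ioo (by linarith) hTT'
    have hC : ContDiff ℝ 1 fun z : ℝ × ℝ => (z.2 / w, -z.1 ^ m / w) := by fun_prop
    obtain ⟨K, hK⟩ := (hC.locallyLipschitz.locallyLipschitzOn
      (s := Metric.closedBall 0 2)).exists_lipschitzOnWith_of_compact (isCompact_closedBall _ _)
    refine ODE_solution_unique_of_mem_Ioo (v := fun _ z => (z.2 / w, -z.1 ^ m / w))
      (s := fun _ => Metric.closedBall 0 2) (K := K) (t₀ := 0) (fun _ _ => hK)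
      (by constructor <;> linarith) (fun t ht => ?_) (fun t ht => ?_) (by rw [hz0 T hT, hz0 T' hT'])
    · simpa using hz T hT t ht
    · simpa using hz T' hT' t (hsub ht)
  have hglob : ∀ t, HasDerivAt (fun t => z (|t| + 1) t)
      ((z (|t| + 1) t).2 / w, -(z (|t| + 1) t).1 ^ m / w) t := by
    intro t
    have ht : t ∈ Set.Ioo (-(|t| + 1)) (|t| + 1) := by
      have := neg_abs_le t; have := le_abs_self t; constructor <;> linarith
    refine ((hz _ (hT t) t ht).1).congr_of_eventuallyEq ?_
    filter_upwards [isOpen_Ioo.mem_nhds ht] with r hr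
    have hr' : r ∈ Set.Ioo (-(|r| + 1)) (|r| + 1) := by
      have := neg_abs_le r; have := le_abs_self r; constructor <;> linarith
    rcases le_total (|t| + 1) (|r| + 1) with h | h
    · exact (hagree _ _ (hT t) h hr).symm
    · exact hagree _ _ (hT r) h hr'
  refine ⟨fun t => (z (|t| + 1) t).1, fun t => (z (|t| + 1) t).2, ?_, ?_, fun t => ⟨?_, ?_⟩⟩
  · simp [hz0]
  · simp [hz0]
  · exact (hglob t).fst
  · exact (hglob t).snd

namespace Data

variable (D : Data)

theorem cast_M (hD : D.Admissible) (hσ : D.SigmaCondition) :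
    (D.M : ℝ) = 2 * D.mu * D.q * ((D.h : ℝ) - 1) := by
  have hh : (2 : ℝ) ≤ D.h := by exact_mod_cast hD.two_le_h
  have hq : (1 : ℝ) ≤ D.q := by exact_mod_cast hD.one_le_a.trans hD.a_le_q
  have hh' : (D.h : ℝ) - 1 ≠ 0 := by linarith
  have hμ : 0 < D.mu := by have := hσ.2; unfold mu; linarith
  have hpos : 0 ≤ 2 * D.mu * D.q * ((D.h : ℝ) - 1) := by
    have : 0 ≤ (D.h : ℝ) - 1 := by linarith
    positivity
  have hz : 2 * D.mu * D.q * ((D.h : ℝ) - 1)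
      = (((D.a + D.b : ℤ) * (D.h - 1) - D.b * ((D.l - 1) * (D.h - 1) + (D.p - 1)) : ℤ) : ℝ) := by
    unfold mu sigma
    push_cast
    field_simp
    ring
  rw [hz] at hpos
  have h0 : (0 : ℤ) ≤ (D.a + D.b : ℤ) * (D.h - 1) - D.b * ((D.l - 1) * (D.h - 1) + (D.p - 1)) := by
    exact_mod_cast hpos
  obtain ⟨m, hm⟩ := Int.eq_ofNat_of_zero_le h0
  unfold M
  rw [hz, hm]
  simp

theorem cast_N (hD : D.Admissible) :
    (D.N : ℝ) = 2 * D.nu * D.q * ((D.h : ℝ) - 1) := by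
  have hq : (1 : ℝ) ≤ D.q := by exact_mod_cast hD.one_le_a.trans hD.a_le_q
  obtain ⟨n, hn⟩ := Nat.exists_eq_add_of_le (one_le_two.trans hD.two_le_h)
  have hz : 2 * D.nu * D.q * ((D.h : ℝ) - 1) = ((2 * (D.q + D.b) * n : ℕ) : ℝ) := by
    unfold nu mu
    rw [hn]
    push_cast
    field_simp
    ring
  unfold N
  rw [hz, Nat.floor_natCast]

theorem exists_isLeadingOrbit (hD : D.Admissible) : ∃ z, D.IsLeadingOrbit z := by
  have hh := hD.two_le_h
  have hh0 : (0 : ℝ) < 2 * D.h := by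
    have : (2 : ℝ) ≤ D.h := by exact_mod_cast hh
    linarith
  have hp : ((2 * D.h : ℝ) ^ (1 / (2 * D.h : ℝ))) ^ (2 * D.h) = 2 * D.h := by
    rw [← Real.rpow_natCast, ← Real.rpow_mul hh0.le]
    push_cast
    rw [one_div_mul_cancel hh0.ne', Real.rpow_one]
  have h0 : 0 ≤ (2 * D.h : ℝ) ^ (1 / (2 * D.h : ℝ)) := by positivity
  have hs : 2 * D.h - 1 + 1 = 2 * D.h := by omega
  have hc : ((2 * D.h - 1 : ℕ) : ℝ) + 1 = 2 * D.h := by exact_mod_cast hs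
  obtain ⟨x, y, hx, hy, hxy⟩ := exists_global_orbit (2 * D.h - 1)
    (Nat.Even.sub_odd (by omega) (even_two_mul _) odd_one) D.omega0
    ((2 * D.h : ℝ) ^ (1 / (2 * D.h : ℝ)))
    (by
      rw [abs_of_nonneg h0]
      refine le_of_pow_le_pow_left₀ (n := 2 * D.h) (by omega) (by norm_num) ?_
      rw [hp]
      exact_mod_cast Nat.lt_two_pow_self.le)
    (by rw [hs, hc, hp, div_self hh0.ne'])
  exact ⟨(x, y), hx, hy, hxy⟩

theorem isLeadingOrbit (hD : D.Admissible) : D.IsLeadingOrbit D.leadingOrbit :=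
  Classical.epsilon_spec (D.exists_isLeadingOrbit hD)

end Data

theorem contDiff_of_hasDerivAt {f f' : ℝ → ℝ} (h : ∀ x, HasDerivAt f (f' x) x)
    (hf' : ContDiff ℝ ∞ f') : ContDiff ℝ ∞ f := by
  rw [contDiff_infty_iff_deriv]
  refine ⟨fun x => (h x).differentiableAt, ?_⟩
  rwa [show deriv f = f' from funext fun x => (h x).deriv]

theorem contDiff_of_hasDerivAt_pair (P Q : ℝ → ℝ → ℝ)
    (hP : ContDiff ℝ ∞ fun z : ℝ × ℝ => P z.1 z.2) (hQ : ContDiff ℝ ∞ fun z : ℝ × ℝ => Q z.1 z.2)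
    {x y : ℝ → ℝ}
    (h : ∀ t, HasDerivAt x (P (x t) (y t)) t ∧ HasDerivAt y (Q (x t) (y t)) t) :
    ContDiff ℝ ∞ x ∧ ContDiff ℝ ∞ y := by
  have key : ∀ n : ℕ, ContDiff ℝ n x ∧ ContDiff ℝ n y := by
    intro n
    induction n with
    | zero =>
      simp only [CharP.cast_eq_zero, contDiff_zero]
      exact ⟨continuous_iff_continuousAt.2 fun t => (h t).1.continuousAt,
        continuous_iff_continuousAt.2 fun t => (h t).2.continuousAt⟩
    | succ n ih =>
      have e1 : deriv x = fun t => P (x t) (y t) := funext fun t => (h t).1.deriv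
      have e2 : deriv y = fun t => Q (x t) (y t) := funext fun t => (h t).2.deriv
      push_cast
      rw [contDiff_succ_iff_deriv, contDiff_succ_iff_deriv, e1, e2]
      have hn : ((n : ℕ∞) : WithTop ℕ∞) ≤ ∞ := by exact_mod_cast le_top
      refine ⟨⟨fun t => (h t).1.differentiableAt, by simp, ?_⟩,
        ⟨fun t => (h t).2.differentiableAt, by simp, ?_⟩⟩
      · exact (hP.of_le hn).comp (ih.1.prodMk ih.2)
      · exact (hQ.of_le hn).comp (ih.1.prodMk ih.2)
  exact ⟨contDiff_infty.2 fun n => (key n).1, contDiff_infty.2 fun n => (key n).2⟩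

/-! series with smooth coefficients -/

def SmoothSeries (F : ℝ → ℝ⟦X⟧) : Prop := ∀ n, ContDiff ℝ ∞ fun φ => PowerSeries.coeff n (F φ)

namespace SmoothSeries
variable {F G : ℝ → ℝ⟦X⟧}
theorem const (f : ℝ⟦X⟧) : SmoothSeries fun _ => f := fun _ => contDiff_const
theorem add (hF : SmoothSeries F) (hG : SmoothSeries G) : SmoothSeries fun φ => F φ + G φ :=
  fun n => by simpa using (hF n).add (hG n)
theorem mul (hF : SmoothSeries F) (hG : SmoothSeries G) : SmoothSeries fun φ => F φ * G φ :=
  fun n => by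
    simp only [PowerSeries.coeff_mul]
    exact ContDiff.sum fun i _ => (hF _).mul (hG _)
theorem pow (hF : SmoothSeries F) (k : ℕ) : SmoothSeries fun φ => F φ ^ k := by
  induction k with
  | zero => simpa using const 1
  | succ k ih => simpa only [pow_succ] using ih.mul hF
theorem sum {ι : Type*} {s : Finset ι} {F : ι → ℝ → ℝ⟦X⟧} (h : ∀ i ∈ s, SmoothSeries (F i)) :
    SmoothSeries fun φ => ∑ i ∈ s, F i φ := fun n => by
  simp only [map_sum]
  exact ContDiff.sum fun i hi => h i hi n
end SmoothSeries

/-! coefficientwise derivative -/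

def HasSeriesDeriv (F : ℝ → ℝ⟦X⟧) (F' : ℝ⟦X⟧) (φ : ℝ) : Prop :=
  ∀ n, HasDerivAt (fun v => PowerSeries.coeff n (F v)) (PowerSeries.coeff n F') φ

namespace HasSeriesDeriv
variable {F G : ℝ → ℝ⟦X⟧} {F' G' : ℝ⟦X⟧} {φ : ℝ}
theorem const (f : ℝ⟦X⟧) : HasSeriesDeriv (fun _ => f) 0 φ := fun n => by
  simpa using hasDerivAt_const φ _
theorem add (hF : HasSeriesDeriv F F' φ) (hG : HasSeriesDeriv G G' φ) :
    HasSeriesDeriv (fun φ => F φ + G φ) (F' + G') φ :=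
  fun n => by simpa using (hF n).fun_add (hG n)
theorem mul (hF : HasSeriesDeriv F F' φ) (hG : HasSeriesDeriv G G' φ) :
    HasSeriesDeriv (fun φ => F φ * G φ) (F' * G φ + F φ * G') φ :=
  fun n => by
    simp only [PowerSeries.coeff_mul, map_add, ← Finset.sum_add_distrib]
    exact HasDerivAt.fun_sum fun i _ => (hF _).mul (hG _)
theorem pow (hF : HasSeriesDeriv F F' φ) (k : ℕ) :
    HasSeriesDeriv (fun φ => F φ ^ k) (k * F φ ^ (k - 1) * F') φ := by
  induction k with
  | zero => simpa using const 1
  | succ k ih =>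
    have := ih.mul hF
    have e : (fun φ => F φ ^ (k + 1)) = fun φ => F φ ^ k * F φ := funext fun φ => pow_succ _ _
    rw [e]
    convert! this using 1
    rcases k with - | k
    · simp
    · push_cast
      ring
theorem sum {ι : Type*} {s : Finset ι} {F : ι → ℝ → ℝ⟦X⟧} {F' : ι → ℝ⟦X⟧}
    (h : ∀ i ∈ s, HasSeriesDeriv (F i) (F' i) φ) :
    HasSeriesDeriv (fun φ => ∑ i ∈ s, F i φ) (∑ i ∈ s, F' i) φ := fun n => by
  simp only [map_sum]
  exact HasDerivAt.fun_sum fun i hi => h i hi n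
end HasSeriesDeriv

theorem coeff_pow_perturb {j n : ℕ} (hj : 1 ≤ j) (hn : n ≤ j) (x r : ℝ⟦X⟧) (k : ℕ) :
    PowerSeries.coeff n ((x + PowerSeries.X ^ j * r) ^ k) = PowerSeries.coeff n (x ^ k)
      + if n = j then k * PowerSeries.coeff 0 x ^ (k - 1) * PowerSeries.coeff 0 r else 0 := by
  obtain ⟨K, hK⟩ := Polynomial.powAddExpansion x (PowerSeries.X ^ j * r) k
  rw [hK]
  have e : x ^ k + (k : ℝ⟦X⟧) * x ^ (k - 1) * (PowerSeries.X ^ j * r) + K * (PowerSeries.X ^ j * r) ^ 2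
      = x ^ k + PowerSeries.X ^ j * ((k : ℝ⟦X⟧) * x ^ (k - 1) * r + PowerSeries.X ^ j * (K * r ^ 2)) := by
    ring
  have hn' : (j ≤ n) ↔ n = j := by omega
  rw [e, map_add, PowerSeries.coeff_X_pow_mul']
  simp only [hn']
  congr 1
  split_ifs with h
  · subst h
    simp only [Nat.sub_self, map_add, PowerSeries.coeff_zero_eq_constantCoeff, map_mul, map_pow,
      map_natCast, PowerSeries.constantCoeff_X]
    rw [zero_pow (by omega)]
    ring
  · rfl

theorem coeff_mul_of_low {j : ℕ} {A : ℝ⟦X⟧} (h : ∀ i < j, PowerSeries.coeff i A = 0) (B : ℝ⟦X⟧) :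
    PowerSeries.coeff j (B * A) = PowerSeries.coeff 0 B * PowerSeries.coeff j A := by
  obtain ⟨A', rfl⟩ := PowerSeries.X_pow_dvd_iff.2 h
  rw [mul_left_comm, PowerSeries.coeff_X_pow_mul', PowerSeries.coeff_X_pow_mul']
  simp

namespace Data

open EnergyAngle
variable (D : Data)

theorem coeff_potSeries (hD : D.Admissible) {j n : ℕ} (hj : 1 ≤ j) (hn : n ≤ j) (x r : ℝ⟦X⟧) :
    PowerSeries.coeff n (D.potSeries (x + PowerSeries.X ^ j * r)) =
      PowerSeries.coeff n (D.potSeries x)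
      + if n = j then PowerSeries.coeff 0 x ^ (2 * D.h - 1) * PowerSeries.coeff 0 r else 0 := by
  have hh := hD.two_le_h
  have hh0 : (D.h : ℝ) ≠ 0 := by norm_cast; omega
  simp only [potSeries, map_add, map_sum, mul_assoc, PowerSeries.coeff_C_mul]
  rw [coeff_pow_perturb hj hn, add_right_comm, mul_add]
  congr 1
  · congr 1
    split_ifs
    · push_cast; field_simp
    · simp
  · refine Finset.sum_congr rfl fun i hi => ?_
    rw [Finset.mem_Icc] at hi
    rw [PowerSeries.coeff_X_pow_mul', PowerSeries.coeff_X_pow_mul']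
    split_ifs with h
    · rw [coeff_pow_perturb hj (by omega), if_neg (by omega), add_zero]
    · rfl

theorem coeff_forceSeries {j n : ℕ} (hj : 1 ≤ j) (hn : n ≤ j) (x r : ℝ⟦X⟧) :
    PowerSeries.coeff n (D.forceSeries (x + PowerSeries.X ^ j * r)) =
      PowerSeries.coeff n (D.forceSeries x)
      + if n = j then (2 * D.h - 1 : ℕ) * PowerSeries.coeff 0 x ^ (2 * D.h - 2)
          * PowerSeries.coeff 0 r else 0 := by
  simp only [forceSeries, map_add, map_sum, mul_assoc, PowerSeries.coeff_C_mul]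
  rw [coeff_pow_perturb hj hn, add_right_comm]
  simp only [mul_assoc, Nat.sub_sub]
  congr 2
  · refine Finset.sum_congr rfl fun i hi => ?_
    rw [Finset.mem_Icc] at hi
    rw [PowerSeries.coeff_X_pow_mul', PowerSeries.coeff_X_pow_mul']
    split_ifs with h
    · rw [coeff_pow_perturb hj (by omega), if_neg (by omega), add_zero]
    · rfl

theorem smooth_potSeries {F : ℝ → ℝ⟦X⟧} (hF : SmoothSeries F) :
    SmoothSeries fun φ => D.potSeries (F φ) :=
  ((SmoothSeries.const _).mul (hF.pow _)).add
    (SmoothSeries.sum fun _ _ => (SmoothSeries.const _).mul (hF.pow _))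

theorem smooth_forceSeries {F : ℝ → ℝ⟦X⟧} (hF : SmoothSeries F) :
    SmoothSeries fun φ => D.forceSeries (F φ) :=
  (hF.pow _).add (SmoothSeries.sum fun _ _ => (SmoothSeries.const _).mul (hF.pow _))

theorem hasSeriesDeriv_potSeries (hD : D.Admissible) {F : ℝ → ℝ⟦X⟧} {F' : ℝ⟦X⟧} {φ : ℝ}
    (hF : HasSeriesDeriv F F' φ) :
    HasSeriesDeriv (fun φ => D.potSeries (F φ)) (D.forceSeries (F φ) * F') φ := by
  have hh := hD.two_le_h
  have hh0 : (D.h : ℝ) ≠ 0 := by norm_cast; omega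
  have h1 := ((HasSeriesDeriv.const (PowerSeries.C (1 / (2 * D.h : ℝ)))).mul (hF.pow (2 * D.h))).add
    (HasSeriesDeriv.sum (s := Finset.Icc 1 (2 * D.h - 1)) fun i _ =>
      (HasSeriesDeriv.const (PowerSeries.C (D.u i) * PowerSeries.X ^ (2 * D.h - i))).mul
        (hF.pow i))
  convert! h1 using 1
  simp only [forceSeries, zero_mul, zero_add, add_mul, Finset.sum_mul]
  congr 1
  · rw [← map_natCast (PowerSeries.C (R := ℝ)), ← mul_assoc, ← mul_assoc, ← map_mul]
    push_cast
    rw [one_div_mul_cancel (by positivity), map_one, one_mul]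
  · refine Finset.sum_congr rfl fun i _ => ?_
    rw [← map_natCast (PowerSeries.C (R := ℝ)), map_mul]
    ring

theorem kappa_pos (hD : D.Admissible) : 0 < D.kappa := by
  have hh := hD.two_le_h
  have hsq : ∀ x ∈ Set.Ioo (-1 : ℝ) 1, x ^ (2 * D.h) ≤ x ^ 2 := fun x hx => by
    have h1 : x ^ 2 ≤ 1 := by nlinarith [hx.1, hx.2]
    rw [pow_mul]
    exact pow_le_of_le_one (sq_nonneg x) h1 (by omega)
  have hlt : ∀ x ∈ Set.Ioo (-1 : ℝ) 1, 0 < 1 - x ^ 2 := fun x hx => by nlinarith [hx.1, hx.2]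
  have hint : IntervalIntegrable (fun x : ℝ => 1 / √(1 - x ^ 2)) MeasureTheory.volume (-1) 1 := by
    refine intervalIntegral.intervalIntegrable_deriv_of_nonneg (g := Real.arcsin)
      Real.continuous_arcsin.continuousOn (fun x hx => ?_) (fun x hx => by positivity)
    simp only [min_eq_left (show (-1 : ℝ) ≤ 1 by norm_num), max_eq_right (show (-1 : ℝ) ≤ 1 by norm_num)] at hx
    exact Real.hasDerivAt_arcsin hx.1.ne' hx.2.ne
  have hint2 : IntervalIntegrable (fun x : ℝ => 1 / √(1 - x ^ (2 * D.h)))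
      MeasureTheory.volume (-1) 1 := by
    rw [intervalIntegrable_iff_integrableOn_Ioo_of_le (by norm_num)] at hint ⊢
    refine hint.mono' (Measurable.aestronglyMeasurable (by fun_prop)) ?_
    rw [MeasureTheory.ae_restrict_iff' measurableSet_Ioo]
    refine Filter.Eventually.of_forall fun x hx => ?_
    rw [Real.norm_of_nonneg (by positivity)]
    have := hlt x hx
    have := hsq x hx
    gcongr
  have := intervalIntegral.intervalIntegral_pos_of_pos_on hint2 (fun x hx => by
    have := hlt x hx
    have := hsq x hx
    have : 0 < 1 - x ^ (2 * D.h) := by linarith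
    positivity) (by norm_num)
  have : (0 : ℝ) < D.h := by exact_mod_cast (by omega : 0 < D.h)
  unfold kappa
  positivity

theorem omega0_pos (hD : D.Admissible) : 0 < D.omega0 :=
  div_pos Real.two_pi_pos (D.kappa_pos hD)

theorem energyAngle_succ (j : ℕ) : D.energyAngle (j + 1) =
    D.energyAngleStep (fun i => if i < j + 1 then D.energyAngle i else ⟨0, 0, 0⟩) (j + 1) := by
  rw [energyAngle]
  simp

/-- the step may be computed with the full sequence -/
theorem energyAngle_eq {j : ℕ} (hj : 1 ≤ j) :
    D.energyAngle j = D.energyAngleStep D.energyAngle j := by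
  obtain ⟨k, rfl⟩ := Nat.exists_eq_add_of_le' hj
  rw [energyAngle_succ]
  set c' : ℕ → EnergyAngle := fun i => if i < k + 1 then D.energyAngle i else ⟨0, 0, 0⟩ with hc'
  have hc : ∀ i < k + 1, c' i = D.energyAngle i := fun i hi => if_pos hi
  have hx : xTrunc c' (k + 1) = xTrunc D.energyAngle (k + 1) := by
    funext φ; ext i
    simp only [xTrunc, PowerSeries.coeff_mk]
    split_ifs with h
    · rw [hc i h]
    · rfl
  have hy : yTrunc c' (k + 1) = yTrunc D.energyAngle (k + 1) := by
    funext φ; ext i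
    simp only [yTrunc, PowerSeries.coeff_mk]
    split_ifs with h
    · rw [hc i h]
    · rfl
  have hJ : D.jTerm c' (k + 1) = D.jTerm D.energyAngle (k + 1) := by
    funext φ; simp only [jTerm, hx, hy]
  have ha : aTerm c' (k + 1) = aTerm D.energyAngle (k + 1) := by
    funext φ
    refine Finset.sum_congr rfl fun i hi => ?_
    rw [Finset.mem_Ico] at hi
    rw [hc i hi.2, hc (k + 1 - i) (by omega)]
  have hb : D.bTerm c' (k + 1) = D.bTerm D.energyAngle (k + 1) := by
    funext φ
    simp only [bTerm, hx]
    congr 1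
    refine Finset.sum_congr rfl fun i hi => ?_
    rw [Finset.mem_Ico] at hi
    rw [hc i hi.2, hc (k + 1 - i) (by omega)]
  have hd : D.phaseDensity c' (k + 1) = D.phaseDensity D.energyAngle (k + 1) := by
    funext φ; simp only [phaseDensity, hJ, ha, hb, hc 0 (Nat.succ_pos k)]
  simp only [energyAngleStep, hd, hJ, hc 0 (Nat.succ_pos k)]

/-- `ω X' = Y`, `ω Y' = -U'(X)`, `Y²/2 + U(X) = 1` at order `j`. -/
structure Order (j : ℕ) : Prop where
  smoothX : ContDiff ℝ ∞ (D.energyAngle j).X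
  smoothY : ContDiff ℝ ∞ (D.energyAngle j).Y
  eqX : ∀ φ, ∑ i ∈ Finset.range (j + 1), (D.energyAngle i).omega * deriv (D.energyAngle (j - i)).X φ
    = (D.energyAngle j).Y φ
  eqY : ∀ φ, ∑ i ∈ Finset.range (j + 1), (D.energyAngle i).omega * deriv (D.energyAngle (j - i)).Y φ
    = -PowerSeries.coeff j (D.forceSeries (D.xSeries φ))
  energy : ∀ φ, PowerSeries.coeff j (PowerSeries.C (1 / 2 : ℝ) * D.ySeries φ ^ 2
    + D.potSeries (D.xSeries φ)) = PowerSeries.coeff j (1 : ℝ⟦X⟧)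

theorem zero_omega : (D.energyAngle 0).omega = D.omega0 := by rw [energyAngle]
theorem zero_X : (D.energyAngle 0).X = D.leadingOrbit.1 := by rw [energyAngle]
theorem zero_Y : (D.energyAngle 0).Y = D.leadingOrbit.2 := by rw [energyAngle]

theorem coeff_zero_potSeries (hD : D.Admissible) (x : ℝ⟦X⟧) : PowerSeries.coeff 0 (D.potSeries x)
    = PowerSeries.coeff 0 x ^ (2 * D.h) / (2 * D.h) := by
  simp only [potSeries, PowerSeries.coeff_zero_eq_constantCoeff, map_add, map_mul, map_pow, map_sum,
    PowerSeries.constantCoeff_C, PowerSeries.constantCoeff_X]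
  rw [Finset.sum_eq_zero]
  · ring
  · intro i hi
    rw [Finset.mem_Icc] at hi
    have := hD.two_le_h
    rw [zero_pow (by omega)]
    ring

theorem coeff_zero_forceSeries (hD : D.Admissible) (x : ℝ⟦X⟧) :
    PowerSeries.coeff 0 (D.forceSeries x) = PowerSeries.coeff 0 x ^ (2 * D.h - 1) := by
  simp only [forceSeries, PowerSeries.coeff_zero_eq_constantCoeff, map_add, map_mul, map_pow,
    map_sum, PowerSeries.constantCoeff_C, PowerSeries.constantCoeff_X]
  rw [Finset.sum_eq_zero]
  · ring
  · intro i hi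
    rw [Finset.mem_Icc] at hi
    have := hD.two_le_h
    rw [zero_pow (by omega)]
    ring

theorem leading_energy (hD : D.Admissible) (φ : ℝ) :
    D.leadingOrbit.2 φ ^ 2 / 2 + D.leadingOrbit.1 φ ^ (2 * D.h) / (2 * D.h) = 1 := by
  obtain ⟨h1, h2, h3⟩ := D.isLeadingOrbit hD
  have hh := hD.two_le_h
  have hh0 : (0 : ℝ) < 2 * D.h := by
    have : (2 : ℝ) ≤ D.h := by exact_mod_cast hh
    linarith
  have hd : ∀ t, HasDerivAt (fun φ => D.leadingOrbit.2 φ ^ 2 / 2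
      + D.leadingOrbit.1 φ ^ (2 * D.h) / (2 * D.h)) 0 t := by
    intro t
    convert! (((h3 t).2.pow 2).div_const 2).add (((h3 t).1.pow (2 * D.h)).div_const (2 * D.h)) using 1
    push_cast
    field_simp
    ring
  have := is_const_of_deriv_eq_zero (fun t => (hd t).differentiableAt) (fun t => (hd t).deriv) φ 0
  rw [this, h1, h2, ← Real.rpow_natCast _ (2 * D.h), ← Real.rpow_mul hh0.le]
  push_cast
  rw [one_div_mul_cancel hh0.ne', Real.rpow_one, div_self hh0.ne']
  norm_num

theorem order_zero (hD : D.Admissible) : D.Order 0 := by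
  obtain ⟨h1, h2, h3⟩ := D.isLeadingOrbit hD
  have hw := (D.omega0_pos hD).ne'
  have hs := contDiff_of_hasDerivAt_pair (fun _ y => y / D.omega0)
    (fun x _ => -x ^ (2 * D.h - 1) / D.omega0) (by fun_prop) (by fun_prop) h3
  refine ⟨?_, ?_, fun φ => ?_, fun φ => ?_, fun φ => ?_⟩
  · rw [zero_X]; exact hs.1
  · rw [zero_Y]; exact hs.2
  · simp only [zero_add, Finset.sum_range_one, Nat.sub_zero, zero_omega, zero_X, zero_Y]
    rw [(h3 φ).1.deriv]
    field_simp
  · simp only [zero_add, Finset.sum_range_one, Nat.sub_zero, zero_omega, zero_Y]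
    rw [(h3 φ).2.deriv, D.coeff_zero_forceSeries hD]
    simp only [xSeries, PowerSeries.coeff_mk, zero_X]
    field_simp
  · rw [map_add, D.coeff_zero_potSeries hD, PowerSeries.coeff_C_mul]
    have := D.leading_energy hD φ
    simp only [xSeries, PowerSeries.coeff_mk, zero_X]
    simp only [PowerSeries.coeff_zero_eq_constantCoeff, map_pow, map_one]
    rw [← PowerSeries.coeff_zero_eq_constantCoeff_apply]
    simp only [ySeries, PowerSeries.coeff_mk, zero_Y]
    linarith

theorem contDiff_primitive {f : ℝ → ℝ} (hf : ContDiff ℝ ∞ f) :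
    ContDiff ℝ ∞ fun φ => ∫ v in (0 : ℝ)..φ, f v :=
  contDiff_of_hasDerivAt (fun _ => intervalIntegral.integral_hasDerivAt_right
    (hf.continuous.intervalIntegrable _ _) (hf.continuous.stronglyMeasurableAtFilter _ _)
    hf.continuous.continuousAt) hf

theorem order_succ (hD : D.Admissible) {j : ℕ} (hj : 1 ≤ j) (ih : ∀ i < j, D.Order i) :
    D.Order j := by
  have hh := hD.two_le_h
  have hh0 : (D.h : ℝ) ≠ 0 := by norm_cast; omega
  have hw := (D.omega0_pos hD).ne'
  have h0 := ih 0 (by omega)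
  obtain ⟨-, -, h3⟩ := D.isLeadingOrbit hD
  set c := D.energyAngle with hc
  have hj' := D.energyAngle_eq hj
  -- smoothness of the lower order terms
  have hxt : SmoothSeries (xTrunc c j) := fun n => by
    simp only [xTrunc, PowerSeries.coeff_mk]
    split_ifs with h
    · exact (ih n h).smoothX
    · exact contDiff_const
  have hyt : SmoothSeries (yTrunc c j) := fun n => by
    simp only [yTrunc, PowerSeries.coeff_mk]
    split_ifs with h
    · exact (ih n h).smoothY
    · exact contDiff_const
  have hderiv : ∀ {f : ℝ → ℝ}, ContDiff ℝ ∞ f → ContDiff ℝ ∞ (deriv f) :=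
    fun hf => (contDiff_infty_iff_deriv.1 hf).2
  have hJ : ContDiff ℝ ∞ (D.jTerm c j) :=
    ((((SmoothSeries.const _).mul (hyt.pow 2)).add (D.smooth_potSeries hxt)) j).neg
  have ha : ContDiff ℝ ∞ (aTerm c j) := ContDiff.sum fun i hi => contDiff_const.mul (by
    rw [Finset.mem_Ico] at hi
    exact hderiv (ih _ (by omega)).smoothX)
  have hb : ContDiff ℝ ∞ (D.bTerm c j) := ContDiff.add
    (ContDiff.sum fun i hi => contDiff_const.mul (by
      rw [Finset.mem_Ico] at hi
      exact hderiv (ih _ (by omega)).smoothY)) (D.smooth_forceSeries hxt j)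
  have hX0 := h0.smoothX
  have hY0 := h0.smoothY
  have hd : ContDiff ℝ ∞ (D.phaseDensity c j) :=
    (contDiff_const.mul hJ).sub (((ha.mul hY0).div_const 2).sub ((hb.mul hX0).div_const _))
  set m : ℝ := (1 / (2 * Real.pi)) * ∫ φ in (0 : ℝ)..(2 * Real.pi), D.phaseDensity c j φ with hm
  set α : ℝ → ℝ := fun φ => ∫ v in (0 : ℝ)..φ, (D.phaseDensity c j v - m) with hα
  have hαs : ContDiff ℝ ∞ α := contDiff_primitive (hd.sub contDiff_const)
  have hαd : ∀ φ, HasDerivAt α (D.phaseDensity c j φ - m) φ := fun φ =>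
    intervalIntegral.integral_hasDerivAt_right
      ((hd.sub contDiff_const).continuous.intervalIntegrable _ _)
      ((hd.sub contDiff_const).continuous.stronglyMeasurableAtFilter _ _)
      (hd.sub contDiff_const).continuous.continuousAt
  have eX : (c j).X = fun φ => α φ * ((c 0).Y φ / (c 0).omega)
      + D.jTerm c j φ * ((c 0).X φ / (2 * D.h)) := congrArg EnergyAngle.X hj'
  have eY : (c j).Y = fun φ => α φ * (-(c 0).X φ ^ (2 * D.h - 1) / (c 0).omega)
      + D.jTerm c j φ * ((c 0).Y φ / 2) := congrArg EnergyAngle.Y hj'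
  have eω : (c j).omega = (c 0).omega * m := congrArg EnergyAngle.omega hj'
  have c0 : (c 0).omega = D.omega0 := D.zero_omega
  have hXd : ∀ φ, HasDerivAt (c 0).X ((c 0).Y φ / D.omega0) φ := fun φ => by
    rw [hc, zero_X, zero_Y]; exact (h3 φ).1
  have hYd : ∀ φ, HasDerivAt (c 0).Y (-(c 0).X φ ^ (2 * D.h - 1) / D.omega0) φ := fun φ => by
    rw [hc, zero_X, zero_Y]; exact (h3 φ).2
  have hE0 : ∀ φ, (c 0).Y φ ^ 2 / 2 + (c 0).X φ ^ (2 * D.h) / (2 * D.h) = 1 := fun φ => by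
    rw [hc, zero_X, zero_Y]; exact D.leading_energy hD φ
  -- truncations
  have htail : ∀ f g : ℕ → ℝ, (∀ i < j, f i = g i) → (∀ i, j ≤ i → f i = 0) →
      ∃ r : ℝ⟦X⟧, PowerSeries.mk g = PowerSeries.mk f + PowerSeries.X ^ j * r ∧
      PowerSeries.coeff 0 r = g j := by
    intro f g h1 h2
    refine ⟨PowerSeries.mk fun i => g (i + j), ?_, by simp⟩
    ext n
    simp only [map_add, PowerSeries.coeff_mk, PowerSeries.coeff_X_pow_mul']
    split_ifs with h
    · rw [h2 n h, zero_add, Nat.sub_add_cancel h]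
    · rw [h1 n (by omega), add_zero]
  have hxs : ∀ φ, ∃ r, D.xSeries φ = xTrunc c j φ + PowerSeries.X ^ j * r ∧
      PowerSeries.coeff 0 r = (c j).X φ := fun φ =>
    htail _ _ (fun i hi => if_pos hi) (fun i hi => if_neg (by omega))
  have hys : ∀ φ, ∃ r, D.ySeries φ = yTrunc c j φ + PowerSeries.X ^ j * r ∧
      PowerSeries.coeff 0 r = (c j).Y φ := fun φ =>
    htail _ _ (fun i hi => if_pos hi) (fun i hi => if_neg (by omega))
  have hx0 : ∀ φ, PowerSeries.coeff 0 (xTrunc c j φ) = (c 0).X φ := fun φ => by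
    simp only [xTrunc, PowerSeries.coeff_mk]
    rw [if_pos (by omega)]
  have hy0 : ∀ φ, PowerSeries.coeff 0 (yTrunc c j φ) = (c 0).Y φ := fun φ => by
    simp only [yTrunc, PowerSeries.coeff_mk]
    rw [if_pos (by omega)]
  -- derivative of `J`
  have hJd : ∀ φ, HasDerivAt (D.jTerm c j) (-((c 0).Y φ * D.bTerm c j φ
      + (c 0).X φ ^ (2 * D.h - 1) * aTerm c j φ) / D.omega0) φ := by
    intro φ
    set xt' : ℝ⟦X⟧ := PowerSeries.mk fun i => if i < j then deriv (c i).X φ else 0 with hxt'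
    set yt' : ℝ⟦X⟧ := PowerSeries.mk fun i => if i < j then deriv (c i).Y φ else 0 with hyt'
    set wt : ℝ⟦X⟧ := PowerSeries.mk fun i => if i < j then (c i).omega else 0 with hwt
    have hdx : HasSeriesDeriv (xTrunc c j) xt' φ := fun n => by
      simp only [xTrunc, PowerSeries.coeff_mk, hxt']
      split_ifs with h
      · exact ((ih n h).smoothX.differentiable (by simp) φ).hasDerivAt
      · exact hasDerivAt_const φ _
    have hdy : HasSeriesDeriv (yTrunc c j) yt' φ := fun n => by
      simp only [yTrunc, PowerSeries.coeff_mk, hyt']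
      split_ifs with h
      · exact ((ih n h).smoothY.differentiable (by simp) φ).hasDerivAt
      · exact hasDerivAt_const φ _
    have hdE := ((HasSeriesDeriv.const (PowerSeries.C (1 / 2 : ℝ))).mul (hdy.pow 2)).add
      (D.hasSeriesDeriv_potSeries hD hdx)
    have hG : 0 * yTrunc c j φ ^ 2 + PowerSeries.C (1 / 2 : ℝ) * ((2 : ℕ) * yTrunc c j φ ^ (2 - 1)
        * yt') + D.forceSeries (xTrunc c j φ) * xt'
        = yTrunc c j φ * yt' + D.forceSeries (xTrunc c j φ) * xt' := by
      have : PowerSeries.C (1 / 2 : ℝ) * ((2 : ℕ) : ℝ⟦X⟧) = 1 := by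
        rw [← map_natCast (PowerSeries.C (R := ℝ)), ← map_mul]; norm_num
      have e : PowerSeries.C (1 / 2 : ℝ) * ((2 : ℕ) * yTrunc c j φ ^ (2 - 1) * yt')
          = (PowerSeries.C (1 / 2 : ℝ) * ((2 : ℕ) : ℝ⟦X⟧)) * (yTrunc c j φ * yt') := by
        rw [show 2 - 1 = 1 from rfl, pow_one]; ring
      rw [e, this]; ring
    rw [hG] at hdE
    set G := yTrunc c j φ * yt' + D.forceSeries (xTrunc c j φ) * xt' with hGdef
    have hlow : ∀ i < j, PowerSeries.coeff i G = 0 := by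
      intro i hi
      have h1 := hdE i
      have h2 : (fun v => PowerSeries.coeff i (PowerSeries.C (1 / 2 : ℝ) * yTrunc c j v ^ 2
          + D.potSeries (xTrunc c j v))) = fun _ => PowerSeries.coeff i (1 : ℝ⟦X⟧) := by
        funext v
        rw [← (ih i hi).energy v]
        obtain ⟨r, hr, -⟩ := hxs v
        obtain ⟨r', hr', -⟩ := hys v
        rw [hr, hr', map_add, map_add, PowerSeries.coeff_C_mul, PowerSeries.coeff_C_mul,
          coeff_pow_perturb hj hi.le, D.coeff_potSeries hD hj hi.le, if_neg hi.ne, if_neg hi.ne,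
          add_zero, add_zero]
      rw [h2] at h1
      exact h1.unique (hasDerivAt_const φ _)
    have hconv : ∀ (f : ℕ → ℝ) (i : ℕ), i < j →
        PowerSeries.coeff i (wt * PowerSeries.mk fun i => if i < j then f i else 0)
          = ∑ k ∈ Finset.range (i + 1), (c k).omega * f (i - k) := by
      intro f i hi
      rw [PowerSeries.coeff_mul, Finset.Nat.sum_antidiagonal_eq_sum_range_succ_mk]
      refine Finset.sum_congr rfl fun k hk => ?_
      rw [Finset.mem_range] at hk
      simp only [hwt, PowerSeries.coeff_mk]
      rw [if_pos (by omega), if_pos (by omega)]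
    have hconvj : ∀ f : ℕ → ℝ,
        PowerSeries.coeff j (wt * PowerSeries.mk fun i => if i < j then f i else 0)
          = ∑ k ∈ Finset.Ico 1 j, (c k).omega * f (j - k) := by
      intro f
      rw [PowerSeries.coeff_mul, Finset.Nat.sum_antidiagonal_eq_sum_range_succ_mk,
        Finset.sum_range_succ, Finset.range_eq_Ico, Finset.sum_eq_sum_Ico_succ_bot (by omega)]
      simp only [hwt, PowerSeries.coeff_mk]
      simp only [lt_irrefl, if_false, Nat.sub_zero, mul_zero, zero_mul, zero_add, add_zero]
      refine Finset.sum_congr rfl fun k hk => ?_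
      rw [Finset.mem_Ico] at hk
      rw [if_pos (by omega), if_pos (by omega)]
    have hP : ∀ i < j, PowerSeries.coeff i (wt * yt' + D.forceSeries (xTrunc c j φ)) = 0 := by
      intro i hi
      obtain ⟨r, hr, -⟩ := hxs φ
      rw [map_add, hconv _ i hi, (ih i hi).eqY φ, hr, coeff_forceSeries D hj hi.le, if_neg hi.ne]
      ring
    have hQ : ∀ i < j, PowerSeries.coeff i (wt * xt' - yTrunc c j φ) = 0 := by
      intro i hi
      rw [map_sub, hconv _ i hi, (ih i hi).eqX φ, yTrunc, PowerSeries.coeff_mk, if_pos hi, sub_self]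
    have hPj : PowerSeries.coeff j (wt * yt' + D.forceSeries (xTrunc c j φ)) = D.bTerm c j φ := by
      rw [map_add, hconvj]; rfl
    have hQj : PowerSeries.coeff j (wt * xt' - yTrunc c j φ) = aTerm c j φ := by
      rw [map_sub, hconvj, yTrunc, PowerSeries.coeff_mk, if_neg (lt_irrefl j), sub_zero]; rfl
    have hw0 : PowerSeries.coeff 0 wt = D.omega0 := by
      rw [hwt, PowerSeries.coeff_mk, if_pos (by omega), c0]
    have key : wt * G = yTrunc c j φ * (wt * yt' + D.forceSeries (xTrunc c j φ))
        + D.forceSeries (xTrunc c j φ) * (wt * xt' - yTrunc c j φ) := by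
      rw [hGdef]; ring
    have key' := congrArg (PowerSeries.coeff j) key
    rw [map_add, coeff_mul_of_low hlow, coeff_mul_of_low hP, coeff_mul_of_low hQ, hPj, hQj, hw0, hy0,
      D.coeff_zero_forceSeries hD, hx0] at key'
    rw [← key', neg_div, mul_div_cancel_left₀ _ hw]
    exact (hdE j).neg
  have hsplit : ∀ F : ℕ → ℝ, ∑ i ∈ Finset.range (j + 1), (c i).omega * F (j - i)
      = (c 0).omega * F j + ∑ i ∈ Finset.Ico 1 j, (c i).omega * F (j - i) + (c j).omega * F 0 := by
    intro F
    rw [Finset.sum_range_succ, Finset.range_eq_Ico, Finset.sum_eq_sum_Ico_succ_bot (by omega)]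
    simp
  have hp1 : ∀ x : ℝ, x ^ (2 * D.h) = x ^ (2 * D.h - 1) * x := fun x => by
    rw [← pow_succ]; congr 1; omega
  have hp2 : ∀ x : ℝ, x ^ (2 * D.h - 1) = x ^ (2 * D.h - 2) * x := fun x => by
    rw [← pow_succ]; congr 1; omega
  have hcast : ((2 * D.h - 1 : ℕ) : ℝ) = 2 * D.h - 1 := by
    rw [Nat.cast_sub (by omega)]; push_cast; ring
  refine ⟨?_, ?_, fun φ => ?_, fun φ => ?_, fun φ => ?_⟩
  · rw [eX]
    exact (hαs.mul (hY0.div_const _)).add (hJ.mul (hX0.div_const _))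
  · rw [eY]
    exact (hαs.mul ((hX0.pow _).neg.div_const _)).add (hJ.mul (hY0.div_const _))
  · rw [hsplit fun i => deriv (c i).X φ]
    have hd1 := ((hαd φ).fun_mul ((hYd φ).div_const (c 0).omega)).fun_add
      ((hJd φ).fun_mul ((hXd φ).div_const (2 * D.h : ℝ)))
    have hd2 := hd1.deriv
    rw [← eX] at hd2
    rw [hd2, (hXd φ).deriv, eω, eY, c0]
    change _ + aTerm c j φ + _ = _
    simp only [phaseDensity]
    have := hE0 φ
    rw [hp1] at this
    field_simp at this ⊢
    linear_combination (-D.omega0 * aTerm c j φ) * this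
  · rw [hsplit fun i => deriv (c i).Y φ]
    have hd1 := ((hαd φ).fun_mul (((hXd φ).fun_pow (2 * D.h - 1)).fun_neg.div_const
      (c 0).omega)).fun_add ((hJd φ).fun_mul ((hYd φ).div_const (2 : ℝ)))
    have hd2 := hd1.deriv
    rw [← eY] at hd2
    obtain ⟨r, hr, hr0⟩ := hxs φ
    rw [hd2, (hYd φ).deriv, eω, c0, hr, coeff_forceSeries D hj le_rfl, if_pos rfl, hr0, eX, hx0, c0]
    have e : D.bTerm c j φ = ∑ i ∈ Finset.Ico 1 j, (c i).omega * deriv (c (j - i)).Y φ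
      + PowerSeries.coeff j (D.forceSeries (xTrunc c j φ)) := rfl
    simp only [phaseDensity, hcast, Nat.sub_sub]
    have := hE0 φ
    rw [hp1, hp2] at this
    simp only [hp2]
    generalize (c 0).X φ ^ (2 * D.h - 2) = P at *
    generalize (c 0).X φ = X at *
    generalize (c 0).Y φ = Y at *
    generalize D.bTerm c j φ = b at *
    generalize aTerm c j φ = a at *
    generalize D.jTerm c j φ = J at *
    generalize α φ = A at *
    field_simp at this ⊢
    linear_combination (-D.omega0 * b) * this - 2 * D.omega0 * D.h * e
  · obtain ⟨r, hr, hr0⟩ := hxs φ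
    obtain ⟨r', hr', hr0'⟩ := hys φ
    rw [hr, hr', map_add, PowerSeries.coeff_C_mul, coeff_pow_perturb hj le_rfl,
      D.coeff_potSeries hD hj le_rfl, if_pos rfl, if_pos rfl, hr0, hr0', hx0, hy0, eX, eY, c0]
    have e : D.jTerm c j φ = -(1 / 2 * PowerSeries.coeff j (yTrunc c j φ ^ 2)
        + PowerSeries.coeff j (D.potSeries (xTrunc c j φ))) := by
      rw [jTerm, map_add, PowerSeries.coeff_C_mul]
    rw [PowerSeries.coeff_one, if_neg (by omega)]
    have := hE0 φ
    rw [hp1] at this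
    have e2 := eq_sub_of_add_eq' (neg_eq_iff_eq_neg.2 e).symm
    rw [e2]
    simp only [Nat.cast_ofNat, Nat.reduceSub, pow_one]
    field_simp at this ⊢
    linear_combination (D.omega0 * D.jTerm c j φ) * this

theorem order_all (hD : D.Admissible) (j : ℕ) : D.Order j := by
  induction j using Nat.strong_induction_on with
  | _ j ih =>
    rcases Nat.eq_zero_or_pos j with rfl | hj
    · exact D.order_zero hD
    · exact D.order_succ hD hj ih

/-- The coefficients are smooth, and the formal series satisfy `ω ∂_φ X = Y`,
`ω ∂_φ Y = -U'(X)`, `Y²/2 + U(X) = E` (after the scaling) and `Y = 0` at `φ = 0`. -/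
theorem energyAngle_formal_solution (hD : D.Admissible) :
    (∀ j, ContDiff ℝ ∞ (D.energyAngle j).X ∧ ContDiff ℝ ∞ (D.energyAngle j).Y) ∧
    (∀ j, (D.energyAngle j).Y 0 = 0) ∧
    (∀ φ, D.omegaSeries * PowerSeries.mk (fun j => deriv (D.energyAngle j).X φ) = D.ySeries φ) ∧
    (∀ φ, D.omegaSeries * PowerSeries.mk (fun j => deriv (D.energyAngle j).Y φ)
      = -D.forceSeries (D.xSeries φ)) ∧
    (∀ φ, PowerSeries.C (1 / 2 : ℝ) * D.ySeries φ ^ 2 + D.potSeries (D.xSeries φ) = 1) := by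
  have hY0 : ∀ j, (D.energyAngle j).Y 0 = 0 := by
    intro j
    induction j using Nat.strong_induction_on with
    | _ j ih =>
      rcases Nat.eq_zero_or_pos j with rfl | hj
      · rw [zero_Y]; exact (D.isLeadingOrbit hD).2.1
      · rw [D.energyAngle_eq hj]
        simp [energyAngleStep, ih 0 hj]
  refine ⟨fun j => ⟨(D.order_all hD j).smoothX, (D.order_all hD j).smoothY⟩, hY0,
    fun φ => ?_, fun φ => ?_, fun φ => ?_⟩ <;> ext j
  · rw [PowerSeries.coeff_mul, Finset.Nat.sum_antidiagonal_eq_sum_range_succ_mk]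
    simpa only [omegaSeries, ySeries, PowerSeries.coeff_mk] using (D.order_all hD j).eqX φ
  · rw [PowerSeries.coeff_mul, Finset.Nat.sum_antidiagonal_eq_sum_range_succ_mk, map_neg]
    simpa only [omegaSeries, PowerSeries.coeff_mk] using (D.order_all hD j).eqY φ
  · exact (D.order_all hD j).energy φ

theorem coeff_zInv_pow (hD : D.Admissible) (ϰ n : ℕ) :
    D.omega0 * PowerSeries.coeff n (D.zInv ϰ ^ (D.h - 1))
      = ∑ i ∈ Finset.range (n + 1), (D.energyAngle i).omega * D.resConst ϰ ^ i
        * PowerSeries.coeff n (PowerSeries.X ^ i * D.zInv ϰ ^ i) := by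
  have hh := hD.two_le_h
  have hw := (D.omega0_pos hD).ne'
  have hz0 : D.zInvCoeff ϰ 0 = 1 := by rw [zInvCoeff]
  rcases n with - | n
  · simp only [zInv, PowerSeries.coeff_zero_eq_constantCoeff, map_pow, zero_add,
      Finset.sum_range_one, pow_zero, mul_one, zero_omega, map_one]
    rw [← PowerSeries.coeff_zero_eq_constantCoeff_apply, PowerSeries.coeff_mk, hz0, one_pow, mul_one]
  · set y : ℝ⟦X⟧ := PowerSeries.mk fun k => if k < n + 1 then D.zInvCoeff ϰ k else 0 with hy
    have hsplit : D.zInv ϰ = y + PowerSeries.X ^ (n + 1) *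
        PowerSeries.mk (fun k => D.zInvCoeff ϰ (k + (n + 1))) := by
      ext k
      simp only [zInv, hy, map_add, PowerSeries.coeff_mk, PowerSeries.coeff_X_pow_mul']
      split_ifs with h1 h2 h2
      · omega
      · rw [add_zero]
      · rw [zero_add, Nat.sub_add_cancel h2]
      · omega
    have hrec : D.zInvCoeff ϰ (n + 1) = (∑ i ∈ Finset.Icc 1 (n + 1), (D.energyAngle i).omega
        * D.resConst ϰ ^ i * PowerSeries.coeff (n + 1) (PowerSeries.X ^ i * y ^ i)
        - D.omega0 * PowerSeries.coeff (n + 1) (y ^ (D.h - 1))) / (D.omega0 * ((D.h : ℝ) - 1)) := by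
      rw [zInvCoeff]
      simp only [dite_eq_ite, hy]
    have hpow : PowerSeries.coeff (n + 1) (D.zInv ϰ ^ (D.h - 1))
        = PowerSeries.coeff (n + 1) (y ^ (D.h - 1)) + ((D.h : ℝ) - 1) * D.zInvCoeff ϰ (n + 1) := by
      rw [hsplit, coeff_pow_perturb (by omega) le_rfl, if_pos rfl, hy, PowerSeries.coeff_mk,
        if_pos (by omega), hz0, PowerSeries.coeff_mk, zero_add, Nat.cast_sub (by omega)]
      simp
    have hsum : ∑ i ∈ Finset.range (n + 1 + 1), (D.energyAngle i).omega * D.resConst ϰ ^ i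
        * PowerSeries.coeff (n + 1) (PowerSeries.X ^ i * D.zInv ϰ ^ i)
        = ∑ i ∈ Finset.Icc 1 (n + 1), (D.energyAngle i).omega * D.resConst ϰ ^ i
        * PowerSeries.coeff (n + 1) (PowerSeries.X ^ i * y ^ i) := by
      rw [Finset.range_eq_Ico, Finset.sum_eq_sum_Ico_succ_bot (by omega)]
      rw [pow_zero, pow_zero, pow_zero, one_mul, PowerSeries.coeff_one, if_neg (by omega), mul_zero,
        zero_add]
      refine Finset.sum_congr rfl fun i hi => ?_
      have hi' := Finset.mem_Icc.1 hi
      rw [PowerSeries.coeff_X_pow_mul', PowerSeries.coeff_X_pow_mul', if_pos hi'.2, if_pos hi'.2,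
        hsplit, coeff_pow_perturb (by omega) (by omega), if_neg (by omega), add_zero]
    have hh1 : (D.h : ℝ) - 1 ≠ 0 := by
      have : (2 : ℝ) ≤ D.h := by exact_mod_cast hh
      linarith
    rw [hsum, hpow, hrec]
    field_simp
    ring

end Data
end PhaseLocking
end

namespace PhaseLocking

/-! ### Smoothness of parametric integrals -/

/-! Put `s = (log τ)/N`, `η = e^(-s) = τ^(-1/N)` and `ϱ = η^M v`. The truncated averaged system
becomes the singular system `v' = M v + e^(αs) P(η, v, φ)`, `φ' = e^(βs) Q(η, v, φ)` with `α = N -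
L`, `β = N - 2M` and `P`, `Q` smooth up to `η = 0`. A factor `η^M` can be taken out of the phase
equation because no averaging corrections occur below order `M`, so that `Ω_K(ϱ, φ) = 𝓠_K(ϱ) ϱ` for
`K < M`. At `η = 0`, `P` is `N Λ_L(0, φ)`, and `Q` is affine in `v` with slope `N 𝓠_0(0) > 0`. Hence
the root `φ₀` determines a common zero `(v₀, φ₀)` at which `P_v = 0`, `P_φ = N λ_L ≠ 0` and `Q_v >
0`. The linear system for each new coefficient is triangular with nonzero diagonal, which yields a
formal power series solution in `η` (`residual_step`, `exists_formal_solution`).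

A genuine solution with this expansion comes from the linearization along a long partial sum of the
series. Its off-diagonal entries have sizes `e^(αs)` and `e^(βs)`. Its diagonal entries are small
compared with the geometric mean `e^(γs)`, `γ = (α + β)/2`, because `L ≤ 2M - 1` and `P_v = O(η^j)`
with `j ≥ M`, and `j ≥ M + 1` if `L = 0`. The time-dependent change of variables `shear` turns it,
up to bounded terms, into the matrix with rows `(t, ςG)`, `(G, t)`, where `ς` is the sign of `λ_L`
(`shear_normalForm`). For `ς = 1` this is a saddle with real rates `t ± G`; for `ς = -1` it is
multiplication by `t + iG`.

No stability is required. It is enough that the real part of each rate is bounded below or tends to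
`-∞`. For the saddle this holds because `G` dominates `t`; for `ς = -1` it holds because `t` is a
constant plus `e^(αs)` times a smooth function of `e^(-s)` and so cannot oscillate
(`lower_bound_or_tendsto_atBot`). Writing the solution as an approximate solution plus `e^(-ms) W`
adds `m` to every rate. For `m` and `s` large all real parts are then at least `c` or at most `-c`,
and a bounded `W` is the fixed point of a contraction (`exists_bounded_solution_nonlinear`,
`exists_solution_near`). A bootstrap shows that this same solution follows the partial sums of every
order (`isBigO_of_residual`, `exists_solution_of_approximations`). The pieces are joined in
`exists_solution_of_normalForm` and `exists_solution_singularField`, and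
`isTruncatedSolution_of_singular` returns to the variable `τ`. -/

theorem hasFDerivAt_intervalIntegral {E F : Type} [NormedAddCommGroup E] [NormedSpace ℝ E]
    [NormedAddCommGroup F] [NormedSpace ℝ F] {f : E → ℝ → F}
    (hf : ContDiff ℝ 1 fun z : E × ℝ => f z.1 z.2) (a b : ℝ) (x : E) :
    HasFDerivAt (fun x => ∫ t in a..b, f x t) (∫ t in a..b, fderiv ℝ (fun y => f y t) x) x := by
  have hF' : Continuous fun z : E × ℝ => fderiv ℝ (fun y => f y z.2) z.1 :=
    (ContDiff.fderiv (n := 0) (m := 1) (f := fun (z : E × ℝ) (y : E) => f y z.2)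
      (g := fun z : E × ℝ => z.1) (hf.comp (contDiff_snd.prodMk contDiff_fst.snd)) contDiff_fst
      (by simp)).continuous
  have hd : ∀ t y, HasFDerivAt (fun y => f y t) (fderiv ℝ (fun y => f y t) y) y := fun t y =>
    ((hf.comp (contDiff_id.prodMk contDiff_const)).differentiable (by simp) y).hasFDerivAt
  obtain ⟨C, hC⟩ := (isCompact_uIcc (a := a) (b := b)).exists_bound_of_continuousOn
    (hF'.comp (continuous_const.prodMk continuous_id : Continuous fun t => (x, t))).continuousOn
  -- Compactness of the interval makes the bound on the derivative uniform in `t` for all `y` near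
  -- `x`; this is the domination needed to differentiate under the integral.
  have hev : ∀ᶠ y in 𝓝 x, ∀ t ∈ Set.uIcc a b, ‖fderiv ℝ (fun y => f y t) y‖ < C + 1 := by
    refine isCompact_uIcc.eventually_forall_of_forall_eventually fun t ht => ?_
    exact (hF'.norm.tendsto (x, t)).eventually (gt_mem_nhds ((hC t ht).trans_lt (lt_add_one C)))
  refine (hasFDerivAt_integral_of_dominated_of_fderiv_le'' (F' := fun y t => fderiv ℝ (fun y => f y t) y)
    (bound := fun _ => C + 1) hev ?_ ?_ ?_ ?_ ?_ ?_)
  · exact Eventually.of_forall fun y =>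
      (hf.continuous.comp (continuous_const.prodMk continuous_id)).aestronglyMeasurable
  · exact (hf.continuous.comp (continuous_const.prodMk continuous_id)).intervalIntegrable _ _
  · exact (hF'.comp (continuous_const.prodMk continuous_id : Continuous fun t => (x, t))).aestronglyMeasurable
  · filter_upwards [MeasureTheory.ae_restrict_mem measurableSet_uIoc] with t ht y hy
    exact (hy t (Set.uIoc_subset_uIcc ht)).le
  · exact intervalIntegrable_const
  · exact Eventually.of_forall fun t y _ => hd t y

/-- Induction on the order with the target space varying: the derivative is an integral of the same
kind with values in continuous linear maps. -/
theorem contDiff_intervalIntegral {E F : Type} [NormedAddCommGroup E] [NormedSpace ℝ E]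
    [NormedAddCommGroup F] [NormedSpace ℝ F] {f : E → ℝ → F}
    (hf : ContDiff ℝ ∞ fun z : E × ℝ => f z.1 z.2) (a b : ℝ) :
    ContDiff ℝ ∞ fun x => ∫ t in a..b, f x t := by
  refine contDiff_infty.2 fun n => ?_
  induction n generalizing F with
  | zero =>
    simp only [CharP.cast_eq_zero, contDiff_zero]
    exact continuous_iff_continuousAt.2 fun x =>
      (hasFDerivAt_intervalIntegral (hf.of_le (by exact_mod_cast le_top)) a b x).continuousAt
  | succ n ih =>
    have h1 : ContDiff ℝ 1 fun z : E × ℝ => f z.1 z.2 := hf.of_le (by exact_mod_cast le_top)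
    push_cast
    rw [contDiff_succ_iff_hasFDerivAt]
    exact ⟨_, ih (ContDiff.fderiv (m := ∞) (f := fun (z : E × ℝ) (y : E) => f y z.2)
      (g := fun z : E × ℝ => z.1) (hf.comp (contDiff_snd.prodMk contDiff_fst.snd)) contDiff_fst
      (by simp)), hasFDerivAt_intervalIntegral h1 a b⟩

/-- Rescaling the integration variable turns the moving endpoint into a parameter of an integrand
over the fixed interval `[0, 1]`. -/
theorem contDiff_primitive_param {E F : Type} [NormedAddCommGroup E] [NormedSpace ℝ E]
    [NormedAddCommGroup F] [NormedSpace ℝ F] {f : E → ℝ → F}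
    (hf : ContDiff ℝ ∞ fun z : E × ℝ => f z.1 z.2) :
    ContDiff ℝ ∞ fun z : E × ℝ => ∫ t in (0 : ℝ)..z.2, f z.1 t := by
  have e : (fun z : E × ℝ => ∫ t in (0 : ℝ)..z.2, f z.1 t)
      = fun z => z.2 • ∫ t in (0 : ℝ)..1, f z.1 (t * z.2) := by
    funext z
    rw [intervalIntegral.smul_integral_comp_mul_right (fun t => f z.1 t)]
    simp
  rw [e]
  refine contDiff_snd.smul (contDiff_intervalIntegral (f := fun (z : E × ℝ) t => f z.1 (t * z.2)) ?_ 0 1)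
  exact hf.comp (contDiff_fst.fst.prodMk (contDiff_snd.mul contDiff_fst.snd))

theorem contDiff_mean {E : Type} [NormedAddCommGroup E] [NormedSpace ℝ E] {f : E → ℝ → ℝ}
    (hf : ContDiff ℝ ∞ fun z : E × ℝ => f z.1 z.2) (ϰ : ℕ) :
    ContDiff ℝ ∞ fun x => mean ϰ (f x) :=
  contDiff_const.mul (contDiff_intervalIntegral hf _ _)

theorem contDiff_zeroMeanPrimitive {E : Type} [NormedAddCommGroup E] [NormedSpace ℝ E]
    {f : E → ℝ → ℝ} (hf : ContDiff ℝ ∞ fun z : E × ℝ => f z.1 z.2) (ϰ : ℕ) :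
    ContDiff ℝ ∞ fun z : E × ℝ => zeroMeanPrimitive ϰ (f z.1) z.2 := by
  have h1 : ContDiff ℝ ∞ fun z : E × ℝ => ∫ v in (0 : ℝ)..z.2, (f z.1 v - mean ϰ (f z.1)) :=
    contDiff_primitive_param (f := fun x v => f x v - mean ϰ (f x))
      (hf.sub ((contDiff_mean hf ϰ).comp contDiff_fst))
  exact h1.sub ((contDiff_mean (f := fun x ζ => ∫ v in (0 : ℝ)..ζ, (f x v - mean ϰ (f x))) h1 ϰ).comp
    contDiff_fst)

theorem contDiff_mean₃ {f : ℝ → ℝ → ℝ → ℝ}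
    (hf : ContDiff ℝ ∞ fun z : ℝ × ℝ × ℝ => f z.1 z.2.1 z.2.2) (ϰ : ℕ) :
    ContDiff ℝ ∞ fun z : ℝ × ℝ => mean ϰ (f z.1 z.2) :=
  contDiff_mean (f := fun z : ℝ × ℝ => f z.1 z.2) (hf.comp (contDiff_fst.fst.prodMk
    (contDiff_fst.snd.prodMk contDiff_snd) :
      ContDiff ℝ ∞ fun w : (ℝ × ℝ) × ℝ => (w.1.1, w.1.2, w.2))) ϰ

theorem contDiff_zeroMeanPrimitive₃ {f : ℝ → ℝ → ℝ → ℝ}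
    (hf : ContDiff ℝ ∞ fun z : ℝ × ℝ × ℝ => f z.1 z.2.1 z.2.2) (ϰ : ℕ) :
    ContDiff ℝ ∞ fun z : ℝ × ℝ × ℝ => zeroMeanPrimitive ϰ (f z.1 z.2.1) z.2.2 :=
  (contDiff_zeroMeanPrimitive (f := fun z : ℝ × ℝ => f z.1 z.2) (hf.comp (contDiff_fst.fst.prodMk
    (contDiff_fst.snd.prodMk contDiff_snd) :
      ContDiff ℝ ∞ fun w : (ℝ × ℝ) × ℝ => (w.1.1, w.1.2, w.2))) ϰ).comp
    ((contDiff_fst.prodMk contDiff_snd.fst).prodMk contDiff_snd.snd :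
      ContDiff ℝ ∞ fun z : ℝ × ℝ × ℝ => ((z.1, z.2.1), z.2.2))

theorem mean_const {ϰ : ℕ} (hϰ : 1 ≤ ϰ) (c : ℝ) : mean ϰ (fun _ => c) = c := by
  have : (ϰ : ℝ) ≠ 0 := by positivity
  rw [mean, intervalIntegral.integral_const, smul_eq_mul]
  field_simp
  simp

/-! ### Smoothness of partial derivatives -/

theorem contDiff_deriv_param {E : Type} [NormedAddCommGroup E] [NormedSpace ℝ E] {f : E → ℝ → ℝ}
    (hf : ContDiff ℝ ∞ fun z : E × ℝ => f z.1 z.2) :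
    ContDiff ℝ ∞ fun z : E × ℝ => deriv (f z.1) z.2 := by
  have := ContDiff.fderiv_apply (m := ∞) (n := ∞) (f := fun (z : E × ℝ) (t : ℝ) => f z.1 t)
      (g := fun z : E × ℝ => z.2) (k := fun _ => (1 : ℝ))
      (hf.comp (contDiff_fst.fst.prodMk contDiff_snd)) contDiff_snd contDiff_const (by simp)
  exact this

theorem contDiff_iteratedDeriv_param {E : Type} [NormedAddCommGroup E] [NormedSpace ℝ E]
    {f : E → ℝ → ℝ} (hf : ContDiff ℝ ∞ fun z : E × ℝ => f z.1 z.2) (n : ℕ) :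
    ContDiff ℝ ∞ fun z : E × ℝ => iteratedDeriv n (f z.1) z.2 := by
  induction n with
  | zero => simpa using hf
  | succ n ih =>
    simp only [iteratedDeriv_succ]
    exact contDiff_deriv_param (f := fun x => iteratedDeriv n (f x)) ih

/-! ### Series with coefficients that depend smoothly on a parameter -/

/-- The coefficients of the series are smooth functions of the parameter. -/
def SmoothSeriesOn {E : Type} [NormedAddCommGroup E] [NormedSpace ℝ E] (F : E → ℝ⟦X⟧) : Prop :=
  ∀ n, ContDiff ℝ ∞ fun z => PowerSeries.coeff n (F z)

namespace SmoothSeriesOn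
variable {E : Type} [NormedAddCommGroup E] [NormedSpace ℝ E] {F G : E → ℝ⟦X⟧}

theorem const (f : ℝ⟦X⟧) : SmoothSeriesOn fun _ : E => f := fun _ => contDiff_const

theorem C {f : E → ℝ} (hf : ContDiff ℝ ∞ f) : SmoothSeriesOn fun z => PowerSeries.C (f z) :=
  fun n => by
    simp only [PowerSeries.coeff_C]
    split_ifs
    exacts [hf, contDiff_const]

theorem mk {f : ℕ → E → ℝ} (hf : ∀ n, ContDiff ℝ ∞ (f n)) :
    SmoothSeriesOn fun z => PowerSeries.mk fun n => f n z := fun n => by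
  simpa only [PowerSeries.coeff_mk] using hf n

theorem add (hF : SmoothSeriesOn F) (hG : SmoothSeriesOn G) : SmoothSeriesOn fun z => F z + G z :=
  fun n => by simpa using (hF n).add (hG n)

theorem sub (hF : SmoothSeriesOn F) (hG : SmoothSeriesOn G) : SmoothSeriesOn fun z => F z - G z :=
  fun n => by simpa using (hF n).sub (hG n)

theorem mul (hF : SmoothSeriesOn F) (hG : SmoothSeriesOn G) : SmoothSeriesOn fun z => F z * G z :=
  fun n => by
    simp only [PowerSeries.coeff_mul]
    exact ContDiff.sum fun i _ => (hF _).mul (hG _)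

theorem pow (hF : SmoothSeriesOn F) (k : ℕ) : SmoothSeriesOn fun z => F z ^ k := by
  induction k with
  | zero => simpa using const 1
  | succ k ih => simpa only [pow_succ] using ih.mul hF

theorem sum {ι : Type} {s : Finset ι} {F : ι → E → ℝ⟦X⟧} (h : ∀ i ∈ s, SmoothSeriesOn (F i)) :
    SmoothSeriesOn fun z => ∑ i ∈ s, F i z := fun n => by
  simp only [map_sum]
  exact ContDiff.sum fun i hi => h i hi n

end SmoothSeriesOn

namespace Data

variable {D : Data}

theorem contDiff_xy (hD : D.Admissible) (j : ℕ) :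
    ContDiff ℝ ∞ (D.energyAngle j).X ∧ ContDiff ℝ ∞ (D.energyAngle j).Y :=
  (D.energyAngle_formal_solution hD).1 j

variable {E : Type} [NormedAddCommGroup E] [NormedSpace ℝ E]

theorem smooth_xSeries (hD : D.Admissible) {f : E → ℝ} (hf : ContDiff ℝ ∞ f) :
    SmoothSeriesOn fun z => D.xSeries (f z) :=
  SmoothSeriesOn.mk fun n => (contDiff_xy hD n).1.comp hf

theorem smooth_ySeries (hD : D.Admissible) {f : E → ℝ} (hf : ContDiff ℝ ∞ f) :
    SmoothSeriesOn fun z => D.ySeries (f z) :=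
  SmoothSeriesOn.mk fun n => (contDiff_xy hD n).2.comp hf

theorem smooth_dxSeries (hD : D.Admissible) {f : E → ℝ} (hf : ContDiff ℝ ∞ f) :
    SmoothSeriesOn fun z => D.dxSeries (f z) :=
  SmoothSeriesOn.mk fun n => contDiff_const.mul ((contDiff_xy hD n).1.comp hf)

theorem smooth_dySeries (hD : D.Admissible) {f : E → ℝ} (hf : ContDiff ℝ ∞ f) :
    SmoothSeriesOn fun z => D.dySeries (f z) :=
  SmoothSeriesOn.mk fun n => contDiff_const.mul ((contDiff_xy hD n).2.comp hf)

theorem smooth_forceSeries_xSeries (hD : D.Admissible) {f : E → ℝ} (hf : ContDiff ℝ ∞ f) :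
    SmoothSeriesOn fun z => D.forceSeries (D.xSeries (f z)) :=
  ((smooth_xSeries hD hf).pow _).add
    (.sum fun _ _ => (SmoothSeriesOn.const _).mul ((smooth_xSeries hD hf).pow _))

theorem smooth_polySeries (hD : D.Admissible) {A : ℕ → ℕ → ℝ → ℝ}
    (hA : ∀ i j, ContDiff ℝ ∞ (A i j)) (e : ℕ → ℕ → ℕ) (m : ℕ) {f g : E → ℝ}
    (hf : ContDiff ℝ ∞ f) (hg : ContDiff ℝ ∞ g) :
    SmoothSeriesOn fun z => ∑ i ∈ Finset.range (D.p + 1), ∑ j ∈ Finset.range m,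
      PowerSeries.C (A i j (g z)) * PowerSeries.X ^ e i j * D.xSeries (f z) ^ i
        * D.ySeries (f z) ^ j :=
  .sum fun i _ => .sum fun j _ => (((SmoothSeriesOn.C ((hA i j).comp hg)).mul
    (.const _)).mul ((smooth_xSeries hD hf).pow _)).mul ((smooth_ySeries hD hf).pow _)

theorem smooth_forcingSeries (hD : D.Admissible) (k : ℕ) {f g : E → ℝ}
    (hf : ContDiff ℝ ∞ f) (hg : ContDiff ℝ ∞ g) :
    SmoothSeriesOn fun z => D.forcingSeries k (f z) (g z) :=
  ((smooth_polySeries hD (D := D) (A := D.A k) (hD.A_smooth k) _ _ hf hg).mul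
    (smooth_forceSeries_xSeries hD hf)).add
  ((smooth_polySeries hD (D := D) (A := D.B k) (hD.B_smooth k) _ _ hf hg).mul
    (smooth_ySeries hD hf))

theorem smooth_phaseForcingSeries (hD : D.Admissible) (k : ℕ) {f g : E → ℝ}
    (hf : ContDiff ℝ ∞ f) (hg : ContDiff ℝ ∞ g) :
    SmoothSeriesOn fun z => D.phaseForcingSeries k (f z) (g z) :=
  (SmoothSeriesOn.const _).mul
  (((smooth_polySeries hD (D := D) (A := D.A k) (hD.A_smooth k) _ _ hf hg).mul
    (smooth_dySeries hD hf)).sub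
  ((smooth_polySeries hD (D := D) (A := D.B k) (hD.B_smooth k) _ _ hf hg).mul
    (smooth_dxSeries hD hf)))

/-! ### Smoothness of the averaged system -/

theorem contDiff_calF (hD : D.Admissible) (ϰ K : ℕ) :
    ContDiff ℝ ∞ fun z : ℝ × ℝ × ℝ => D.calF ϰ K z.1 z.2.1 z.2.2 := by
  unfold calF
  refine contDiff_const.mul (ContDiff.sum fun w _ => ContDiff.mul ?_ (contDiff_fst.pow _))
  unfold hatF
  refine ((((contDiff_const.mul ?_).mul contDiff_const).mul contDiff_const).mul contDiff_const)
  exact smooth_forcingSeries hD _ (f := fun z : ℝ × ℝ × ℝ => z.2.1 + z.2.2 / ϰ)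
    (contDiff_snd.fst.add (contDiff_snd.snd.div_const _)) contDiff_snd.snd _

theorem contDiff_calG (hD : D.Admissible) (ϰ K : ℕ) :
    ContDiff ℝ ∞ fun z : ℝ × ℝ × ℝ => D.calG ϰ K z.1 z.2.1 z.2.2 := by
  unfold calG
  refine contDiff_const.mul (ContDiff.sum fun w _ => ContDiff.mul ?_ (contDiff_fst.pow _))
  unfold hatG
  refine (((ContDiff.mul ?_ contDiff_const).mul contDiff_const).mul contDiff_const)
  exact smooth_phaseForcingSeries hD _ (f := fun z : ℝ × ℝ × ℝ => z.2.1 + z.2.2 / ϰ)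
    (contDiff_snd.fst.add (contDiff_snd.snd.div_const _)) contDiff_snd.snd _

theorem contDiff_calP (ϰ K : ℕ) : ContDiff ℝ ∞ (D.calP ϰ K) :=
  contDiff_const.mul (ContDiff.sum fun _ _ => contDiff_const.mul (contDiff_id.pow _))

theorem contDiff_calQ (ϰ K : ℕ) : ContDiff ℝ ∞ (D.calQ ϰ K) :=
  contDiff_const.mul (ContDiff.sum fun _ _ => contDiff_const.mul (contDiff_id.pow _))

theorem contDiff_calA (hD : D.Admissible) (ϰ K : ℕ) :
    ContDiff ℝ ∞ fun z : ℝ × ℝ × ℝ => D.calA ϰ K z.1 z.2.1 z.2.2 := by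
  unfold calA
  refine ((contDiff_calF hD ϰ K).add ?_).add ?_
  · split_ifs
    exacts [(contDiff_calP ϰ _).comp contDiff_fst, contDiff_const]
  · split_ifs
    exacts [contDiff_const.mul contDiff_fst, contDiff_const]

theorem contDiff_calB (hD : D.Admissible) (ϰ K : ℕ) :
    ContDiff ℝ ∞ fun z : ℝ × ℝ × ℝ => D.calB ϰ K z.1 z.2.1 z.2.2 := by
  unfold calB
  refine (((contDiff_calQ ϰ _).comp contDiff_fst).mul contDiff_fst).add ?_
  split_ifs
  exacts [contDiff_calG hD ϰ _, contDiff_const]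

theorem contDiff_taylorTerm (M K : ℕ) {T : ℕ → ℝ → ℝ → ℝ} {ρ ψ : ℕ → ℝ → ℝ → ℝ → ℝ}
    (hT : ∀ j, ContDiff ℝ ∞ fun z : ℝ × ℝ => T j z.1 z.2)
    (hρ : ∀ j, ContDiff ℝ ∞ fun z : ℝ × ℝ × ℝ => ρ j z.1 z.2.1 z.2.2)
    (hψ : ∀ j, ContDiff ℝ ∞ fun z : ℝ × ℝ × ℝ => ψ j z.1 z.2.1 z.2.2) :
    ContDiff ℝ ∞ fun z : ℝ × ℝ × ℝ => taylorTerm M K T (fun i => ρ i z.1 z.2.1 z.2.2)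
      (fun i => ψ i z.1 z.2.1 z.2.2) z.1 z.2.1 := by
  unfold taylorTerm
  refine ContDiff.sum fun m _ => ContDiff.sum fun j _ => ?_
  split_ifs
  · refine ContDiff.sum fun ab _ => (contDiff_const.mul ?_).mul
      (((SmoothSeriesOn.mk hρ).pow _).mul ((SmoothSeriesOn.mk hψ).pow _) _)
    have h1 : ContDiff ℝ ∞ fun z : ℝ × ℝ => iteratedDeriv ab.2 (fun θ' => T j z.1 θ') z.2 :=
      contDiff_iteratedDeriv_param (f := fun r θ => T j r θ) (hT j) _
    have h2 := contDiff_iteratedDeriv_param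
      (f := fun θ r => iteratedDeriv ab.2 (fun θ' => T j r θ') θ)
      (h1.comp (contDiff_snd.prodMk contDiff_fst)) ab.1
    exact h2.comp (contDiff_snd.fst.prodMk contDiff_fst)
  · exact contDiff_const

theorem contDiff_correction (hD : D.Admissible) (ϰ K : ℕ) {χ ρ ψ : ℕ → ℝ → ℝ → ℝ → ℝ}
    {T : ℕ → ℝ → ℝ → ℝ}
    (hχ : ∀ j, ContDiff ℝ ∞ fun z : ℝ × ℝ × ℝ => χ j z.1 z.2.1 z.2.2)
    (hT : ∀ j, ContDiff ℝ ∞ fun z : ℝ × ℝ => T j z.1 z.2)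
    (hρ : ∀ j, ContDiff ℝ ∞ fun z : ℝ × ℝ × ℝ => ρ j z.1 z.2.1 z.2.2)
    (hψ : ∀ j, ContDiff ℝ ∞ fun z : ℝ × ℝ × ℝ => ψ j z.1 z.2.1 z.2.2) :
    ContDiff ℝ ∞ fun z : ℝ × ℝ × ℝ => D.correction ϰ K χ T ρ ψ z.1 z.2.1 z.2.2 := by
  unfold correction
  refine (ContDiff.add ?_ ?_).sub (contDiff_taylorTerm _ _ hT hρ hψ)
  · split_ifs
    · refine ContDiff.sum fun ij _ => ((contDiff_calA hD ϰ _).mul ?_).add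
        ((contDiff_calB hD ϰ _).mul ?_)
      · exact (contDiff_deriv_param (f := fun (w : ℝ × ℝ) r' => χ ij.2 r' w.1 w.2)
          ((hχ _).comp (contDiff_snd.prodMk (contDiff_fst.fst.prodMk contDiff_fst.snd)))).comp
          (contDiff_snd.prodMk contDiff_fst : ContDiff ℝ ∞ fun z : ℝ × ℝ × ℝ => (z.2, z.1))
      · exact (contDiff_deriv_param (f := fun (w : ℝ × ℝ) θ' => χ ij.2 w.1 θ' w.2)
          ((hχ _).comp (contDiff_fst.fst.prodMk (contDiff_snd.prodMk contDiff_fst.snd)))).comp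
          ((contDiff_fst.prodMk contDiff_snd.snd).prodMk contDiff_snd.fst :
            ContDiff ℝ ∞ fun z : ℝ × ℝ × ℝ => ((z.1, z.2.2), z.2.1))
    · exact contDiff_const
  · split_ifs
    exacts [contDiff_const.mul (hχ _), contDiff_const]

/-- The functions of one order of the averaging procedure are smooth. -/
structure _root_.PhaseLocking.AvgOrder.Smooth (c : AvgOrder) : Prop where
  Lam : ContDiff ℝ ∞ fun z : ℝ × ℝ => c.Lam z.1 z.2
  Om : ContDiff ℝ ∞ fun z : ℝ × ℝ => c.Om z.1 z.2
  rho : ContDiff ℝ ∞ fun z : ℝ × ℝ × ℝ => c.rho z.1 z.2.1 z.2.2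
  psi : ContDiff ℝ ∞ fun z : ℝ × ℝ × ℝ => c.psi z.1 z.2.1 z.2.2

theorem smooth_averagingStep (hD : D.Admissible) (ϰ K : ℕ) {c : ℕ → AvgOrder}
    (hc : ∀ i, (c i).Smooth) : (D.averagingStep ϰ K c).Smooth := by
  let a : ℝ → ℝ → ℝ → ℝ := fun r θ ζ => D.calA ϰ K r θ ζ
    + D.correction ϰ K (fun i => (c i).rho) (fun i => (c i).Lam)
        (fun i => (c i).rho) (fun i => (c i).psi) r θ ζ
  let b : ℝ → ℝ → ℝ → ℝ := fun r θ ζ => D.calB ϰ K r θ ζ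
    + D.correction ϰ K (fun i => (c i).psi) (fun i => (c i).Om)
        (fun i => (c i).rho) (fun i => (c i).psi) r θ ζ
  have ha : ContDiff ℝ ∞ fun z : ℝ × ℝ × ℝ => a z.1 z.2.1 z.2.2 :=
    (contDiff_calA hD ϰ K).add (contDiff_correction hD ϰ K (fun i => (hc i).rho)
      (fun i => (hc i).Lam) (fun i => (hc i).rho) (fun i => (hc i).psi))
  have hb : ContDiff ℝ ∞ fun z : ℝ × ℝ × ℝ => b z.1 z.2.1 z.2.2 :=
    (contDiff_calB hD ϰ K).add (contDiff_correction hD ϰ K (fun i => (hc i).psi)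
      (fun i => (hc i).Om) (fun i => (hc i).rho) (fun i => (hc i).psi))
  exact ⟨contDiff_mean₃ ha ϰ, contDiff_mean₃ hb ϰ,
    contDiff_const.mul (contDiff_zeroMeanPrimitive₃ ha ϰ),
    contDiff_const.mul (contDiff_zeroMeanPrimitive₃ hb ϰ)⟩

theorem smooth_averaging (hD : D.Admissible) (ϰ K : ℕ) : (D.averaging ϰ K).Smooth := by
  induction K using Nat.strong_induction_on with
  | _ K ih =>
    rw [averaging]
    refine smooth_averagingStep hD ϰ K fun i => ?_
    split_ifs with h
    · exact ih i h
    · exact ⟨contDiff_const, contDiff_const, contDiff_const, contDiff_const⟩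

theorem contDiff_Lambda (hD : D.Admissible) (ϰ K : ℕ) :
    ContDiff ℝ ∞ fun z : ℝ × ℝ => D.Lambda ϰ K z.1 z.2 := (smooth_averaging hD ϰ K).Lam

theorem contDiff_Omega (hD : D.Admissible) (ϰ K : ℕ) :
    ContDiff ℝ ∞ fun z : ℝ × ℝ => D.Omega ϰ K z.1 z.2 := (smooth_averaging hD ϰ K).Om

/-! ### The low orders of the averaged system -/

theorem one_le_M (hD : D.Admissible) (hσ : D.SigmaCondition) : 1 ≤ D.M := by
  have hh : (2 : ℝ) ≤ D.h := by exact_mod_cast hD.two_le_h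
  have hq : (1 : ℝ) ≤ D.q := by exact_mod_cast hD.one_le_a.trans hD.a_le_q
  have hμ : 0 < D.mu := by have := hσ.2; unfold mu; linarith
  have h1 : 0 < (D.h : ℝ) - 1 := by linarith
  have : 0 < (D.M : ℝ) := by rw [D.cast_M hD hσ]; positivity
  exact_mod_cast this

theorem two_mul_M_le_N (hD : D.Admissible) (hσ : D.SigmaCondition) : 2 * D.M ≤ D.N := by
  have hh : (2 : ℝ) ≤ D.h := by exact_mod_cast hD.two_le_h
  have hq : (1 : ℝ) ≤ D.q := by exact_mod_cast hD.one_le_a.trans hD.a_le_q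
  have h1 : 0 ≤ (D.q : ℝ) * ((D.h : ℝ) - 1) := mul_nonneg (by linarith) (by linarith)
  have h2 : 2 * D.mu ≤ D.nu := by have := hσ.1; unfold nu; linarith
  have : 2 * (D.M : ℝ) ≤ D.N := by
    rw [D.cast_M hD hσ, D.cast_N hD]
    nlinarith [mul_le_mul_of_nonneg_right h2 h1]
  exact_mod_cast this

/-- Products of `𝓐`, `𝓑` with derivatives of `χ` and all Taylor terms carry at least one extra
factor `τ^(-M/N)`, and `∂_τ` contributes `τ^(-1) = τ^(-N/N)`. Nothing is left below order `M`. -/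
theorem correction_eq_zero {K : ℕ} (hK : K < D.M) (hMN : D.M ≤ D.N) (ϰ : ℕ)
    (χ ρ ψ : ℕ → ℝ → ℝ → ℝ → ℝ) (T : ℕ → ℝ → ℝ → ℝ) (r θ ζ : ℝ) :
    D.correction ϰ K χ T ρ ψ r θ ζ = 0 := by
  have ht : ∀ ρ ψ : ℕ → ℝ, taylorTerm D.M K T ρ ψ r θ = 0 := by
    intro ρ ψ
    refine Finset.sum_eq_zero fun m hm => Finset.sum_eq_zero fun j _ => if_neg ?_
    have h1 := (Finset.mem_Icc.1 hm).1
    have h2 := Nat.mul_le_mul_right D.M h1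
    omega
  rw [correction, ht, if_neg (by omega), if_neg (by omega)]
  simp

theorem Lambda_eq_mean {K : ℕ} (hK : K < D.M) (hMN : D.M ≤ D.N) (ϰ : ℕ) (r θ : ℝ) :
    D.Lambda ϰ K r θ = mean ϰ fun ζ => D.calA ϰ K r θ ζ := by
  rw [Lambda, averaging, averagingStep]
  simp only [correction_eq_zero hK hMN, add_zero]

/-- Below order `M` the function `𝓑_K` is only the frequency detuning, which does not involve `ζ`
and is its own mean. The factor `r` is what allows `η^M` to be divided out of the phase equation. -/
theorem Omega_eq_of_lt {K : ℕ} (hK : K < D.M) (hMN : D.M ≤ D.N) {ϰ : ℕ} (hϰ : 1 ≤ ϰ) (r θ : ℝ) :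
    D.Omega ϰ K r θ = D.calQ ϰ K r * r := by
  rw [Omega, averaging, averagingStep]
  simp only [correction_eq_zero hK hMN, add_zero, calB, if_neg (not_le.2 hK), mean_const hϰ]

theorem indexSet_zero (hD : D.Admissible) (hσ : D.SigmaCondition) : D.indexSet 0 = {(0, 0, 0, 0)} := by
  ext ⟨k, d, i, l⟩
  have hb := hD.one_le_b
  have hh := hD.two_le_h
  have hM := one_le_M hD hσ
  simp only [indexSet, Finset.mem_filter, Finset.mem_product, Finset.mem_range,
    Finset.mem_singleton, Prod.mk.injEq]
  constructor
  · omega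
  · rintro ⟨rfl, rfl, rfl, rfl⟩
    simp

/-- At order zero only the index `(0, 0, 0, 0)` contributes, hence only the power `r^0`; the linear
term `(M/N) r` enters at order `N - M ≥ M > 0`. This gives the additional power of `η` that the case
`L = 0` needs. -/
theorem Lambda_zero_indep (hD : D.Admissible) (hσ : D.SigmaCondition) (ϰ : ℕ) (r r' θ : ℝ) :
    D.Lambda ϰ 0 r θ = D.Lambda ϰ 0 r' θ := by
  have hM := one_le_M hD hσ
  have hN := two_mul_M_le_N hD hσ
  have hi := indexSet_zero hD hσ
  rw [Lambda_eq_mean (by omega) (by omega), Lambda_eq_mean (by omega) (by omega)]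
  congr 1
  funext ζ
  rw [calA, calA, if_neg (show ¬(0 + D.M = D.N) by omega), if_neg (show ¬(0 + D.M = D.N) by omega)]
  simp only [calF, calP, hi, Finset.sum_singleton, pow_zero]
  by_cases h : D.N ≤ 0 + 2 * D.M
  · have e : 0 + 2 * D.M - D.N = 0 := by omega
    simp only [if_pos h, e, hi, Finset.sum_singleton, pow_zero]
  · simp only [if_neg h]

/-- The leading coefficient is `ω_0 (h - 1)` times positive powers: for `h ≥ 2` the leading
frequency grows with the energy, so the detuning is nondegenerate. -/
theorem calQ_zero_pos (hD : D.Admissible) (hσ : D.SigmaCondition) {ϰ : ℕ} (hϰ : 1 ≤ ϰ) (r : ℝ) :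
    0 < D.calQ ϰ 0 r := by
  have hM := one_le_M hD hσ
  have hh : (2 : ℝ) ≤ D.h := by exact_mod_cast hD.two_le_h
  have hq : (1 : ℝ) ≤ D.q := by exact_mod_cast hD.one_le_a.trans hD.a_le_q
  have hμ : 0 < D.mu := by have := hσ.2; unfold mu; linarith
  have hν : 0 < D.nu := by have := hσ.1; unfold nu; linarith
  have hω := D.omega0_pos hD
  have hs := hD.s_pos
  have hc : 0 < D.resConst ϰ := by
    unfold resConst vartheta
    have : (0 : ℝ) < ϰ := by exact_mod_cast hϰ
    positivity
  rw [calQ, indexSet_zero hD hσ, Finset.sum_singleton, hatQ, if_pos rfl, zero_omega, pow_zero]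
  have hb : binomCoeff ((D.h : ℤ) - 1 - (0 : ℕ)) (0 + 1) = (D.h : ℝ) - 1 := by
    simp [binomCoeff]
  have hz : D.zPowCoeff ϰ ((D.h : ℤ) - 1 - (0 : ℕ)) 0 = 1 := by
    have h0 : PowerSeries.constantCoeff (D.zInv ϰ) = 1 := by
      rw [← PowerSeries.coeff_zero_eq_constantCoeff_apply, zInv, PowerSeries.coeff_mk, zInvCoeff]
    rw [zPowCoeff]
    split_ifs <;> simp [h0]
  rw [hb, hz]
  have h1 : 0 < (D.h : ℝ) - 1 := by linarith
  positivity

end Data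

/-! ### Scalar linear equations with a definite real part -/

theorem hasDerivAt_primitive {μ : ℝ → ℂ} (hμ : Continuous μ) (s : ℝ) :
    HasDerivAt (fun s => ∫ t in (0 : ℝ)..s, μ t) (μ s) s :=
  intervalIntegral.integral_hasDerivAt_right (hμ.intervalIntegrable _ _)
    (hμ.stronglyMeasurableAtFilter _ _) hμ.continuousAt

theorem mul_sub_le_re_sub {a μ : ℝ → ℂ} (ha : ∀ s, HasDerivAt a (μ s) s) {c s₀ s t : ℝ}
    (hc : ∀ s, s₀ ≤ s → c ≤ (μ s).re) (hs : s₀ ≤ s) (hst : s ≤ t) :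
    c * (t - s) ≤ (a t - a s).re := by
  have hd : ∀ s, HasDerivAt (fun s => (a s).re) (μ s).re s := fun s =>
    (Complex.reCLM.hasFDerivAt.comp_hasDerivAt s (ha s) :)
  rw [Complex.sub_re]
  refine (convex_Ici s₀).mul_sub_le_image_sub_of_le_deriv
    (fun s _ => (hd s).continuousAt.continuousWithinAt)
    (fun s _ => (hd s).differentiableAt.differentiableWithinAt) (fun s hs => ?_)
    s hs t (hs.trans hst) hst
  rw [(hd s).deriv]
  exact hc s (interior_subset hs)

/-- With the integrating factor `e^(-(a(t) - a(s)))` the solution tends to zero as `t → ∞`, since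
its growth rate `β` is below `c`. So `w s` is controlled by the integral of the forcing over `[s,
∞)` and no initial value appears. The growing terms `e^(βs)` are admitted for the bootstrap in
`isBigO_of_residual`. -/
theorem norm_le_of_unstable {μ w w' : ℝ → ℂ} (hμ : Continuous μ) {c β s₀ D E ε₀ ε₁ : ℝ}
    (hβ : 0 ≤ β) (hβc : β < c) (hc : ∀ s, s₀ ≤ s → c ≤ (μ s).re)
    (hw : ∀ s, s₀ ≤ s → HasDerivAt w (w' s) s)
    (hb : ∀ s, s₀ ≤ s → ‖w' s - μ s * w s‖ ≤ ε₀ + ε₁ * Real.exp (β * s)) (hε₁ : 0 ≤ ε₁)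
    (hε₀ : 0 ≤ ε₀) (hg : ∀ s, s₀ ≤ s → ‖w s‖ ≤ D + E * Real.exp (β * s)) {s : ℝ} (hs : s₀ ≤ s) :
    ‖w s‖ ≤ (ε₀ + ε₁ * Real.exp (β * s)) / (c - β) := by
  set a : ℝ → ℂ := fun s => ∫ t in (0 : ℝ)..s, μ t with ha
  have had := hasDerivAt_primitive hμ
  have hre : ∀ t, s ≤ t → ‖Complex.exp (-(a t - a s))‖ ≤ Real.exp (-(c * (t - s))) := by
    intro t ht
    rw [Complex.norm_exp, Complex.neg_re]
    exact Real.exp_le_exp.2 (neg_le_neg (mul_sub_le_re_sub had hc hs ht))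
  set f : ℝ → ℂ := fun t => Complex.exp (-(a t - a s)) * w t - w s with hf
  have hfd : ∀ t, s ≤ t → HasDerivAt f (Complex.exp (-(a t - a s)) * (w' t - μ t * w t)) t := by
    intro t ht
    have h1 := ((((had t).sub_const (a s)).fun_neg.cexp).mul (hw t (hs.trans ht))).sub_const (w s)
    convert! h1 using 1
    ring
  set δ := c - β with hδ
  have hδ0 : 0 < δ := sub_pos.2 hβc
  set A := (ε₀ + ε₁ * Real.exp (β * s)) with hA
  have hA0 : 0 ≤ A := by positivity
  have hbound : ∀ t, s ≤ t → ‖Complex.exp (-(a t - a s)) * (w' t - μ t * w t)‖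
      ≤ A * Real.exp (-(δ * (t - s))) := by
    intro t ht
    rw [norm_mul]
    refine (mul_le_mul (hre t ht) (hb t (hs.trans ht)) (norm_nonneg _) (Real.exp_nonneg _)).trans ?_
    have e1 : Real.exp (-(c * (t - s))) = Real.exp (-(δ * (t - s))) * Real.exp (-(β * (t - s))) := by
      rw [← Real.exp_add]; congr 1; rw [hδ]; ring
    have e2 : Real.exp (-(β * (t - s))) * Real.exp (β * t) = Real.exp (β * s) := by
      rw [← Real.exp_add]; congr 1; ring
    have e3 : Real.exp (-(β * (t - s))) ≤ 1 :=
      Real.exp_le_one_iff.2 (neg_nonpos.2 (mul_nonneg hβ (sub_nonneg.2 ht)))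
    rw [e1, mul_assoc, mul_comm A]
    refine mul_le_mul_of_nonneg_left ?_ (Real.exp_nonneg _)
    calc _ = ε₀ * Real.exp (-(β * (t - s)))
        + ε₁ * (Real.exp (-(β * (t - s))) * Real.exp (β * t)) := by ring
      _ ≤ _ := by rw [e2, hA]; gcongr; exact mul_le_of_le_one_right hε₀ e3
  have key : ∀ t, s ≤ t → ‖f t‖ ≤ A / δ := by
    intro t ht
    have hB : ∀ x, HasDerivAt (fun x => A / δ - A / δ * Real.exp (-(δ * (x - s))))
        (A * Real.exp (-(δ * (x - s)))) x := by
      intro x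
      have h1 := ((((hasDerivAt_id x).sub_const s).const_mul δ).fun_neg.exp.const_mul (A / δ)).const_sub
        (A / δ)
      convert! h1 using 1
      simp only [mul_one, id]
      field_simp
    have := image_norm_le_of_norm_deriv_right_le_deriv_boundary (f := f) (a := s) (b := t)
      (fun x hx => (hfd x hx.1).continuousAt.continuousWithinAt)
      (fun x hx => (hfd x hx.1).hasDerivWithinAt) (by simp [hf]) hB
      (fun x hx => hbound x hx.1) (Set.right_mem_Icc.2 ht)
    refine this.trans (sub_le_self _ (by positivity))
  have hlim : Tendsto f atTop (𝓝 (0 - w s)) := by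
    refine Tendsto.sub_const ?_ _
    have hlin : Tendsto (fun t => c * (t - s)) atTop atTop :=
      (tendsto_atTop_add_const_right _ _ tendsto_id).const_mul_atTop (hβ.trans_lt hβc)
    have hlin' : Tendsto (fun t => δ * (t - s)) atTop atTop :=
      (tendsto_atTop_add_const_right _ _ tendsto_id).const_mul_atTop hδ0
    have h0 : Tendsto (fun t => D * Real.exp (-(c * (t - s)))
        + E * Real.exp (β * s) * Real.exp (-(δ * (t - s)))) atTop (𝓝 0) := by
      have := ((Real.tendsto_exp_neg_atTop_nhds_zero.comp hlin).const_mul D).add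
        ((Real.tendsto_exp_neg_atTop_nhds_zero.comp hlin').const_mul (E * Real.exp (β * s)))
      simpa using this
    refine squeeze_zero_norm' ?_ h0
    filter_upwards [eventually_ge_atTop s] with t ht
    rw [norm_mul]
    refine (mul_le_mul (hre t ht) (hg t (hs.trans ht)) (norm_nonneg _) (Real.exp_nonneg _)).trans
      (le_of_eq ?_)
    have : Real.exp (-(c * (t - s))) * Real.exp (β * t)
        = Real.exp (β * s) * Real.exp (-(δ * (t - s))) := by
      rw [← Real.exp_add, ← Real.exp_add]; congr 1; rw [hδ]; ring
    linear_combination E * this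
  have := le_of_tendsto hlim.norm ((eventually_ge_atTop s).mono key)
  simpa using this

/-- Here the variation of constants runs forward from `s₀`, which leaves the initial value in the
bound. The forcing bound is increasing and can be replaced by its value at `s`. The denominator `c -
β` instead of `c` only serves to match the unstable case. -/
theorem norm_le_of_stable {μ w w' : ℝ → ℂ} (hμ : Continuous μ) {c β s₀ ε₀ ε₁ : ℝ}
    (hβ : 0 ≤ β) (hβc : β < c) (hc : ∀ s, s₀ ≤ s → (μ s).re ≤ -c)
    (hw : ∀ s, s₀ ≤ s → HasDerivAt w (w' s) s)
    (hb : ∀ s, s₀ ≤ s → ‖w' s - μ s * w s‖ ≤ ε₀ + ε₁ * Real.exp (β * s)) (hε₁ : 0 ≤ ε₁)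
    (hε₀ : 0 ≤ ε₀) {s : ℝ} (hs : s₀ ≤ s) :
    ‖w s‖ ≤ ‖w s₀‖ + (ε₀ + ε₁ * Real.exp (β * s)) / (c - β) := by
  set a : ℝ → ℂ := fun s => ∫ t in (0 : ℝ)..s, μ t with ha
  have had := hasDerivAt_primitive hμ
  have hc0 : 0 < c := hβ.trans_lt hβc
  have hre : ∀ t, s₀ ≤ t → t ≤ s → ‖Complex.exp (-(a t - a s))‖ ≤ Real.exp (-(c * (s - t))) := by
    intro t h0 ht
    rw [Complex.norm_exp]
    have h1 := mul_sub_le_re_sub (a := fun s => -a s) (μ := fun s => -μ s) (c := c)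
      (fun s => (had s).neg) (fun s hs => by simpa using le_neg_of_le_neg (hc s hs)) h0 ht
    refine Real.exp_le_exp.2 ?_
    simp only [Complex.sub_re, Complex.neg_re] at h1 ⊢
    linarith
  set f : ℝ → ℂ := fun t => Complex.exp (-(a t - a s)) * w t with hf
  have hfd : ∀ t, s₀ ≤ t → HasDerivAt f (Complex.exp (-(a t - a s)) * (w' t - μ t * w t)) t := by
    intro t ht
    have h1 := ((((had t).sub_const (a s)).fun_neg.cexp).mul (hw t ht))
    convert! h1 using 1
    ring
  set A := (ε₀ + ε₁ * Real.exp (β * s)) with hA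
  have hA0 : 0 ≤ A := by positivity
  have hbound : ∀ t, s₀ ≤ t → t ≤ s → ‖Complex.exp (-(a t - a s)) * (w' t - μ t * w t)‖
      ≤ A * Real.exp (-(c * (s - t))) := by
    intro t h0 ht
    rw [norm_mul, mul_comm A]
    refine mul_le_mul (hre t h0 ht) ((hb t h0).trans ?_) (norm_nonneg _) (Real.exp_nonneg _)
    rw [hA]
    gcongr
  have hB : ∀ x, HasDerivAt (fun x => ‖w s₀‖ + A / c * Real.exp (-(c * (s - x))))
      (A * Real.exp (-(c * (s - x)))) x := by
    intro x
    have h1 := ((((hasDerivAt_id x).const_sub s).const_mul c).fun_neg.exp.const_mul (A / c)).const_add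
      ‖w s₀‖
    convert! h1 using 1
    simp only [id]
    field_simp
  have h := image_norm_le_of_norm_deriv_right_le_deriv_boundary (f := f) (a := s₀) (b := s)
    (fun x hx => (hfd x hx.1).continuousAt.continuousWithinAt)
    (fun x hx => (hfd x hx.1).hasDerivWithinAt)
    (by
      have h2 : ‖f s₀‖ ≤ ‖w s₀‖ := by
        rw [hf, norm_mul]
        refine mul_le_of_le_one_left (norm_nonneg _) ((hre s₀ le_rfl hs).trans ?_)
        exact Real.exp_le_one_iff.2 (neg_nonpos.2 (mul_nonneg hc0.le (sub_nonneg.2 hs)))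
      refine h2.trans (le_add_of_nonneg_right (by positivity))) hB
    (fun x hx => hbound x hx.1 hx.2.le) (Set.right_mem_Icc.2 hs)
  have e : ‖f s‖ = ‖w s‖ := by simp [hf]
  rw [e] at h
  refine h.trans ?_
  have h3 : A / c ≤ A / (c - β) := div_le_div_of_nonneg_left hA0 (by linarith) (by linarith)
  simpa using h3

/-- The bounded solution is `-∫_s^∞ e^(a(s) - a(t)) f(t) dt`, where `a` is a primitive of `μ`; the
integrand decays like `e^(-c(t - s))`. -/
theorem exists_bounded_of_unstable {μ f : ℝ → ℂ} (hμ : Continuous μ) (hf : Continuous f)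
    {c F : ℝ} (hc0 : 0 < c) (hc : ∀ s, c ≤ (μ s).re) (hF : ∀ s, ‖f s‖ ≤ F) :
    ∃ w : ℝ → ℂ, (∀ s, HasDerivAt w (μ s * w s + f s) s) ∧ ∀ s, ‖w s‖ ≤ F / c := by
  set a : ℝ → ℂ := fun s => ∫ t in (0 : ℝ)..s, μ t with ha
  have had := hasDerivAt_primitive hμ
  have hac : Continuous a := continuous_iff_continuousAt.2 fun s => (had s).continuousAt
  set g : ℝ → ℂ := fun t => Complex.exp (-a t) * f t with hg
  have hgc : Continuous g := (Complex.continuous_exp.comp hac.neg).mul hf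
  have hF0 : 0 ≤ F := (norm_nonneg _).trans (hF 0)
  have hgb : ∀ s t, s ≤ t → ‖g t‖ ≤ ‖Complex.exp (-a s)‖ * (F * Real.exp (c * s)) *
      Real.exp (-c * t) := by
    intro s t hst
    have h1 := mul_sub_le_re_sub had (s₀ := s) (fun s _ => hc s) le_rfl hst
    rw [hg, norm_mul, Complex.norm_exp, Complex.norm_exp]
    have h2 : Real.exp (-a t).re ≤ Real.exp (-a s).re * Real.exp (c * s) * Real.exp (-c * t) := by
      rw [← Real.exp_add, ← Real.exp_add]
      refine Real.exp_le_exp.2 ?_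
      simp only [Complex.sub_re, Complex.neg_re] at h1 ⊢
      linarith
    calc _ ≤ Real.exp (-a s).re * Real.exp (c * s) * Real.exp (-c * t) * F :=
          mul_le_mul h2 (hF t) (norm_nonneg _) (by positivity)
      _ = _ := by ring
  have hgi : ∀ s, MeasureTheory.IntegrableOn g (Set.Ioi s) := by
    intro s
    refine MeasureTheory.Integrable.mono'
      ((integrableOn_exp_mul_Ioi (neg_lt_zero.2 hc0) s).const_mul
        (‖Complex.exp (-a s)‖ * (F * Real.exp (c * s))))
      hgc.aestronglyMeasurable ?_
    filter_upwards [MeasureTheory.ae_restrict_mem measurableSet_Ioi] with t ht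
    exact hgb s t (le_of_lt ht)
  set J : ℝ → ℂ := fun s => ∫ t in Set.Ioi s, g t with hJ
  have hJd : ∀ s, HasDerivAt J (-g s) s := by
    intro s
    have e : J = fun s => (∫ t in Set.Ioi (0 : ℝ), g t) - ∫ t in (0 : ℝ)..s, g t := by
      funext s
      rw [hJ, ← intervalIntegral.integral_interval_add_Ioi (hgi 0) (hgi s)]
      ring
    rw [e]
    exact (hasDerivAt_primitive hgc s).const_sub _
  refine ⟨fun s => -Complex.exp (a s) * J s, fun s => ?_, fun s => ?_⟩
  · have h1 := ((had s).cexp.fun_neg).mul (hJd s)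
    convert! h1 using 1
    have h2 : Complex.exp (a s) * Complex.exp (-a s) = 1 := by
      rw [← Complex.exp_add, add_neg_cancel, Complex.exp_zero]
    simp only [hg]
    linear_combination (-f s) * h2
  · have h1 : ‖J s‖ ≤ ‖Complex.exp (-a s)‖ * (F / c) := by
      refine (MeasureTheory.norm_integral_le_of_norm_le
        ((integrableOn_exp_mul_Ioi (neg_lt_zero.2 hc0) s).const_mul
        (‖Complex.exp (-a s)‖ * (F * Real.exp (c * s)))) ?_).trans (le_of_eq ?_)
      · filter_upwards [MeasureTheory.ae_restrict_mem measurableSet_Ioi] with t ht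
        exact hgb s t (le_of_lt ht)
      · rw [MeasureTheory.integral_const_mul, integral_exp_mul_Ioi (neg_lt_zero.2 hc0)]
        have : Real.exp (c * s) * Real.exp (-c * s) = 1 := by
          rw [← Real.exp_add]; simp
        calc _ = ‖Complex.exp (-a s)‖ * (F / c) * (Real.exp (c * s) * Real.exp (-c * s)) := by ring
          _ = _ := by rw [this, mul_one]
    rw [norm_mul, norm_neg]
    calc _ ≤ ‖Complex.exp (a s)‖ * (‖Complex.exp (-a s)‖ * (F / c)) := by gcongr
      _ = F / c := by
        rw [← mul_assoc, ← norm_mul, ← Complex.exp_add, add_neg_cancel, Complex.exp_zero]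
        simp

/-- The real part of `μ` is at least `c` everywhere, or at most `-c` everywhere. -/
def Definite (c : ℝ) (μ : ℝ → ℂ) : Prop := (∀ s, c ≤ (μ s).re) ∨ ∀ s, (μ s).re ≤ -c

theorem exists_bounded_solution {μ f : ℝ → ℂ} (hμ : Continuous μ) (hf : Continuous f)
    {c F : ℝ} (hc0 : 0 < c) (hc : Definite c μ) (hF : ∀ s, ‖f s‖ ≤ F) :
    ∃ w : ℝ → ℂ, (∀ s, HasDerivAt w (μ s * w s + f s) s) ∧ ∀ s, ‖w s‖ ≤ F / c := by
  rcases hc with hc | hc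
  · exact exists_bounded_of_unstable hμ hf hc0 hc hF
  -- Reversing time exchanges the two signs of the real part.
  · obtain ⟨w, hw, hwb⟩ := exists_bounded_of_unstable (μ := fun s => -μ (-s)) (f := fun s => -f (-s))
      (hμ.comp continuous_neg).neg (hf.comp continuous_neg).neg hc0
      (fun s => by simpa using le_neg_of_le_neg (hc (-s))) (F := F) (fun s => by simpa using hF (-s))
    refine ⟨fun s => w (-s), fun s => ?_, fun s => hwb (-s)⟩
    have := (hw (-s)).scomp s (hasDerivAt_neg s)
    convert! this using 1
    simp

/-- The bound does not involve `B`: an equation with definite real part has only one solution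
bounded on the whole line. Applied to differences of solutions, this gives the contraction estimate.
-/
theorem norm_le_of_bounded_solution {μ f w : ℝ → ℂ} (hμ : Continuous μ)
    {c F B : ℝ} (hc0 : 0 < c) (hc : Definite c μ) (hF : ∀ s, ‖f s‖ ≤ F)
    (hw : ∀ s, HasDerivAt w (μ s * w s + f s) s) (hB : ∀ s, ‖w s‖ ≤ B) (s : ℝ) :
    ‖w s‖ ≤ F / c := by
  have hF0 : 0 ≤ F := (norm_nonneg _).trans (hF 0)
  rcases hc with hc | hc
  · have := norm_le_of_unstable hμ le_rfl hc0 (s₀ := s) (fun s _ => hc s) (fun s _ => hw s)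
      (ε₀ := F) (ε₁ := 0) (fun s _ => by simpa using hF s) le_rfl hF0 (D := B) (E := 0)
      (fun s _ => by simpa using hB s) le_rfl
    simpa using this
  · have hw' : ∀ s, HasDerivAt (fun s => w (-s)) (-(μ (-s) * w (-s) + f (-s))) s := by
      intro s
      have := (hw (-s)).scomp s (hasDerivAt_neg s)
      convert! this using 1
      rw [neg_one_smul]
    have := norm_le_of_unstable (μ := fun s => -μ (-s)) (w := fun s => w (-s))
      (hμ.comp continuous_neg).neg le_rfl hc0 (s₀ := -s)
      (fun s _ => by simpa using le_neg_of_le_neg (hc (-s))) (fun s _ => hw' s)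
      (ε₀ := F) (ε₁ := 0) (fun s _ => by
        have e : -(μ (-s) * w (-s) + f (-s)) - -μ (-s) * w (-s) = -f (-s) := by ring
        simpa [e] using hF (-s)) le_rfl hF0 (D := B) (E := 0)
      (fun s _ => by simpa using hB (-s)) le_rfl
    simpa using this

/-! ### Bounded solutions of weakly nonlinear systems -/

/-- Evaluate `h` along a given function `w`, solve the resulting linear equation by its bounded
solution, and iterate. On the unit ball of bounded continuous functions, `K + K' ≤ c` makes the ball
invariant and `K < c` makes the map a contraction with factor `K / c`. -/
theorem exists_bounded_solution_nonlinear {ι : Type} [Fintype ι] {μ : ι → ℝ → ℂ}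
    (hμ : ∀ i, Continuous (μ i)) {c K K' : ℝ} (hK : 0 ≤ K) (hKc : K < c) (hKK : K + K' ≤ c)
    (hc : ∀ i, Definite c (μ i)) {h : ℝ → (ι → ℂ) → ι → ℂ}
    (hh : Continuous fun z : ℝ × (ι → ℂ) => h z.1 z.2)
    (hL : ∀ s U V, ‖U‖ ≤ 1 → ‖V‖ ≤ 1 → ‖h s U - h s V‖ ≤ K * ‖U - V‖)
    (h0 : ∀ s, ‖h s 0‖ ≤ K') :
    ∃ U : ℝ → ι → ℂ, (∀ s, ‖U s‖ ≤ 1) ∧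
      ∀ s, HasDerivAt U (fun i => μ i s * U s i + h s (U s) i) s := by
  have hc0 : 0 < c := hK.trans_lt hKc
  set X := {w : BoundedContinuousFunction ℝ (ι → ℂ) // w ∈ Metric.closedBall 0 1}
  have hX : ∀ w : X, ∀ s, ‖w.1 s‖ ≤ 1 := fun w s =>
    (w.1.norm_coe_le_norm s).trans (mem_closedBall_zero_iff.1 w.2)
  have hhb : ∀ s U, ‖U‖ ≤ 1 → ‖h s U‖ ≤ c := by
    intro s U hU
    have h1 := hL s U 0 hU (by simp)
    rw [sub_zero] at h1
    have h2 : ‖h s U‖ ≤ ‖h s U - h s 0‖ + ‖h s 0‖ := by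
      simpa using norm_add_le (h s U - h s 0) (h s 0)
    nlinarith [h0 s]
  have hex : ∀ w : X, ∃ w' : X, ∀ s, HasDerivAt w'.1 (fun i => μ i s * w'.1 s i + h s (w.1 s) i) s := by
    intro w
    have hcont : Continuous fun s => h s (w.1 s) := hh.comp (continuous_id.prodMk w.1.continuous)
    have : ∀ i, ∃ u : ℝ → ℂ, (∀ s, HasDerivAt u (μ i s * u s + h s (w.1 s) i) s) ∧
        ∀ s, ‖u s‖ ≤ c / c := fun i =>
      exists_bounded_solution (hμ i) ((continuous_apply i).comp hcont) hc0 (hc i) fun s =>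
        (norm_le_pi_norm _ i).trans (hhb s _ (hX w s))
    choose u hu hub using this
    have hud : ∀ s, HasDerivAt (fun s i => u i s) (fun i => μ i s * u i s + h s (w.1 s) i) s :=
      fun s => hasDerivAt_pi.2 fun i => hu i s
    have hb : ∀ s, ‖fun i => u i s‖ ≤ 1 := fun s =>
      (pi_norm_le_iff_of_nonneg zero_le_one).2 fun i => by simpa [hc0.ne'] using hub i s
    refine ⟨⟨BoundedContinuousFunction.ofNormedAddCommGroup (fun s i => u i s)
      (continuous_iff_continuousAt.2 fun s => (hud s).continuousAt) 1 hb, ?_⟩, hud⟩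
    rw [mem_closedBall_zero_iff]
    exact BoundedContinuousFunction.norm_ofNormedAddCommGroup_le _ zero_le_one hb
  choose T hT using hex
  have hcontr : ContractingWith (K / c).toNNReal T := by
    refine ⟨?_, LipschitzWith.of_dist_le_mul fun w₁ w₂ => ?_⟩
    · exact Real.toNNReal_lt_one.2 ((div_lt_one hc0).2 hKc)
    · rw [Real.coe_toNNReal _ (div_nonneg hK hc0.le)]
      rw [Subtype.dist_eq, Subtype.dist_eq, BoundedContinuousFunction.dist_le
        (mul_nonneg (div_nonneg hK hc0.le) dist_nonneg)]
      intro s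
      rw [dist_eq_norm, pi_norm_le_iff_of_nonneg (mul_nonneg (div_nonneg hK hc0.le) dist_nonneg)]
      intro i
      have key := norm_le_of_bounded_solution (hμ i) hc0 (hc i)
        (w := fun s => (T w₁).1 s i - (T w₂).1 s i)
        (f := fun s => h s (w₁.1 s) i - h s (w₂.1 s) i) (F := K * dist w₁.1 w₂.1) (B := 2)
        (fun s => ?_) (fun s => ?_) (fun s => ?_) s
      · rw [Pi.sub_apply]
        refine key.trans (le_of_eq ?_)
        ring
      · refine (norm_le_pi_norm (h s (w₁.1 s) - h s (w₂.1 s)) i).trans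
          ((hL s _ _ (hX w₁ s) (hX w₂ s)).trans ?_)
        rw [← dist_eq_norm]
        exact mul_le_mul_of_nonneg_left (BoundedContinuousFunction.dist_coe_le_dist s) hK
      · convert! (hasDerivAt_pi.1 (hT w₁ s) i).sub (hasDerivAt_pi.1 (hT w₂ s) i) using 1
        ring
      · have h1 := (norm_le_pi_norm _ i).trans (hX (T w₁) s)
        have h2 := (norm_le_pi_norm _ i).trans (hX (T w₂) s)
        exact (norm_sub_le _ _).trans (by linarith)
  have : CompleteSpace X := Metric.isClosed_closedBall.completeSpace_coe
  have : Nonempty X := ⟨⟨0, by simp⟩⟩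
  have hfix := hcontr.fixedPoint_isFixedPt
  set w := hcontr.fixedPoint
  refine ⟨w.1, hX w, fun s => ?_⟩
  have := hT w s
  rwa [hfix.eq] at this


/-! ### Solutions near approximate solutions -/

section Approximations

variable {ι : Type} [Fintype ι] {μ : ι → ℝ → ℂ} {H : ℝ → (ι → ℂ) → ι → ℂ} {s₀ K κ : ℝ}

theorem hasDerivAt_exp_mul_pi (m : ℝ) {W : ℝ → ι → ℂ} {W' : ι → ℂ} {s : ℝ} (hW : HasDerivAt W W' s) :
    HasDerivAt (fun s => Real.exp (m * s) • W s)
      (Real.exp (m * s) • (W' + m • W s)) s := by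
  have h1 : HasDerivAt (fun s => Real.exp (m * s)) (Real.exp (m * s) * m) s := by
    simpa using ((hasDerivAt_id s).const_mul m).exp
  convert! h1.smul hW using 1
  rw [smul_add, smul_smul]

/-- A solution close to one approximate solution `A` whose residual `R` is small. -/
theorem exists_solution_near (hμ : ∀ i, ContinuousOn (μ i) (Set.Ici s₀))
    (hH : ContinuousOn (fun z : ℝ × (ι → ℂ) => H z.1 z.2) (Set.Ici s₀ ×ˢ Set.univ))
    (hK : 0 ≤ K) (hL : ∀ s, s₀ ≤ s → ∀ U V, ‖U‖ ≤ Real.exp (-(κ * s)) → ‖V‖ ≤ Real.exp (-(κ * s)) →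
      ‖H s U - H s V‖ ≤ K * ‖U - V‖) {A R : ℝ → ι → ℂ}
    (hA : ∀ s, s₀ ≤ s → HasDerivAt A (fun i => μ i s * A s i + H s (A s) i + R s i) s)
    (hRc : ContinuousOn R (Set.Ici s₀)) {c m : ℝ} (hKc : K < c) (hKc' : K + 1 ≤ c)
    (hm : ∀ i, (∀ s, s₀ ≤ s → c ≤ (μ i s).re + m) ∨ ∀ s, s₀ ≤ s → (μ i s).re + m ≤ -c)
    (hR : ∀ s, s₀ ≤ s → ‖R s‖ ≤ Real.exp (-(m * s)))
    (hAs : ∀ s, s₀ ≤ s → ‖A s‖ + Real.exp (-(m * s)) ≤ Real.exp (-(κ * s))) :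
    ∃ U : ℝ → ι → ℂ, (∀ s, s₀ < s → HasDerivAt U (fun i => μ i s * U s i + H s (U s) i) s) ∧
      ∀ s, s₀ ≤ s → ‖U s - A s‖ ≤ Real.exp (-(m * s)) := by
  -- Freezing time before `s₀` extends the equation to the whole line, where bounded solutions are
  -- sought; nothing changes for `s ≥ s₀`.
  set σ : ℝ → ℝ := fun s => max s s₀ with hσ
  have hσc : Continuous σ := continuous_id.max continuous_const
  have hσ0 : ∀ s, s₀ ≤ σ s := fun s => le_max_right _ _
  have hσm : ∀ s, σ s ∈ Set.Ici s₀ := hσ0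
  have hAc : ContinuousOn A (Set.Ici s₀) := fun s hs => (hA s hs).continuousAt.continuousWithinAt
  have hAσ : Continuous fun s => A (σ s) := hAc.comp_continuous hσc hσm
  have hexp : ∀ x : ℝ, Real.exp (m * x) * Real.exp (-(m * x)) = 1 := fun x => by
    rw [← Real.exp_add, add_neg_cancel, Real.exp_zero]
  have hin : ∀ s, s₀ ≤ s → ∀ W : ι → ℂ, ‖W‖ ≤ 1 →
      ‖A s + Real.exp (-(m * s)) • W‖ ≤ Real.exp (-(κ * s)) := by
    intro s hs W hW
    refine (norm_add_le _ _).trans (le_trans ?_ (hAs s hs))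
    rw [norm_smul, Real.norm_of_nonneg (Real.exp_nonneg _)]
    gcongr
    exact mul_le_of_le_one_right (Real.exp_nonneg _) hW
  have hin0 : ∀ s, s₀ ≤ s → ‖A s‖ ≤ Real.exp (-(κ * s)) := fun s hs => by
    simpa using hin s hs 0 (by simp)
  -- The nonlinear part of the equation for `W` in `U = A + e^(-ms) W`. The weight adds `m` to every
  -- rate and preserves the Lipschitz constant `K`; the value at `W = 0` is the weighted residual,
  -- of norm at most `1`.
  set h : ℝ → (ι → ℂ) → ι → ℂ := fun s W => Real.exp (m * σ s) •
    (H (σ s) (A (σ s) + Real.exp (-(m * σ s)) • W) - H (σ s) (A (σ s)) - R (σ s)) with hh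
  have hHσ : ∀ {f : ℝ × (ι → ℂ) → ι → ℂ}, Continuous f →
      Continuous fun z : ℝ × (ι → ℂ) => H (σ z.1) (f z) := fun {f} hf =>
    hH.comp_continuous ((hσc.comp continuous_fst).prodMk hf) fun z => ⟨hσm z.1, Set.mem_univ _⟩
  have hcexp : ∀ c : ℝ, Continuous fun z : ℝ × (ι → ℂ) => Real.exp (c * σ z.1) := fun c =>
    Real.continuous_exp.comp (continuous_const.mul (hσc.comp continuous_fst))
  obtain ⟨W, hW1, hW⟩ := exists_bounded_solution_nonlinear
    (μ := fun i s => μ i (σ s) + m) (c := c) (K := K) (K' := 1) (h := h)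
    (fun i => ((hμ i).comp_continuous hσc hσm).add continuous_const) hK hKc hKc'
    (fun i => (hm i).imp (fun hi s => by simpa using hi _ (hσ0 s))
      fun hi s => by simpa using hi _ (hσ0 s))
    (by
      refine (hcexp m).smul (((hHσ ?_).sub (hHσ (hAσ.comp continuous_fst))).sub
        ((hRc.comp_continuous hσc hσm).comp continuous_fst))
      refine (hAσ.comp continuous_fst).add ?_
      simpa only [neg_mul] using! (hcexp (-m)).smul continuous_snd)
    (by
      intro s U V hU hV
      have e : h s U - h s V = Real.exp (m * σ s) • (H (σ s) (A (σ s) + Real.exp (-(m * σ s)) • U)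
          - H (σ s) (A (σ s) + Real.exp (-(m * σ s)) • V)) := by
        simp only [hh, ← smul_sub]; congr 1; abel
      rw [e, norm_smul, Real.norm_of_nonneg (Real.exp_nonneg _)]
      have h1 := hL _ (hσ0 s) _ _ (hin _ (hσ0 s) U hU) (hin _ (hσ0 s) V hV)
      rw [add_sub_add_left_eq_sub, ← smul_sub, norm_smul, Real.norm_of_nonneg (Real.exp_nonneg _)]
        at h1
      calc _ ≤ Real.exp (m * σ s) * (K * (Real.exp (-(m * σ s)) * ‖U - V‖)) := by gcongr
        _ = (Real.exp (m * σ s) * Real.exp (-(m * σ s))) * (K * ‖U - V‖) := by ring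
        _ = _ := by rw [hexp, one_mul])
    (by
      intro s
      have e : h s 0 = Real.exp (m * σ s) • (-R (σ s)) := by simp [hh]
      rw [e, norm_smul, Real.norm_of_nonneg (Real.exp_nonneg _), norm_neg, ← hexp (σ s)]
      exact mul_le_mul_of_nonneg_left (hR _ (hσ0 s)) (Real.exp_nonneg _))
  refine ⟨fun s => A s + Real.exp (-(m * s)) • W s, fun s hs => ?_, fun s hs => ?_⟩
  · have hσs : σ s = s := max_eq_left hs.le
    have h2 := (hA s hs.le).add (hasDerivAt_exp_mul_pi (-m) (hW s))
    simp only [neg_mul] at h2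
    convert! h2 using 1
    funext i
    have e2 : Real.exp (-(m * s)) • h s (W s) =
        H s (A s + Real.exp (-(m * s)) • W s) - H s (A s) - R s := by
      simp only [hh, hσs]
      rw [smul_smul, mul_comm, hexp, one_smul]
    have e3 := congrFun e2 i
    simp only [Pi.smul_apply, Pi.sub_apply, Pi.add_apply, Complex.real_smul, hσs] at e3 ⊢
    push_cast at e3 ⊢
    linear_combination -e3
  · rw [add_sub_cancel_left, norm_smul, Real.norm_of_nonneg (Real.exp_nonneg _)]
    exact mul_le_of_le_one_right (Real.exp_nonneg _) (hW1 s)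

/-- A solution that approaches an approximate solution `A` at a slower rate than the residual of `A`
does so at the rate of the residual. -/
theorem isBigO_of_residual (hμ : ∀ i, ContinuousOn (μ i) (Set.Ici s₀))
    (hK : 0 ≤ K) (hL : ∀ s, s₀ ≤ s → ∀ U V, ‖U‖ ≤ Real.exp (-(κ * s)) → ‖V‖ ≤ Real.exp (-(κ * s)) →
      ‖H s U - H s V‖ ≤ K * ‖U - V‖) {A R U : ℝ → ι → ℂ}
    (hA : ∀ s, s₀ ≤ s → HasDerivAt A (fun i => μ i s * A s i + H s (A s) i + R s i) s)
    (hU : ∀ s, s₀ ≤ s → HasDerivAt U (fun i => μ i s * U s i + H s (U s) i) s)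
    {c m β B E : ℝ} (hc : 0 < c) (hKc : 2 * K ≤ c) (hβ : 0 ≤ β) (hB : 0 ≤ B) (hE : 0 ≤ E)
    (hm : ∀ i, (∀ s, s₀ ≤ s → c + β ≤ (μ i s).re + m) ∨ ∀ s, s₀ ≤ s → (μ i s).re + m ≤ -(c + β))
    (hR : ∀ s, s₀ ≤ s → ‖R s‖ ≤ B * Real.exp (-(m * s)))
    (hAs : ∀ s, s₀ ≤ s → ‖A s‖ ≤ Real.exp (-(κ * s)))
    (hUs : ∀ s, s₀ ≤ s → ‖U s‖ ≤ Real.exp (-(κ * s)))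
    (hUA : ∀ s, s₀ ≤ s → ‖U s - A s‖ ≤ E * Real.exp ((β - m) * s)) :
    ∃ D, ∀ s, s₀ ≤ s → ‖U s - A s‖ ≤ D * Real.exp (-(m * s)) := by
  have hexp : ∀ x : ℝ, Real.exp (m * x) * Real.exp (-(m * x)) = 1 := fun x => by
    rw [← Real.exp_add, add_neg_cancel, Real.exp_zero]
  set σ : ℝ → ℝ := fun s => max s s₀ with hσ
  have hσc : Continuous σ := continuous_id.max continuous_const
  have hσ0 : ∀ s, s₀ ≤ σ s := fun s => le_max_right _ _
  set V : ℝ → ι → ℂ := fun s => Real.exp (m * s) • (U s - A s) with hV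
  have hVn : ∀ s, ‖V s‖ = Real.exp (m * s) * ‖U s - A s‖ := fun s => by
    rw [hV, norm_smul, Real.norm_of_nonneg (Real.exp_nonneg _)]
  have hVd : ∀ s, s₀ ≤ s → HasDerivAt V (fun i => (μ i s + m) * V s i
      + Real.exp (m * s) * (H s (U s) i - H s (A s) i - R s i)) s := by
    intro s hs
    convert! hasDerivAt_exp_mul_pi m ((hU s hs).sub (hA s hs)) using 1
    funext i
    simp only [hV, Pi.smul_apply, Pi.sub_apply, Pi.add_apply, Complex.real_smul]
    ring
  -- Chosen so that `‖V s₀‖ + B/c + D/2 = D`. Since `K/c ≤ 1/2`, one pass through the linear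
  -- estimates reproduces `D` and halves the coefficient `E` of the growing term.
  set D := 2 * (‖V s₀‖ + B / c) with hD
  have hD0 : 0 ≤ D := by positivity
  have step : ∀ E, 0 ≤ E → (∀ s, s₀ ≤ s → ‖V s‖ ≤ D + E * Real.exp (β * s)) →
      ∀ s, s₀ ≤ s → ‖V s‖ ≤ D + E / 2 * Real.exp (β * s) := by
    intro E hE hg s hs
    refine (pi_norm_le_iff_of_nonneg (by positivity)).2 fun i => ?_
    have hb : ∀ s, s₀ ≤ s → ‖(μ i s + m) * V s i
        + Real.exp (m * s) * (H s (U s) i - H s (A s) i - R s i) - (μ i (σ s) + m) * V s i‖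
        ≤ (B + K * D) + K * E * Real.exp (β * s) := by
      intro s hs
      have hσs : σ s = s := max_eq_left hs
      rw [hσs, add_sub_cancel_left, norm_mul, Complex.norm_real,
        Real.norm_of_nonneg (Real.exp_nonneg _)]
      have h1 : ‖H s (U s) i - H s (A s) i - R s i‖ ≤ K * ‖U s - A s‖ + B * Real.exp (-(m * s)) := by
        refine (norm_sub_le _ _).trans (add_le_add ?_ ((norm_le_pi_norm _ i).trans (hR s hs)))
        exact (norm_le_pi_norm (H s (U s) - H s (A s)) i).trans (hL s hs _ _ (hUs s hs) (hAs s hs))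
      calc _ ≤ Real.exp (m * s) * (K * ‖U s - A s‖ + B * Real.exp (-(m * s))) := by gcongr
        _ = K * ‖V s‖ + B * (Real.exp (m * s) * Real.exp (-(m * s))) := by rw [hVn]; ring
        _ ≤ K * (D + E * Real.exp (β * s)) + B := by
          rw [hexp, mul_one]
          gcongr
          exact hg s hs
        _ = _ := by ring
    have hμc : Continuous fun s => μ i (σ s) + m :=
      ((hμ i).comp_continuous hσc hσ0).add continuous_const
    have hVi : ∀ s, s₀ ≤ s → HasDerivAt (fun s => V s i) ((μ i s + m) * V s i
      + Real.exp (m * s) * (H s (U s) i - H s (A s) i - R s i)) s := fun s hs =>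
      hasDerivAt_pi.1 (hVd s hs) i
    have hfin : ‖V s i‖ ≤ ‖V s₀ i‖
        + ((B + K * D) + K * E * Real.exp (β * s)) / (c + β - β) := by
      rcases hm i with hi | hi
      · refine (norm_le_of_unstable hμc hβ (by linarith) (fun s hs => ?_) hVi hb (by positivity)
          (by positivity) (fun s hs => (norm_le_pi_norm _ i).trans (hg s hs)) hs).trans
          (le_add_of_nonneg_left (norm_nonneg _))
        simpa using hi _ (hσ0 s)
      · refine norm_le_of_stable hμc hβ (by linarith) (fun s hs => ?_) hVi hb (by positivity)
          (by positivity) hs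
        simpa using hi _ (hσ0 s)
    refine hfin.trans ?_
    have hKc2 : K / c ≤ 1 / 2 := by rw [div_le_div_iff₀ hc two_pos]; linarith
    have e : ((B + K * D) + K * E * Real.exp (β * s)) / (c + β - β)
        = B / c + K / c * D + K / c * (E * Real.exp (β * s)) := by
      rw [add_sub_cancel_right]; ring
    have h0 : ‖V s₀ i‖ ≤ ‖V s₀‖ := norm_le_pi_norm _ i
    have h3 : K / c * D ≤ 1 / 2 * D := by gcongr
    have h4 : K / c * (E * Real.exp (β * s)) ≤ 1 / 2 * (E * Real.exp (β * s)) := by gcongr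
    rw [e]
    linarith
  -- In the limit of infinitely many passes the growing term disappears and `V` is bounded.
  have hiter : ∀ n : ℕ, ∀ s, s₀ ≤ s → ‖V s‖ ≤ D + E / 2 ^ n * Real.exp (β * s) := by
    intro n
    induction n with
    | zero =>
      intro s hs
      rw [hVn, pow_zero, div_one]
      calc _ ≤ Real.exp (m * s) * (E * Real.exp ((β - m) * s)) := by gcongr; exact hUA s hs
        _ = E * (Real.exp (m * s) * Real.exp ((β - m) * s)) := by ring
        _ = E * Real.exp (β * s) := by rw [← Real.exp_add]; congr 2; ring
        _ ≤ _ := le_add_of_nonneg_left hD0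
    | succ n ih =>
      rw [pow_succ, ← div_div]
      exact step _ (by positivity) ih
  refine ⟨D, fun s hs => ?_⟩
  have hlim : Tendsto (fun n : ℕ => D + E / 2 ^ n * Real.exp (β * s)) atTop (𝓝 D) := by
    have h1 : Tendsto (fun n : ℕ => E * (1 / 2 : ℝ) ^ n * Real.exp (β * s)) atTop (𝓝 0) := by
      simpa using ((tendsto_pow_atTop_nhds_zero_of_lt_one (by norm_num) (by norm_num :
        (1 / 2 : ℝ) < 1)).const_mul E).mul_const (Real.exp (β * s))
    have := h1.const_add D
    rw [add_zero] at this
    refine this.congr fun n => ?_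
    rw [one_div, inv_pow]
    rfl
  have := ge_of_tendsto' hlim fun n => hiter n s hs
  rw [hVn] at this
  calc ‖U s - A s‖ = Real.exp (m * s) * ‖U s - A s‖ * Real.exp (-(m * s)) := by
        rw [mul_right_comm, hexp, one_mul]
    _ ≤ _ := by gcongr

end Approximations


/-! ### From approximate solutions of all orders to one solution -/

theorem isLittleO_exp_neg {a b : ℝ} (h : a < b) :
    (fun s : ℝ => Real.exp (-(b * s))) =o[atTop] fun s : ℝ => Real.exp (-(a * s)) := by
  rw [Real.isLittleO_exp_comp_exp_comp]
  have : Tendsto (fun s : ℝ => (b - a) * s) atTop atTop :=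
    tendsto_id.const_mul_atTop (sub_pos.2 h)
  exact this.congr fun s => by ring

theorem isBigO_exp_neg {a b : ℝ} (h : a ≤ b) :
    (fun s : ℝ => Real.exp (-(b * s))) =O[atTop] fun s : ℝ => Real.exp (-(a * s)) := by
  rcases h.eq_or_lt with rfl | h
  exacts [isBigO_refl _ _, (isLittleO_exp_neg h).isBigO]

theorem IsLittleO.eventually_norm_le {E : Type} [NormedAddCommGroup E] {f : ℝ → E} {g : ℝ → ℝ}
    (h : f =o[atTop] fun s => Real.exp (g s)) : ∀ᶠ s in atTop, ‖f s‖ ≤ Real.exp (g s) := by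
  have := h.bound one_pos
  simpa using this

/-- A system with a diagonal linear part, whose real parts are bounded from below or tend to `-∞`,
has a solution with the asymptotic behaviour prescribed by a sequence of approximate solutions. -/
theorem exists_solution_of_approximations {ι : Type} [Fintype ι] {μ : ι → ℝ → ℂ} {s₀ K κ : ℝ}
    (hμ : ∀ i, ContinuousOn (μ i) (Set.Ici s₀))
    (hμ' : ∀ i, (∃ C, ∀ s, s₀ ≤ s → -C ≤ (μ i s).re) ∨
      Tendsto (fun s => (μ i s).re) atTop atBot)
    {H : ℝ → (ι → ℂ) → ι → ℂ}
    (hH : ContinuousOn (fun z : ℝ × (ι → ℂ) => H z.1 z.2) (Set.Ici s₀ ×ˢ Set.univ))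
    (hL : ∀ s, s₀ ≤ s → ∀ U V, ‖U‖ ≤ Real.exp (-(κ * s)) → ‖V‖ ≤ Real.exp (-(κ * s)) →
      ‖H s U - H s V‖ ≤ K * ‖U - V‖) {A R : ℕ → ℝ → ι → ℂ}
    (hA : ∀ m s, s₀ ≤ s → HasDerivAt (A m) (fun i => μ i s * A m s i + H s (A m s) i + R m s i) s)
    (hRc : ∀ m, ContinuousOn (R m) (Set.Ici s₀))
    (hR : ∀ m : ℕ, R m =O[atTop] fun s => Real.exp (-(m * s)))
    (hAs : ∀ m, ∀ᶠ s in atTop, ‖A m s‖ ≤ Real.exp (-(κ * s)) / 2)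
    (hAA : ∀ m m' : ℕ, m ≤ m' → (fun s => A m' s - A m s) =O[atTop] fun s => Real.exp (-(m * s))) :
    ∃ s₁, s₀ ≤ s₁ ∧ ∃ U : ℝ → ι → ℂ,
      (∀ s, s₁ < s → HasDerivAt U (fun i => μ i s * U s i + H s (U s) i) s) ∧
      (∀ s, s₁ ≤ s → ‖U s‖ ≤ Real.exp (-(κ * s))) ∧
      ∀ m : ℕ, (fun s => U s - A m s) =O[atTop] fun s => Real.exp (-(m * s)) := by
  wlog hK : 0 ≤ K generalizing K
  · exact this (K := |K|) (fun s hs U V hU hV => (hL s hs U V hU hV).trans (by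
      gcongr; exact le_abs_self K)) (abs_nonneg K)
  obtain ⟨C, hC⟩ : ∃ C : ℝ, ∀ i, (∀ s, s₀ ≤ s → -C ≤ (μ i s).re) ∨
      Tendsto (fun s => (μ i s).re) atTop atBot := by
    have : ∀ i, ∃ C, (∀ s, s₀ ≤ s → -C ≤ (μ i s).re) ∨
        Tendsto (fun s => (μ i s).re) atTop atBot := fun i => by
      rcases hμ' i with ⟨C, h⟩ | h
      exacts [⟨C, Or.inl h⟩, ⟨0, Or.inr h⟩]
    choose C hC using this
    refine ⟨∑ i, |C i|, fun i => (hC i).imp_left fun h s hs => (neg_le_neg ?_).trans (h s hs)⟩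
    exact (le_abs_self _).trans (Finset.single_le_sum (f := fun i => |C i|)
      (fun i _ => abs_nonneg _) (Finset.mem_univ i))
  -- Adding `m` makes every rate definite: one bounded below by `-C` becomes at least `c`, and one
  -- tending to `-∞` remains at most `-c` from some time on.
  have hev : ∀ m c : ℝ, c ≤ m - C → ∀ᶠ s₁ in atTop, ∀ i,
      (∀ s, s₁ ≤ s → c ≤ (μ i s).re + m) ∨ ∀ s, s₁ ≤ s → (μ i s).re + m ≤ -c := by
    intro m c hmc
    refine eventually_all.2 fun i => ?_
    rcases hC i with h | h
    · filter_upwards [eventually_ge_atTop s₀] with s₁ hs₁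
      exact Or.inl fun s hs => by linarith [h s (hs₁.trans hs)]
    · filter_upwards [eventually_forall_ge_atTop.2 (h.eventually_le_atBot (-c - m))] with s₁ hs₁
      exact Or.inr fun s hs => by linarith [hs₁ s hs]
  -- `K + 1 ≤ c` serves the fixed point, `2K ≤ c` the bootstrap.
  set c := 2 * K + 1 with hc
  -- `m₀ ≥ C + c` makes the rates definite, and `m₀ > κ` keeps perturbations of size `e^(-m₀ s)` in
  -- the region where `H` is Lipschitz. The approximation of index `m₀ + 1` is used so that its
  -- residual is `o(e^(-m₀ s))`, which absorbs the implied constant.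
  obtain ⟨m₀, hm₀⟩ := exists_nat_ge (max (C + c) (κ + 1))
  have hm₀C : C + c ≤ m₀ := (le_max_left _ _).trans hm₀
  have hm₀κ : κ < m₀ := by linarith [(le_max_right (C + c) (κ + 1)).trans hm₀]
  have hnat : ((m₀ + 1 : ℕ) : ℝ) = m₀ + 1 := by push_cast; rfl
  obtain ⟨s₁, hs₁⟩ := ((hev m₀ c (by linarith)).and ((eventually_ge_atTop s₀).and
    ((eventually_forall_ge_atTop.2 (IsLittleO.eventually_norm_le ((hR (m₀ + 1)).trans_isLittleO
      (isLittleO_exp_neg (a := m₀) (by rw [hnat]; linarith))))).and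
    ((eventually_forall_ge_atTop.2 (hAs (m₀ + 1))).and
    (eventually_forall_ge_atTop.2 ((isLittleO_exp_neg hm₀κ).bound (half_pos one_pos))))))).exists
  obtain ⟨hs₁m, hs₀₁, hs₁R, hs₁A, hs₁e⟩ := hs₁
  have hsub : Set.Ici s₁ ⊆ Set.Ici s₀ := Set.Ici_subset_Ici.2 hs₀₁
  have hAm : ∀ s, s₁ ≤ s → ‖A (m₀ + 1) s‖ + Real.exp (-(m₀ * s)) ≤ Real.exp (-(κ * s)) := by
    intro s hs
    have h1 := hs₁A s hs
    have h2 := hs₁e s hs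
    simp only [Real.norm_eq_abs, Real.abs_exp] at h2
    linarith
  obtain ⟨U, hU, hUA⟩ := exists_solution_near (fun i => (hμ i).mono hsub)
    (hH.mono (Set.prod_mono hsub subset_rfl)) hK (fun s hs => hL s (hs₀₁.trans hs))
    (fun s hs => hA (m₀ + 1) s (hs₀₁.trans hs)) ((hRc _).mono hsub) (c := c) (m := m₀)
    (by linarith) (by linarith) hs₁m hs₁R hAm
  have hUs : ∀ s, s₁ ≤ s → ‖U s‖ ≤ Real.exp (-(κ * s)) := fun s hs => by
    have h1 : ‖U s‖ ≤ ‖U s - A (m₀ + 1) s‖ + ‖A (m₀ + 1) s‖ := by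
      simpa using norm_add_le (U s - A (m₀ + 1) s) (A (m₀ + 1) s)
    linarith [hUA s hs, hAm s hs]
  have hUA' : (fun s => U s - A (m₀ + 1) s) =O[atTop] fun s => Real.exp (-(m₀ * s)) := by
    refine IsBigO.of_bound 1 ?_
    filter_upwards [eventually_ge_atTop s₁] with s hs
    simpa using hUA s hs
  refine ⟨s₁, hs₀₁, U, hU, hUs, fun m => ?_⟩
  -- Up to order `m₀` the approximations are compared directly. Beyond it, the known rate `m₀` falls
  -- short of `m` by `β = m - m₀`, and `isBigO_of_residual` removes this defect. The rates remain
  -- definite with the larger constant `c + β`, because `m₀ ≥ C + c`.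
  rcases le_or_gt m m₀ with hm | hm
  · have h1 := hAA m (m₀ + 1) (by omega)
    have h2 := hUA'.trans (isBigO_exp_neg (show (m : ℝ) ≤ m₀ by exact_mod_cast hm))
    exact (h2.add h1).congr_left fun s => by abel
  · have h1 : (fun s => U s - A m s) =O[atTop] fun s => Real.exp (-(m₀ * s)) := by
      have h2 := (hAA (m₀ + 1) m hm).trans (isBigO_exp_neg (a := m₀) (by rw [hnat]; linarith))
      exact (hUA'.sub h2).congr_left fun s => by abel
    obtain ⟨E, hE0, hE⟩ := h1.exists_nonneg
    obtain ⟨B, hB0, hB⟩ := (hR m).exists_nonneg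
    have hmm : (m₀ : ℝ) ≤ m := by exact_mod_cast hm.le
    obtain ⟨s₂, hs₂⟩ := ((hev m (c + (m - m₀)) (by linarith)).and ((eventually_gt_atTop s₁).and
      ((eventually_forall_ge_atTop.2 hE.bound).and ((eventually_forall_ge_atTop.2 hB.bound).and
      (eventually_forall_ge_atTop.2 (hAs m)))))).exists
    obtain ⟨hs₂m, hs₁₂, hs₂E, hs₂B, hs₂A⟩ := hs₂
    simp only [Real.norm_eq_abs, Real.abs_exp] at hs₂E hs₂B
    have h₀₂ := hs₀₁.trans hs₁₂.le
    obtain ⟨D, hD⟩ := isBigO_of_residual (fun i => (hμ i).mono (Set.Ici_subset_Ici.2 h₀₂)) hK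
      (fun s hs => hL s (h₀₂.trans hs)) (fun s hs => hA m s (h₀₂.trans hs))
      (fun s hs => hU s (hs₁₂.trans_le hs)) (c := c) (β := m - m₀) (by linarith) (by linarith)
      (by linarith) hB0 hE0 hs₂m hs₂B
      (fun s hs => (hs₂A s hs).trans (half_le_self (Real.exp_nonneg _)))
      (fun s hs => hUs s (hs₁₂.le.trans hs))
      (fun s hs => (hs₂E s hs).trans (le_of_eq (by congr 2; ring)))
    refine IsBigO.of_bound D ?_
    filter_upwards [eventually_ge_atTop s₂] with s hs
    simpa using hD s hs


/-! ### Planar systems with a saddle, a focus or a centre -/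

/-- The planar linear vector field `(t x + ς G y, G x + t y)`. -/
def planarLin (ς t G : ℝ) (z : ℝ × ℝ) : ℝ × ℝ := (t * z.1 + ς * G * z.2, G * z.1 + t * z.2)

/-- The complex coordinates `S z` diagonalize the linear part. They may range over a space larger
than the real plane, so `S'` is required only to be a left inverse. The system is solved there with
nonlinearity `S ∘ H ∘ S'`, and applying `S'` gives a solution of the real system. -/
theorem exists_solution_of_diagonalization {ι : Type} [Fintype ι] {μ : ι → ℝ → ℂ} {ς : ℝ}
    {t G : ℝ → ℝ} {s₀ K κ : ℝ}
    (S : ℝ × ℝ →L[ℝ] (ι → ℂ)) (S' : (ι → ℂ) →L[ℝ] ℝ × ℝ) (hS : ∀ z, S' (S z) = z)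
    (hSμ : ∀ s z, S (planarLin ς (t s) (G s) z) = fun i => μ i s * S z i)
    (hSμ' : ∀ s U, S' (fun i => μ i s * U i) = planarLin ς (t s) (G s) (S' U))
    (hS1 : ∀ U, ‖S' U‖ ≤ ‖U‖)
    (hμ : ∀ i, ContinuousOn (μ i) (Set.Ici s₀))
    (hμ' : ∀ i, (∃ C, ∀ s, s₀ ≤ s → -C ≤ (μ i s).re) ∨
      Tendsto (fun s => (μ i s).re) atTop atBot)
    {H : ℝ → ℝ × ℝ → ℝ × ℝ}
    (hH : ContinuousOn (fun z : ℝ × ℝ × ℝ => H z.1 z.2) (Set.Ici s₀ ×ˢ Set.univ))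
    (hL : ∀ s, s₀ ≤ s → ∀ U V, ‖U‖ ≤ Real.exp (-(κ * s)) → ‖V‖ ≤ Real.exp (-(κ * s)) →
      ‖H s U - H s V‖ ≤ K * ‖U - V‖) {A R : ℕ → ℝ → ℝ × ℝ}
    (hA : ∀ m s, s₀ ≤ s →
      HasDerivAt (A m) (planarLin ς (t s) (G s) (A m s) + H s (A m s) + R m s) s)
    (hRc : ∀ m, ContinuousOn (R m) (Set.Ici s₀))
    (hR : ∀ m : ℕ, R m =O[atTop] fun s => Real.exp (-(m * s)))
    (hAs : ∀ m, A m =O[atTop] fun s => Real.exp (-((κ + 1) * s)))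
    (hAA : ∀ m m' : ℕ, m ≤ m' → (fun s => A m' s - A m s) =O[atTop] fun s => Real.exp (-(m * s))) :
    ∃ s₁, s₀ ≤ s₁ ∧ ∃ Z : ℝ → ℝ × ℝ,
      (∀ s, s₁ < s → HasDerivAt Z (planarLin ς (t s) (G s) (Z s) + H s (Z s)) s) ∧
      ∀ m : ℕ, (fun s => Z s - A m s) =O[atTop] fun s => Real.exp (-(m * s)) := by
  wlog hK : 0 ≤ K generalizing K
  · exact this (K := |K|) (fun s hs U V hU hV => (hL s hs U V hU hV).trans (by
      gcongr; exact le_abs_self K)) (abs_nonneg K)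
  have hSO : ∀ (f : ℝ → ℝ × ℝ), (fun s => S (f s)) =O[atTop] f := fun f => S.isBigO_comp f atTop
  obtain ⟨s₁, hs₁, U, hU, -, hUA⟩ := exists_solution_of_approximations (K := ‖S‖ * K) (κ := κ) hμ hμ'
    (H := fun s U => S (H s (S' U))) (A := fun m s => S (A m s)) (R := fun m s => S (R m s))
    (S.continuous.comp_continuousOn (hH.comp
      (continuous_fst.prodMk (S'.continuous.comp continuous_snd)).continuousOn
      fun z hz => ⟨hz.1, Set.mem_univ _⟩))
    (fun s hs U V hU hV => by
      rw [← map_sub, mul_assoc]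
      refine (S.le_opNorm _).trans (mul_le_mul_of_nonneg_left ?_ (norm_nonneg _))
      refine (hL s hs _ _ ((hS1 U).trans hU) ((hS1 V).trans hV)).trans ?_
      rw [← map_sub]
      exact mul_le_mul_of_nonneg_left (hS1 _) hK)
    (fun m s hs => by
      have := S.hasFDerivAt.comp_hasDerivAt s (hA m s hs)
      convert! this using 1
      rw [map_add, map_add, hSμ, hS]
      rfl)
    (fun m => S.continuous.comp_continuousOn (hRc m))
    (fun m => (hSO _).trans (hR m))
    (fun m => by
      have := ((hSO _).trans (hAs m)).trans_isLittleO (isLittleO_exp_neg (lt_add_one κ))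
      filter_upwards [this.bound (half_pos one_pos)] with s hs
      simp only [Real.norm_eq_abs, Real.abs_exp] at hs
      linarith)
    (fun m m' h => by
      refine (IsBigO.trans ?_ (hAA m m' h))
      simpa only [map_sub] using hSO (fun s => A m' s - A m s))
  refine ⟨s₁, hs₁, fun s => S' (U s), fun s hs => ?_, fun m => ?_⟩
  · have := S'.hasFDerivAt.comp_hasDerivAt s (hU s hs)
    convert! this using 1
    have e : (fun i => μ i s * U s i + S (H s (S' (U s))) i)
      = (fun i => μ i s * U s i) + S (H s (S' (U s))) := rfl
    rw [e, map_add, hSμ', hS]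
  · refine IsBigO.trans ?_ (hUA m)
    refine (S'.isBigO_comp (fun s => U s - S (A m s)) atTop).congr_left fun s => ?_
    rw [map_sub, hS]

/-- The planar system `z' = planarLin ς t G z + H(s, z)` has a solution with the asymptotic behaviour
prescribed by a sequence of approximate solutions, both for a saddle (`ς = 1`) and for a focus or
centre (`ς = -1`). -/
theorem exists_planar_solution {ς : ℝ} {t G : ℝ → ℝ} {s₀ K κ : ℝ}
    (ht : ContinuousOn t (Set.Ici s₀)) (hG : ContinuousOn G (Set.Ici s₀))
    (hς : (ς = 1 ∧ Tendsto (fun s => t s + G s) atTop atTop ∧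
        Tendsto (fun s => t s - G s) atTop atBot) ∨
      (ς = -1 ∧ ((∃ C, ∀ s, s₀ ≤ s → -C ≤ t s) ∨ Tendsto t atTop atBot)))
    {H : ℝ → ℝ × ℝ → ℝ × ℝ}
    (hH : ContinuousOn (fun z : ℝ × ℝ × ℝ => H z.1 z.2) (Set.Ici s₀ ×ˢ Set.univ))
    (hL : ∀ s, s₀ ≤ s → ∀ U V, ‖U‖ ≤ Real.exp (-(κ * s)) → ‖V‖ ≤ Real.exp (-(κ * s)) →
      ‖H s U - H s V‖ ≤ K * ‖U - V‖) {A R : ℕ → ℝ → ℝ × ℝ}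
    (hA : ∀ m s, s₀ ≤ s →
      HasDerivAt (A m) (planarLin ς (t s) (G s) (A m s) + H s (A m s) + R m s) s)
    (hRc : ∀ m, ContinuousOn (R m) (Set.Ici s₀))
    (hR : ∀ m : ℕ, R m =O[atTop] fun s => Real.exp (-(m * s)))
    (hAs : ∀ m, A m =O[atTop] fun s => Real.exp (-((κ + 1) * s)))
    (hAA : ∀ m m' : ℕ, m ≤ m' → (fun s => A m' s - A m s) =O[atTop] fun s => Real.exp (-(m * s))) :
    ∃ s₁, s₀ ≤ s₁ ∧ ∃ Z : ℝ → ℝ × ℝ,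
      (∀ s, s₁ < s → HasDerivAt Z (planarLin ς (t s) (G s) (Z s) + H s (Z s)) s) ∧
      ∀ m : ℕ, (fun s => Z s - A m s) =O[atTop] fun s => Real.exp (-(m * s)) := by
  have hof : ∀ {f : ℝ → ℝ}, ContinuousOn f (Set.Ici s₀) →
      ContinuousOn (fun s => (f s : ℂ)) (Set.Ici s₀) := fun hf =>
    Complex.continuous_ofReal.comp_continuousOn hf
  -- For `ς = 1` the coordinates are `z₁ ± z₂`, with real rates `t ± G`; for `ς = -1` the single
  -- coordinate is `z₁ + i z₂`, with rate `t + iG`.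
  rcases hς with ⟨rfl, h1, h2⟩ | ⟨rfl, h⟩
  · obtain ⟨C, hC⟩ : ∃ C, ∀ s, s₀ ≤ s → -C ≤ t s + G s := by
      obtain ⟨s₂, hs₂⟩ := (eventually_atTop.1 (h1.eventually_ge_atTop 0))
      obtain ⟨C, hC⟩ := (isCompact_Icc (a := s₀) (b := s₂)).exists_bound_of_continuousOn
        ((ht.add hG).mono Set.Icc_subset_Ici_self)
      refine ⟨max C 0, fun s hs => ?_⟩
      rcases le_total s₂ s with h | h
      · exact (neg_nonpos.2 (le_max_right _ _)).trans (hs₂ s h)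
      · exact (neg_le_neg (le_max_left _ _)).trans (abs_le.1 (hC s ⟨hs, h⟩)).1
    let S : ℝ × ℝ →L[ℝ] (Fin 2 → ℂ) := ContinuousLinearMap.pi
      ![Complex.ofRealCLM.comp (ContinuousLinearMap.fst ℝ ℝ ℝ + ContinuousLinearMap.snd ℝ ℝ ℝ),
        Complex.ofRealCLM.comp (ContinuousLinearMap.fst ℝ ℝ ℝ - ContinuousLinearMap.snd ℝ ℝ ℝ)]
    let p : Fin 2 → (Fin 2 → ℂ) →L[ℝ] ℝ := fun i =>
      Complex.reCLM.comp (ContinuousLinearMap.proj (R := ℝ) (φ := fun _ : Fin 2 => ℂ) i)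
    let S' : (Fin 2 → ℂ) →L[ℝ] ℝ × ℝ :=
      (((1 / 2 : ℝ) • (p 0 + p 1))).prod ((1 / 2 : ℝ) • (p 0 - p 1))
    have eS : ∀ z, S z = ![((z.1 + z.2 : ℝ) : ℂ), ((z.1 - z.2 : ℝ) : ℂ)] := by
      intro z
      funext i
      fin_cases i <;> simp [S]
    have eS' : ∀ U, S' U = (1 / 2 * ((U 0).re + (U 1).re), 1 / 2 * ((U 0).re - (U 1).re)) := by
      intro U
      simp [S', p]
      ring
    refine exists_solution_of_diagonalization (ι := Fin 2)
      (μ := ![fun s => ((t s + G s : ℝ) : ℂ), fun s => ((t s - G s : ℝ) : ℂ)])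
      S S' (fun z => ?_) (fun s z => ?_) (fun s U => ?_) (fun U => ?_) (fun i => ?_) (fun i => ?_)
      hH hL hA hRc hR hAs hAA
    · rw [eS', eS]
      ext <;> simp <;> ring
    · rw [eS, eS]
      funext i
      fin_cases i <;> simp [planarLin] <;> ring
    · rw [eS', eS']
      ext <;> simp [planarLin] <;> ring
    · rw [eS', Prod.norm_def]
      have a0 := abs_le.1 ((Complex.abs_re_le_norm (U 0)).trans (norm_le_pi_norm U 0))
      have a1 := abs_le.1 ((Complex.abs_re_le_norm (U 1)).trans (norm_le_pi_norm U 1))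
      refine max_le (abs_le.2 ⟨?_, ?_⟩) (abs_le.2 ⟨?_, ?_⟩) <;> simp only <;> linarith
    · fin_cases i
      exacts [hof (ht.add hG), hof (ht.sub hG)]
    · fin_cases i
      · exact Or.inl ⟨C, by simpa using hC⟩
      · exact Or.inr (by simpa using h2)
  · let S : ℝ × ℝ →L[ℝ] (Unit → ℂ) := ContinuousLinearMap.pi fun _ =>
      Complex.equivRealProdCLM.symm
    let S' : (Unit → ℂ) →L[ℝ] ℝ × ℝ := (Complex.equivRealProdCLM : ℂ →L[ℝ] ℝ × ℝ).comp
      (ContinuousLinearMap.proj (R := ℝ) (φ := fun _ : Unit => ℂ) ())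
    have eS : ∀ z i, S z i = ⟨z.1, z.2⟩ := by
      intro z i
      simp [S, Complex.ext_iff]
    have eS' : ∀ U, S' U = ((U ()).re, (U ()).im) := by
      intro U
      simp [S']
    refine exists_solution_of_diagonalization (ι := Unit)
      (μ := fun _ s => ⟨t s, G s⟩)
      S S' (fun z => ?_) (fun s z => ?_) (fun s U => ?_) (fun U => ?_) (fun i => ?_) (fun i => h)
      hH hL hA hRc hR hAs hAA
    · rw [eS', eS]
    · funext i
      rw [eS, eS]
      apply Complex.ext <;> simp [planarLin] <;> ring
    · rw [eS', eS']
      ext <;> simp [planarLin] <;> ring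
    · rw [eS', Prod.norm_def]
      exact max_le ((Complex.abs_re_le_norm _).trans (norm_le_pi_norm U ()))
        ((Complex.abs_im_le_norm _).trans (norm_le_pi_norm U ()))
    · have e : (fun s => (⟨t s, G s⟩ : ℂ)) = fun s => (t s : ℂ) + (G s : ℂ) * Complex.I := by
        funext s
        apply Complex.ext <;> simp
      rw [e]
      exact (hof ht).add ((hof hG).mul continuousOn_const)


/-! ### Vanishing orders of smooth functions -/

section Taylor

variable {F : Type} [NormedAddCommGroup F] [NormedSpace ℝ F]

theorem eq_zero_of_pow_smul_isLittleO {n : ℕ} {a : F}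
    (h : (fun x : ℝ => x ^ n • a) =o[𝓝 0] fun x : ℝ => x ^ n) : a = 0 := by
  by_contra ha
  have h1 := h.bound (half_pos (norm_pos_iff.2 ha))
  obtain ⟨x, hx, hx0⟩ := ((h1.filter_mono nhdsWithin_le_nhds).and
    (self_mem_nhdsWithin : ∀ᶠ x in 𝓝[≠] (0 : ℝ), x ≠ 0)).exists
  have hp : 0 < ‖x ^ n‖ := norm_pos_iff.2 (pow_ne_zero _ hx0)
  rw [norm_smul, mul_comm] at hx
  have := le_of_mul_le_mul_right hx hp
  linarith [norm_pos_iff.2 ha]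

theorem isLittleO_pow_pow_zero {m n : ℕ} (h : m < n) :
    (fun x : ℝ => x ^ n) =o[𝓝 0] fun x : ℝ => x ^ m := isLittleO_pow_pow h

theorem exists_taylor_succ (f : ℝ → F) (n : ℕ) : ∃ a : F,
    (∀ x, taylorWithinEval f (n + 1) Set.univ 0 x
      = taylorWithinEval f n Set.univ 0 x + x ^ (n + 1) • a) := by
  refine ⟨((((n : ℝ) + 1) * n.factorial)⁻¹) • iteratedDerivWithin (n + 1) f Set.univ 0, fun x => ?_⟩
  rw [taylorWithinEval_succ, sub_zero, smul_smul, mul_comm]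

theorem isLittleO_taylor {f : ℝ → F} (hf : ContDiff ℝ ∞ f) (n : ℕ) :
    (fun x => f x - taylorWithinEval f n Set.univ 0 x) =o[𝓝 0] fun x : ℝ => x ^ n := by
  simpa using taylor_isLittleO_univ (x₀ := 0) (n := n) (hf.of_le (by exact_mod_cast le_top))

theorem taylor_eq_zero {f : ℝ → F} (hf : ContDiff ℝ ∞ f) {n : ℕ}
    (h : f =o[𝓝 0] fun x : ℝ => x ^ n) (x : ℝ) : taylorWithinEval f n Set.univ 0 x = 0 := by
  induction n generalizing x with
  | zero =>
    have h1 : Tendsto f (𝓝 0) (𝓝 0) := by simpa using h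
    rw [taylor_within_zero_eval]
    exact tendsto_nhds_unique (hf.continuous.tendsto 0) h1
  | succ n ih =>
    obtain ⟨a, ha⟩ := exists_taylor_succ f n
    have ih' := ih (h.trans (isLittleO_pow_pow_zero n.lt_succ_self))
    simp only [ih', zero_add] at ha
    have h2 := h.sub (isLittleO_taylor hf (n + 1))
    simp only [sub_sub_cancel, ha] at h2
    rw [ha, eq_zero_of_pow_smul_isLittleO h2, smul_zero]

/-- A smooth function has integer orders of vanishing: `o(x^n)` forces all Taylor coefficients up to
`x^n` to be zero. This is how a residual gains one full order. -/
theorem isBigO_succ_of_isLittleO {f : ℝ → F} (hf : ContDiff ℝ ∞ f) {n : ℕ}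
    (h : f =o[𝓝 0] fun x : ℝ => x ^ n) : f =O[𝓝 0] fun x : ℝ => x ^ (n + 1) := by
  obtain ⟨a, ha⟩ := exists_taylor_succ f n
  simp only [taylor_eq_zero hf h, zero_add] at ha
  have h1 := (isLittleO_taylor hf (n + 1)).isBigO
  simp only [ha] at h1
  have h2 : (fun x : ℝ => x ^ (n + 1) • a) =O[𝓝 0] fun x : ℝ => x ^ (n + 1) := by
    refine IsBigO.of_bound ‖a‖ (Eventually.of_forall fun x => ?_)
    rw [norm_smul, mul_comm]
  exact (h1.add h2).congr_left fun x => by abel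

theorem exists_leading_of_isBigO {f : ℝ → F} (hf : ContDiff ℝ ∞ f) {n : ℕ}
    (h : f =O[𝓝 0] fun x : ℝ => x ^ n) :
    ∃ a, (fun x => f x - x ^ n • a) =o[𝓝 0] fun x : ℝ => x ^ n := by
  rcases n with - | n
  · refine ⟨f 0, ?_⟩
    have := isLittleO_taylor hf 0
    simpa only [taylor_within_zero_eval, pow_zero, one_smul] using this
  · obtain ⟨a, ha⟩ := exists_taylor_succ f n
    simp only [taylor_eq_zero hf (h.trans_isLittleO (isLittleO_pow_pow_zero n.lt_succ_self)),
      zero_add] at ha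
    exact ⟨a, by simpa only [ha] using isLittleO_taylor hf (n + 1)⟩

/-- A function that is `O(x^n)` has a coefficient of `x^n`. If that coefficient is nonzero it gives
the leading term, and otherwise smoothness raises the order by one. -/
theorem isBigO_or_exists_leading {f : ℝ → F} (hf : ContDiff ℝ ∞ f) (n : ℕ) :
    (f =O[𝓝 0] fun x : ℝ => x ^ n) ∨
      ∃ j < n, ∃ a, a ≠ 0 ∧ (fun x => f x - x ^ j • a) =o[𝓝 0] fun x : ℝ => x ^ j := by
  induction n with
  | zero =>
    left
    simpa using (hf.continuous.tendsto 0).isBigO_one ℝ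
  | succ n ih =>
    rcases ih with h | ⟨j, hj, a, ha, h⟩
    · obtain ⟨a, ha⟩ := exists_leading_of_isBigO hf h
      by_cases h0 : a = 0
      · left
        refine isBigO_succ_of_isLittleO hf ?_
        simpa [h0] using ha
      · exact Or.inr ⟨n, n.lt_succ_self, a, h0, ha⟩
    · exact Or.inr ⟨j, hj.trans n.lt_succ_self, a, ha, h⟩

end Taylor

/-! ### Formal solutions of singular systems -/

/-- `x_0 + x_1 η + … + x_{m-1} η^(m-1)` -/
noncomputable def partialSum (c : ℕ → ℝ × ℝ) (m : ℕ) (η : ℝ) : ℝ × ℝ :=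
  ∑ K ∈ Finset.range m, η ^ K • c K

theorem contDiff_partialSum (c : ℕ → ℝ × ℝ) (m : ℕ) : ContDiff ℝ ∞ (partialSum c m) :=
  ContDiff.sum fun _ _ => (contDiff_id.pow _).smul contDiff_const

/-- The residual of `x(η)` in the system
`-η^(α+1) v' = κ η^α v + P(η, v, φ)`, `-η^(β+1) φ' = Q(η, v, φ)`, `x = (v, φ)`. -/
noncomputable def residual (P Q : ℝ × ℝ × ℝ → ℝ) (κ : ℝ) (α β : ℕ) (x : ℝ → ℝ × ℝ) (η : ℝ) : ℝ × ℝ :=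
  (P (η, x η) + η ^ α * (κ * (x η).1 + η * (deriv x η).1), Q (η, x η) + η ^ (β + 1) * (deriv x η).2)

theorem contDiff_residual {P Q : ℝ × ℝ × ℝ → ℝ} (hP : ContDiff ℝ ∞ P) (hQ : ContDiff ℝ ∞ Q) (κ : ℝ)
    (α β : ℕ) {x : ℝ → ℝ × ℝ} (hx : ContDiff ℝ ∞ x) : ContDiff ℝ ∞ (residual P Q κ α β x) := by
  have hx' : ContDiff ℝ ∞ (deriv x) := (contDiff_infty_iff_deriv.1 hx).2
  exact ((hP.comp (contDiff_id.prodMk hx)).add ((contDiff_id.pow _).mul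
    ((contDiff_const.mul hx.fst).add (contDiff_id.mul hx'.fst)))).prodMk
    ((hQ.comp (contDiff_id.prodMk hx)).add ((contDiff_id.pow _).mul hx'.snd))

/-- Strict differentiability at the limit point is used because the base point `(η, x η)` moves
together with the increment. -/
theorem isLittleO_strict {P : ℝ × ℝ × ℝ → ℝ} (hP : ContDiff ℝ ∞ P) {x : ℝ → ℝ × ℝ}
    (hx : Continuous x) {k : ℕ} (hk : 1 ≤ k) (d : ℝ × ℝ) :
    (fun η => P (η, x η + η ^ k • d) - P (η, x η) - η ^ k • fderiv ℝ P (0, x 0) (0, d))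
      =o[𝓝 0] fun η : ℝ => η ^ k := by
  have h1 : HasStrictFDerivAt P (fderiv ℝ P (0, x 0)) (0, x 0) :=
    hP.contDiffAt.hasStrictFDerivAt (by simp)
  have hc : Continuous fun η : ℝ => (((η, x η + η ^ k • d), (η, x η)) : (ℝ × ℝ × ℝ) × ℝ × ℝ × ℝ) :=
    (continuous_id.prodMk (hx.add ((continuous_id.pow k).smul continuous_const))).prodMk
      (continuous_id.prodMk hx)
  have ht : Tendsto (fun η : ℝ => (((η, x η + η ^ k • d), (η, x η)) : (ℝ × ℝ × ℝ) × ℝ × ℝ × ℝ)) (𝓝 0)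
      (𝓝 ((0, x 0), (0, x 0))) := by
    have := hc.tendsto 0
    simpa [zero_pow (by omega : k ≠ 0)] using this
  have h2 := h1.isLittleO.comp_tendsto ht
  have h3 : (fun η : ℝ => ((η, x η + η ^ k • d) : ℝ × ℝ × ℝ) - (η, x η)) =O[𝓝 0] fun η => η ^ k := by
    refine IsBigO.of_bound ‖d‖ (Eventually.of_forall fun η => ?_)
    have e : ((η, x η + η ^ k • d) : ℝ × ℝ × ℝ) - (η, x η) = (0, η ^ k • d) := by simp
    rw [e, Prod.norm_mk, norm_zero, max_eq_right (norm_nonneg _), norm_smul, mul_comm]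
  refine (h2.trans_isBigO h3).congr_left fun η => ?_
  have e : ((η, x η + η ^ k • d) : ℝ × ℝ × ℝ) - (η, x η) = η ^ k • ((0, d) : ℝ × ℝ × ℝ) := by simp
  simp only [Function.comp_apply, e, map_smul]

/-- At order `η^k` the correction `d` changes the residual by a triangular linear map. Its first
component is `lam d₂`, because `P_v` vanishes at the base point and the factor `η^α` with `α ≥ 1`
moves the remaining terms to higher order. Its second component is `w d₁ + (q + ε) d₂`. As `lam` and
`w` are nonzero, `d₂` and then `d₁` can be chosen to cancel the leading coefficient of the residual.
-/
theorem residual_step {P Q : ℝ × ℝ × ℝ → ℝ} (hP : ContDiff ℝ ∞ P) (hQ : ContDiff ℝ ∞ Q) {κ : ℝ}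
    {α β : ℕ} (hα : 1 ≤ α) {x : ℝ → ℝ × ℝ} (hx : ContDiff ℝ ∞ x)
    (hPv : fderiv ℝ P (0, x 0) (0, 1, 0) = 0) (hPφ : fderiv ℝ P (0, x 0) (0, 0, 1) ≠ 0)
    (hQv : fderiv ℝ Q (0, x 0) (0, 1, 0) ≠ 0) {k : ℕ} (hk : 1 ≤ k)
    (hres : residual P Q κ α β x =O[𝓝 0] fun η : ℝ => η ^ k) :
    ∃ d, residual P Q κ α β (fun η => x η + η ^ k • d) =O[𝓝 0] fun η : ℝ => η ^ (k + 1) := by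
  obtain ⟨e, he⟩ := exists_leading_of_isBigO (contDiff_residual hP hQ κ α β hx) hres
  set lam := fderiv ℝ P (0, x 0) (0, 0, 1)
  set w := fderiv ℝ Q (0, x 0) (0, 1, 0)
  set q := fderiv ℝ Q (0, x 0) (0, 0, 1)
  -- The term `η^(β+1) φ'` contributes `k d₂ η^(β+k)`, which is of order `η^k` only if `β = 0`.
  set ε : ℝ := if β = 0 then k else 0 with hε
  set d₂ := -e.1 / lam with hd₂
  set d₁ := -(e.2 + (q + ε) * d₂) / w with hd₁
  have hsm : ContDiff ℝ ∞ fun η => x η + η ^ k • ((d₁, d₂) : ℝ × ℝ) :=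
    hx.add ((contDiff_id.pow k).smul contDiff_const)
  refine ⟨(d₁, d₂), isBigO_succ_of_isLittleO (contDiff_residual hP hQ κ α β hsm) ?_⟩
  have h1 : e.1 + lam * d₂ = 0 := by rw [hd₂]; field_simp; ring
  have h2 : e.2 + w * d₁ + (q + ε) * d₂ = 0 := by rw [hd₁]; field_simp; ring
  clear_value d₁ d₂
  have hsplit : ∀ L : ℝ × ℝ × ℝ →L[ℝ] ℝ, L (0, d₁, d₂) = d₁ * L (0, 1, 0) + d₂ * L (0, 0, 1) := by
    intro L
    rw [← smul_eq_mul, ← smul_eq_mul, ← map_smul, ← map_smul, ← map_add]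
    simp
  have hP1 := isLittleO_strict hP hx.continuous hk (d₁, d₂)
  have hQ1 := isLittleO_strict hQ hx.continuous hk (d₁, d₂)
  have hder : ∀ η, deriv (fun η => x η + η ^ k • ((d₁, d₂) : ℝ × ℝ)) η
      = deriv x η + ((k : ℝ) * η ^ (k - 1)) • (d₁, d₂) := by
    intro η
    have h1 := ((hx.differentiable (by simp)) η).hasDerivAt
    exact (h1.add ((hasDerivAt_pow k η).smul_const (d₁, d₂))).deriv
  simp only [Prod.smul_mk, smul_eq_mul] at hder
  have hpow : ∀ η : ℝ, η * η ^ (k - 1) = η ^ k := fun η => by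
    rw [← pow_succ']; congr 1; omega
  have hα' : (fun η : ℝ => η ^ α * ((κ + k) * d₁ * η ^ k)) =o[𝓝 0] fun η : ℝ => η ^ k := by
    have : (fun η : ℝ => η ^ (k + α)) =o[𝓝 0] fun η : ℝ => η ^ k :=
      isLittleO_pow_pow_zero (by omega)
    refine (this.const_mul_left ((κ + k) * d₁)).congr_left fun η => by ring
  have hβ' : (fun η : ℝ => η ^ β * (k * d₂ * η ^ k) - η ^ k * (ε * d₂)) =o[𝓝 0]
      fun η : ℝ => η ^ k := by
    rcases Nat.eq_zero_or_pos β with rfl | hβ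
    · simp only [hε, if_true]
      refine (isLittleO_zero _ _).congr_left fun η => by ring
    · have : (fun η : ℝ => η ^ (k + β)) =o[𝓝 0] fun η : ℝ => η ^ k :=
        isLittleO_pow_pow_zero (by omega)
      refine (this.const_mul_left (k * d₂)).congr_left fun η => ?_
      rw [hε, if_neg hβ.ne']
      ring
  rw [isLittleO_prod_left] at he ⊢
  constructor
  · refine ((he.1.add hP1).add hα').congr_left fun η => ?_
    simp only [residual, hder, hsplit, hPv, Prod.fst_sub, Prod.fst_add, Prod.smul_fst, smul_eq_mul,
      Prod.smul_mk]
    linear_combination (-η ^ k) * h1 - η ^ α * k * d₁ * hpow η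
  · refine ((he.2.add hQ1).add hβ').congr_left fun η => ?_
    simp only [residual, hder, hsplit, Prod.snd_sub, Prod.snd_add, Prod.smul_snd, smul_eq_mul,
      Prod.smul_mk]
    linear_combination (-η ^ k) * h2 - η ^ β * k * d₂ * hpow η

/-- Dependent choice with coherent prefixes: the step at `k` changes only entry `k`, so each entry
becomes stationary, and the diagonal sequence inherits every property that depends on finitely many
entries. -/
theorem exists_seq_of_extension {X : Type} (Good : ℕ → (ℕ → X) → Prop)
    (hloc : ∀ k, 1 ≤ k → ∀ a b, (∀ i < k, a i = b i) → Good k a → Good k b)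
    (h1 : ∃ a, Good 1 a) (hstep : ∀ k, 1 ≤ k → ∀ a, Good k a → ∃ d, Good (k + 1) (Function.update a k d)) :
    ∃ c, ∀ k, 1 ≤ k → Good k c := by
  obtain ⟨a₀, ha₀⟩ := h1
  choose d hd using hstep
  let seq : ∀ k : ℕ, {a : ℕ → X // Good (k + 1) a} := fun k =>
    Nat.rec ⟨a₀, ha₀⟩ (fun k a => ⟨Function.update a.1 (k + 1) (d (k + 1) (by omega) a.1 a.2),
      hd (k + 1) (by omega) a.1 a.2⟩) k
  have hs : ∀ k i, i ≤ k → (seq (k + 1)).1 i = (seq k).1 i := fun k i hi =>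
    Function.update_of_ne (by omega) _ _
  have hs' : ∀ j k i, i ≤ k → (seq (k + j)).1 i = (seq k).1 i := by
    intro j k i hi
    induction j with
    | zero => rfl
    | succ j ih => rw [← add_assoc, hs _ _ (by omega), ih]
  refine ⟨fun i => (seq i).1 i, fun k hk => ?_⟩
  obtain ⟨k, rfl⟩ := Nat.exists_eq_add_of_le' hk
  refine hloc _ hk _ _ (fun i hi => ?_) (seq k).2
  obtain ⟨j, rfl⟩ := Nat.exists_eq_add_of_le (Nat.lt_succ_iff.1 hi)
  exact hs' j i i le_rfl

theorem exists_formal_solution {P Q : ℝ × ℝ × ℝ → ℝ} (hP : ContDiff ℝ ∞ P) (hQ : ContDiff ℝ ∞ Q)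
    (κ : ℝ) {α β : ℕ} (hα : 1 ≤ α) {x₀ : ℝ × ℝ} (hP0 : P (0, x₀) = 0) (hQ0 : Q (0, x₀) = 0)
    (hPv : fderiv ℝ P (0, x₀) (0, 1, 0) = 0) (hPφ : fderiv ℝ P (0, x₀) (0, 0, 1) ≠ 0)
    (hQv : fderiv ℝ Q (0, x₀) (0, 1, 0) ≠ 0) :
    ∃ c : ℕ → ℝ × ℝ, c 0 = x₀ ∧
      ∀ m, residual P Q κ α β (partialSum c m) =O[𝓝 0] fun η : ℝ => η ^ m := by
  have hS0 : ∀ (c : ℕ → ℝ × ℝ) k, 1 ≤ k → partialSum c k 0 = c 0 := by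
    intro c k hk
    rw [partialSum, Finset.sum_eq_single_of_mem 0 (Finset.mem_range.2 hk)]
    · simp
    · intro i _ hi
      simp [hi]
  obtain ⟨c, hc⟩ := exists_seq_of_extension (fun k c => c 0 = x₀ ∧
      residual P Q κ α β (partialSum c k) =O[𝓝 0] fun η : ℝ => η ^ k)
    (fun k hk a b hab h => by
      have e : partialSum b k = partialSum a k := by
        funext η
        exact Finset.sum_congr rfl fun i hi => by rw [hab i (Finset.mem_range.1 hi)]
      rw [e, ← hab 0 hk]
      exact h)
    (by
      refine ⟨fun _ => x₀, rfl, ?_⟩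
      have hsm := contDiff_residual hP hQ κ α β (contDiff_partialSum (fun _ => x₀) 1)
      refine isBigO_succ_of_isLittleO hsm (n := 0) ?_
      have e : residual P Q κ α β (partialSum (fun _ => x₀) 1) 0 = 0 := by
        simp [residual, hS0, hP0, hQ0, Nat.one_le_iff_ne_zero.1 hα]
      have := hsm.continuous.tendsto 0
      rw [e] at this
      simpa using this)
    (fun k hk a ha => by
      obtain ⟨d, hd⟩ := residual_step hP hQ hα (contDiff_partialSum a k) (by rwa [hS0 _ _ hk, ha.1])
        (by rwa [hS0 _ _ hk, ha.1]) (by rwa [hS0 _ _ hk, ha.1]) hk ha.2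
      refine ⟨d, by rw [Function.update_of_ne (by omega)]; exact ha.1, ?_⟩
      have e : partialSum (Function.update a k d) (k + 1) = fun η => partialSum a k η + η ^ k • d := by
        funext η
        rw [partialSum, Finset.sum_range_succ, Function.update_self]
        congr 1
        refine Finset.sum_congr rfl fun i hi => ?_
        rw [Function.update_of_ne (Finset.mem_range.1 hi).ne]
      rw [e]
      exact hd)
  refine ⟨c, (hc 1 le_rfl).1, fun m => ?_⟩
  rcases Nat.eq_zero_or_pos m with rfl | hm
  · simpa using ((contDiff_residual hP hQ κ α β (contDiff_partialSum c 0)).continuous.tendsto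
      0).isBigO_one ℝ
  · exact (hc m hm).2


/-! ### Reduction of the linearization to `planarLin` -/

/-- The change of variables `(e^(-δs) v - k(s) φ, ρ(s) φ)`. -/
noncomputable def shear (δ : ℝ) (k ρ : ℝ → ℝ) (s : ℝ) (z : ℝ × ℝ) : ℝ × ℝ :=
  (Real.exp (-(δ * s)) * z.1 - k s * z.2, ρ s * z.2)

/-- The derivative of `shear` with respect to `s`. -/
noncomputable def shearDeriv (δ : ℝ) (k' ρ' : ℝ → ℝ) (s : ℝ) (z : ℝ × ℝ) : ℝ × ℝ :=
  (-δ * Real.exp (-(δ * s)) * z.1 - k' s * z.2, ρ' s * z.2)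

/-- The inverse of `shear`. -/
noncomputable def shearInv (δ : ℝ) (k ρ : ℝ → ℝ) (s : ℝ) (U : ℝ × ℝ) : ℝ × ℝ :=
  (Real.exp (δ * s) * (U.1 + k s * (U.2 / ρ s)), U.2 / ρ s)

section Shear

variable {δ : ℝ} {k ρ k' ρ' : ℝ → ℝ} {s : ℝ}

theorem shear_shearInv (hρ : ρ s ≠ 0) (U : ℝ × ℝ) : shear δ k ρ s (shearInv δ k ρ s U) = U := by
  have e : Real.exp (-(δ * s)) * Real.exp (δ * s) = 1 := by
    rw [← Real.exp_add, neg_add_cancel, Real.exp_zero]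
  ext
  · simp only [shear, shearInv]
    linear_combination (U.1 + k s * (U.2 / ρ s)) * e
  · simp only [shear, shearInv]
    field_simp

theorem shearInv_shear (hρ : ρ s ≠ 0) (z : ℝ × ℝ) : shearInv δ k ρ s (shear δ k ρ s z) = z := by
  have e : Real.exp (δ * s) * Real.exp (-(δ * s)) = 1 := by
    rw [← Real.exp_add, add_neg_cancel, Real.exp_zero]
  have h2 : ρ s * z.2 / ρ s = z.2 := by field_simp
  ext
  · simp only [shear, shearInv, h2]
    linear_combination z.1 * e
  · simp only [shear, shearInv, h2]

theorem shear_sub (z w : ℝ × ℝ) : shear δ k ρ s (z - w) = shear δ k ρ s z - shear δ k ρ s w := by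
  ext <;> simp [shear] <;> ring

theorem shearInv_sub (z w : ℝ × ℝ) :
    shearInv δ k ρ s (z - w) = shearInv δ k ρ s z - shearInv δ k ρ s w := by
  ext <;> simp [shearInv] <;> ring

theorem shearDeriv_sub (z w : ℝ × ℝ) :
    shearDeriv δ k' ρ' s (z - w) = shearDeriv δ k' ρ' s z - shearDeriv δ k' ρ' s w := by
  ext <;> simp [shearDeriv] <;> ring

theorem planarLin_sub (ς t G : ℝ) (z w : ℝ × ℝ) :
    planarLin ς t G (z - w) = planarLin ς t G z - planarLin ς t G w := by
  ext <;> simp [planarLin] <;> ring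

theorem hasDerivAt_shear (hk : HasDerivAt k (k' s) s) (hρ : HasDerivAt ρ (ρ' s) s)
    {z : ℝ → ℝ × ℝ} {z' : ℝ × ℝ} (hz : HasDerivAt z z' s) :
    HasDerivAt (fun s => shear δ k ρ s (z s)) (shearDeriv δ k' ρ' s (z s) + shear δ k ρ s z') s := by
  have he : HasDerivAt (fun s => Real.exp (-(δ * s))) (-δ * Real.exp (-(δ * s))) s := by
    convert! ((hasDerivAt_id s).const_mul δ).fun_neg.exp using 1
    simp only [id]
    ring
  convert! ((he.fun_mul hz.fst).fun_sub (hk.fun_mul hz.snd)).prodMk (hρ.fun_mul hz.snd) using 1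
  ext <;> simp [shear, shearDeriv] <;> ring

theorem norm_shear_le {C : ℝ} (hδ : 0 ≤ δ) (hs : 0 ≤ s) (hk : |k s| ≤ C) (hρ : |ρ s| ≤ C)
    (z : ℝ × ℝ) : ‖shear δ k ρ s z‖ ≤ (1 + C) * ‖z‖ := by
  have h1 : |z.1| ≤ ‖z‖ := norm_fst_le z
  have h2 : |z.2| ≤ ‖z‖ := norm_snd_le z
  have he : Real.exp (-(δ * s)) ≤ 1 := Real.exp_le_one_iff.2 (neg_nonpos.2 (mul_nonneg hδ hs))
  have h3 : |Real.exp (-(δ * s)) * z.1| ≤ 1 * ‖z‖ := by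
    rw [abs_mul, Real.abs_exp]
    exact mul_le_mul he h1 (abs_nonneg _) zero_le_one
  have h4 : |k s * z.2| ≤ C * ‖z‖ := by
    rw [abs_mul]
    exact mul_le_mul hk h2 (abs_nonneg _) ((abs_nonneg _).trans hk)
  have h5 : |ρ s * z.2| ≤ C * ‖z‖ := by
    rw [abs_mul]
    exact mul_le_mul hρ h2 (abs_nonneg _) ((abs_nonneg _).trans hρ)
  refine max_le ((abs_sub _ _).trans ?_) (h5.trans ?_) <;> nlinarith [norm_nonneg z]

theorem norm_shearInv_le {C : ℝ} (hδ : 0 ≤ δ) (hs : 0 ≤ s) (hk : |k s| ≤ C) (hρ : 1 ≤ C * ρ s)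
    (hC : 0 < C) (U : ℝ × ℝ) :
    ‖shearInv δ k ρ s U‖ ≤ (1 + C + C * C) * Real.exp (δ * s) * ‖U‖ := by
  have hρ0 : 0 < ρ s := by
    by_contra! h
    nlinarith
  have h1 : |U.1| ≤ ‖U‖ := norm_fst_le U
  have h2 : |U.2| ≤ ‖U‖ := norm_snd_le U
  have he : 1 ≤ Real.exp (δ * s) := Real.one_le_exp (mul_nonneg hδ hs)
  have h3 : |U.2 / ρ s| ≤ C * ‖U‖ := by
    rw [abs_div, abs_of_pos hρ0, div_le_iff₀ hρ0]
    nlinarith [norm_nonneg U]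
  have h4 : |k s * (U.2 / ρ s)| ≤ C * (C * ‖U‖) := by
    rw [abs_mul]
    exact mul_le_mul hk h3 (abs_nonneg _) hC.le
  have h5 : |U.1 + k s * (U.2 / ρ s)| ≤ (1 + C + C * C) * ‖U‖ := by
    refine (abs_add_le _ _).trans ?_
    nlinarith [norm_nonneg U]
  refine max_le ?_ ?_
  · change |Real.exp (δ * s) * (U.1 + k s * (U.2 / ρ s))| ≤ _
    rw [abs_mul, Real.abs_exp]
    calc _ ≤ Real.exp (δ * s) * ((1 + C + C * C) * ‖U‖) := by gcongr
      _ = _ := by ring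
  · refine h3.trans ?_
    have : C * ‖U‖ ≤ (1 + C + C * C) * ‖U‖ := by gcongr; nlinarith
    refine this.trans ?_
    gcongr
    exact le_mul_of_one_le_right (by positivity) he

end Shear

/-- A planar system whose linearization along an approximate solution `X 0` is brought to the form
`planarLin ς t G` by the change of variables `shear`, up to bounded terms, has a solution with the
asymptotic behaviour prescribed by the approximate solutions `X m`. -/
theorem exists_solution_of_normalForm {F : ℝ → ℝ × ℝ → ℝ × ℝ} {δ s₀ C K κ ς : ℝ}
    {k ρ k' ρ' t G : ℝ → ℝ} {J : ℝ → ℝ × ℝ → ℝ × ℝ} {X X' : ℕ → ℝ → ℝ × ℝ}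
    (hF : Continuous fun z : ℝ × ℝ × ℝ => F z.1 z.2) (hδ : 0 ≤ δ) (hs₀ : 0 ≤ s₀) (hC : 0 < C)
    (hk : ∀ s, s₀ ≤ s → HasDerivAt k (k' s) s) (hρ : ∀ s, s₀ ≤ s → HasDerivAt ρ (ρ' s) s)
    (hk' : ContinuousOn k' (Set.Ici s₀)) (hρ' : ContinuousOn ρ' (Set.Ici s₀))
    (hkC : ∀ s, s₀ ≤ s → |k s| ≤ C) (hρC : ∀ s, s₀ ≤ s → |ρ s| ≤ C)
    (hk'C : ∀ s, s₀ ≤ s → |k' s| ≤ C) (hρ'C : ∀ s, s₀ ≤ s → |ρ' s| ≤ C)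
    (hρ1 : ∀ s, s₀ ≤ s → 1 ≤ C * ρ s)
    (ht : ContinuousOn t (Set.Ici s₀)) (hG : ContinuousOn G (Set.Ici s₀))
    (hς : (ς = 1 ∧ Tendsto (fun s => t s + G s) atTop atTop ∧
        Tendsto (fun s => t s - G s) atTop atBot) ∨
      (ς = -1 ∧ ((∃ C, ∀ s, s₀ ≤ s → -C ≤ t s) ∨ Tendsto t atTop atBot)))
    (hJ : ∀ s, s₀ ≤ s → ∀ z, shearDeriv δ k' ρ' s z + shear δ k ρ s (J s z)
      = planarLin ς (t s) (G s) (shear δ k ρ s z) + (-k' s * z.2, ρ' s * z.2))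
    (hN : ∀ s, s₀ ≤ s → ∀ z w,
      ‖z‖ ≤ (1 + C + C * C) * Real.exp (δ * s) * Real.exp (-(κ * s)) →
      ‖w‖ ≤ (1 + C + C * C) * Real.exp (δ * s) * Real.exp (-(κ * s)) →
      ‖F s (X 0 s + z) - F s (X 0 s + w) - J s (z - w)‖ ≤ K * Real.exp (-(δ * s)) * ‖z - w‖)
    (hX : ∀ m s, s₀ ≤ s → HasDerivAt (X m) (X' m s) s)
    (hX' : ∀ m, ContinuousOn (X' m) (Set.Ici s₀))
    (hres : ∀ m : ℕ, (fun s => X' m s - F s (X m s)) =O[atTop] fun s => Real.exp (-(m * s)))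
    (hX0 : ∀ m, (fun s => X m s - X 0 s) =O[atTop] fun s => Real.exp (-((κ + 1) * s)))
    (hXX : ∀ m m' : ℕ, m ≤ m' → (fun s => X m' s - X m s) =O[atTop] fun s => Real.exp (-(m * s))) :
    ∃ s₁, s₀ ≤ s₁ ∧ ∃ x : ℝ → ℝ × ℝ, (∀ s, s₁ < s → HasDerivAt x (F s (x s)) s) ∧
      ∀ m : ℕ, (fun s => x s - X m s) =O[atTop] fun s => Real.exp (-((m - δ) * s)) := by
  wlog hK : 0 ≤ K generalizing K
  · exact this (K := |K|) (fun s hs U V hU hV => (hN s hs U V hU hV).trans (by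
      gcongr; exact le_abs_self K)) (abs_nonneg K)
  have hρpos : ∀ s, s₀ ≤ s → 0 < ρ s := fun s hs => by
    by_contra! h
    nlinarith [hρ1 s hs]
  have hρ0 : ∀ s, s₀ ≤ s → ρ s ≠ 0 := fun s hs => (hρpos s hs).ne'
  have hkc : ContinuousOn k (Set.Ici s₀) := fun s hs => (hk s hs).continuousAt.continuousWithinAt
  have hρc : ContinuousOn ρ (Set.Ici s₀) := fun s hs => (hρ s hs).continuousAt.continuousWithinAt
  have hXc : ∀ m, ContinuousOn (X m) (Set.Ici s₀) := fun m s hs =>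
    (hX m s hs).continuousAt.continuousWithinAt
  set r := 1 + C + C * C with hr
  have hr0 : 0 < r := by positivity
  -- What remains of the equation for `U = shear (x - X 0)` after its linear normal form is removed.
  -- It is Lipschitz with a constant independent of `s`: the terms with `k'` and `ρ'` are bounded,
  -- and the factor `e^(-δs)` in the nonlinear remainder compensates the growth `e^(δs)` of
  -- `shearInv`.
  set H : ℝ → ℝ × ℝ → ℝ × ℝ := fun s U => shearDeriv δ k' ρ' s (shearInv δ k ρ s U)
    + shear δ k ρ s (F s (X 0 s + shearInv δ k ρ s U) - X' 0 s) - planarLin ς (t s) (G s) U with hH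
  have hTO : ∀ f : ℝ → ℝ × ℝ, (fun s => shear δ k ρ s (f s)) =O[atTop] f := fun f => by
    refine IsBigO.of_bound (1 + C) ?_
    filter_upwards [eventually_ge_atTop s₀] with s hs
    exact norm_shear_le hδ (hs₀.trans hs) (hkC s hs) (hρC s hs) _
  have hinv : ∀ m s, s₀ ≤ s → shearInv δ k ρ s (shear δ k ρ s (X m s - X 0 s)) = X m s - X 0 s :=
    fun m s hs => shearInv_shear (hρ0 s hs) _
  have hfst : ∀ {f : ℝ → ℝ}, ContinuousOn f (Set.Ici s₀) →
      ContinuousOn (fun z : ℝ × ℝ × ℝ => f z.1) (Set.Ici s₀ ×ˢ Set.univ) := fun hf =>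
    hf.comp continuousOn_fst fun z hz => hz.1
  have hexpc : ∀ c : ℝ, ContinuousOn (fun z : ℝ × ℝ × ℝ => Real.exp (c * z.1))
      (Set.Ici s₀ ×ˢ Set.univ) := fun c => by fun_prop
  have hexpc' : ContinuousOn (fun z : ℝ × ℝ × ℝ => Real.exp (-(δ * z.1)))
      (Set.Ici s₀ ×ˢ Set.univ) := by fun_prop
  obtain ⟨s₁, hs₁, Z, hZ, hZA⟩ := exists_planar_solution (ς := ς) (t := t) (G := G) (s₀ := s₀)
    (K := C * C + C * C + (1 + C) * K * r) (κ := κ) ht hG hς (H := H)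
    (A := fun m s => shear δ k ρ s (X m s - X 0 s))
    (R := fun m s => shear δ k ρ s (X' m s - F s (X m s)))
    (by
      have hInv : ContinuousOn (fun z : ℝ × ℝ × ℝ => shearInv δ k ρ z.1 z.2)
          (Set.Ici s₀ ×ˢ Set.univ) := by
        have hd : ContinuousOn (fun z : ℝ × ℝ × ℝ => z.2.2 / ρ z.1) (Set.Ici s₀ ×ˢ Set.univ) :=
          (continuous_snd.snd.continuousOn).div (hfst hρc) fun z hz => hρ0 _ hz.1
        exact ((hexpc δ).mul (continuous_snd.fst.continuousOn.add ((hfst hkc).mul hd))).prodMk hd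
      have hT : ∀ {f : ℝ × ℝ × ℝ → ℝ × ℝ}, ContinuousOn f (Set.Ici s₀ ×ˢ Set.univ) →
          ContinuousOn (fun z : ℝ × ℝ × ℝ => shear δ k ρ z.1 (f z)) (Set.Ici s₀ ×ˢ Set.univ) :=
        fun hf => ((hexpc'.mul hf.fst).sub ((hfst hkc).mul hf.snd)).prodMk ((hfst hρc).mul hf.snd)
      have h1 : ContinuousOn (fun z : ℝ × ℝ × ℝ => shearDeriv δ k' ρ' z.1 (shearInv δ k ρ z.1 z.2))
          (Set.Ici s₀ ×ˢ Set.univ) :=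
        (((continuousOn_const.mul hexpc').mul hInv.fst).sub ((hfst hk').mul hInv.snd)).prodMk
          ((hfst hρ').mul hInv.snd)
      have hX0c : ContinuousOn (fun z : ℝ × ℝ × ℝ => X 0 z.1) (Set.Ici s₀ ×ˢ Set.univ) :=
        (hXc 0).comp continuousOn_fst fun z hz => hz.1
      have hX0c' : ContinuousOn (fun z : ℝ × ℝ × ℝ => X' 0 z.1) (Set.Ici s₀ ×ˢ Set.univ) :=
        (hX' 0).comp continuousOn_fst fun z hz => hz.1
      have h2 := hT ((hF.comp_continuousOn (continuousOn_fst.prodMk (hX0c.add hInv))).sub hX0c')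
      have h3 : ContinuousOn (fun z : ℝ × ℝ × ℝ => planarLin ς (t z.1) (G z.1) z.2)
          (Set.Ici s₀ ×ˢ Set.univ) :=
        (((hfst ht).mul continuous_snd.fst.continuousOn).add ((continuousOn_const.mul (hfst hG)).mul
          continuous_snd.snd.continuousOn)).prodMk
          (((hfst hG).mul continuous_snd.fst.continuousOn).add ((hfst ht).mul
          continuous_snd.snd.continuousOn))
      exact (h1.add h2).sub h3)
    (by
      intro s hs U V hU hV
      have h0 := hs₀.trans hs
      set z := shearInv δ k ρ s U with hz
      set w := shearInv δ k ρ s V with hw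
      have hzw : z - w = shearInv δ k ρ s (U - V) := (shearInv_sub U V).symm
      have hUV : U - V = shear δ k ρ s (z - w) := by rw [hzw, shear_shearInv (hρ0 s hs)]
      have e : H s U - H s V = (-k' s * (z - w).2, ρ' s * (z - w).2)
          + shear δ k ρ s (F s (X 0 s + z) - F s (X 0 s + w) - J s (z - w)) := by
        have h1 := hJ s hs (z - w)
        rw [← hUV, planarLin_sub, shearDeriv_sub] at h1
        simp only [hH, ← hz, ← hw, shear_sub]
        rw [eq_sub_of_add_eq' h1]
        abel
      have hbz : ∀ W : ℝ × ℝ, ‖W‖ ≤ Real.exp (-(κ * s)) →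
          ‖shearInv δ k ρ s W‖ ≤ r * Real.exp (δ * s) * Real.exp (-(κ * s)) := fun W hW =>
        (norm_shearInv_le hδ h0 (hkC s hs) (hρ1 s hs) hC W).trans (by gcongr)
      have h2 : |(z - w).2| ≤ C * ‖U - V‖ := by
        rw [hzw]
        change |(U - V).2 / ρ s| ≤ _
        have : |(U - V).2| ≤ ‖U - V‖ := norm_snd_le (U - V)
        rw [abs_div, abs_of_pos (hρpos s hs), div_le_iff₀ (hρpos s hs)]
        nlinarith [norm_nonneg (U - V), hρ1 s hs]
      have h3 : ‖((-k' s * (z - w).2, ρ' s * (z - w).2) : ℝ × ℝ)‖ ≤ C * C * ‖U - V‖ := by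
        have aux : ∀ c : ℝ, |c| ≤ C → |c * (z - w).2| ≤ C * C * ‖U - V‖ := fun c hc => by
          rw [abs_mul, mul_assoc]
          exact mul_le_mul hc h2 (abs_nonneg _) hC.le
        exact max_le (aux _ (by rw [abs_neg]; exact hk'C s hs)) (aux _ (hρ'C s hs))
      have h4 := norm_shear_le hδ h0 (hkC s hs) (hρC s hs)
        (F s (X 0 s + z) - F s (X 0 s + w) - J s (z - w))
      have h5 := hN s hs z w (hbz U hU) (hbz V hV)
      have h6 : ‖z - w‖ ≤ r * Real.exp (δ * s) * ‖U - V‖ := by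
        rw [hzw]; exact norm_shearInv_le hδ h0 (hkC s hs) (hρ1 s hs) hC _
      have e1 : Real.exp (-(δ * s)) * Real.exp (δ * s) = 1 := by
        rw [← Real.exp_add, neg_add_cancel, Real.exp_zero]
      have h7 : K * Real.exp (-(δ * s)) * ‖z - w‖ ≤ K * r * ‖U - V‖ := by
        calc _ ≤ K * Real.exp (-(δ * s)) * (r * Real.exp (δ * s) * ‖U - V‖) := by gcongr
          _ = K * r * ‖U - V‖ * (Real.exp (-(δ * s)) * Real.exp (δ * s)) := by ring
          _ = _ := by rw [e1, mul_one]
      rw [e]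
      refine (norm_add_le _ _).trans ?_
      have h8 : (1 + C) * ‖F s (X 0 s + z) - F s (X 0 s + w) - J s (z - w)‖
        ≤ (1 + C) * (K * r * ‖U - V‖) := by gcongr; exact h5.trans h7
      nlinarith [mul_nonneg (mul_pos hC hC).le (norm_nonneg (U - V))])
    (fun m s hs => by
      have h1 := hasDerivAt_shear (δ := δ) (hk s hs) (hρ s hs) ((hX m s hs).sub (hX 0 s hs))
      convert! h1 using 1
      simp only [hH, hinv m s hs, Pi.sub_apply, add_sub_cancel]
      rw [shear_sub (F s (X m s)), shear_sub (X' m s) (F s (X m s)), shear_sub (X' m s) (X' 0 s)]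
      abel)
    (fun m => by
      have h1 : ContinuousOn (fun s => X' m s - F s (X m s)) (Set.Ici s₀) :=
        (hX' m).sub (hF.comp_continuousOn (continuousOn_id.prodMk (hXc m)))
      have h2 : ContinuousOn (fun s => Real.exp (-(δ * s))) (Set.Ici s₀) := by fun_prop
      exact ((h2.mul h1.fst).sub (hkc.mul h1.snd)).prodMk (hρc.mul h1.snd))
    (fun m => (hTO _).trans (hres m))
    (fun m => (hTO _).trans (hX0 m))
    (fun m m' h => by
      refine ((hTO (fun s => X m' s - X m s)).trans (hXX m m' h)).congr_left fun s => ?_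
      rw [← shear_sub, sub_sub_sub_cancel_right])
  refine ⟨s₁, hs₁, fun s => X 0 s + shearInv δ k ρ s (Z s), fun s hs => ?_, fun m => ?_⟩
  · have hs' : s₀ ≤ s := hs₁.trans hs.le
    have hρn := hρ0 s hs'
    have hZs := hZ s hs
    have hZ1 : HasDerivAt (fun s => (Z s).1) _ s := hZs.fst
    have hZ2 : HasDerivAt (fun s => (Z s).2) _ s := hZs.snd
    have hy : HasDerivAt (fun s => (Z s).2 / ρ s) _ s := hZ2.fun_div (hρ s hs') hρn
    have he : HasDerivAt (fun s => Real.exp (δ * s)) _ s := ((hasDerivAt_id s).const_mul δ).exp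
    -- Only the existence of a derivative is needed; its value follows below by differentiating the
    -- identity `shear (shearInv Z) = Z`.
    have hD : ∃ d, HasDerivAt (fun s => shearInv δ k ρ s (Z s)) d s :=
      ⟨_, (he.fun_mul (hZ1.fun_add ((hk s hs').fun_mul hy))).prodMk hy⟩
    obtain ⟨d, hd⟩ := hD
    have h1 := hasDerivAt_shear (δ := δ) (hk s hs') (hρ s hs') hd
    have h2 : HasDerivAt (fun s => shear δ k ρ s (shearInv δ k ρ s (Z s)))
        (planarLin ς (t s) (G s) (Z s) + H s (Z s)) s := by
      refine hZs.congr_of_eventuallyEq ?_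
      filter_upwards [eventually_gt_nhds hs] with u hu
      exact shear_shearInv (hρ0 u (hs₁.trans hu.le)) _
    have h3 := h1.unique h2
    simp only [hH] at h3
    have h4 : shear δ k ρ s d
        = shear δ k ρ s (F s (X 0 s + shearInv δ k ρ s (Z s)) - X' 0 s) := by
      rw [add_comm, ← eq_sub_iff_add_eq] at h3
      rw [h3]
      abel
    have h5 : d = F s (X 0 s + shearInv δ k ρ s (Z s)) - X' 0 s := by
      rw [← shearInv_shear (δ := δ) (k := k) hρn d, h4, shearInv_shear hρn]
    convert! (hX 0 s hs').add hd using 1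
    rw [h5]
    abel
  -- Undoing the shear costs a factor `e^(δs)`, hence the exponent `m - δ`.
  · have h1 : (fun s => X 0 s + shearInv δ k ρ s (Z s) - X m s) =O[atTop]
        fun s => Real.exp (δ * s) * ‖Z s - shear δ k ρ s (X m s - X 0 s)‖ := by
      refine IsBigO.of_bound r ?_
      filter_upwards [eventually_ge_atTop s₀] with s hs
      have e : X 0 s + shearInv δ k ρ s (Z s) - X m s
          = shearInv δ k ρ s (Z s - shear δ k ρ s (X m s - X 0 s)) := by
        rw [shearInv_sub, hinv m s hs]
        abel
      rw [e, norm_mul, Real.norm_of_nonneg (Real.exp_nonneg _), norm_norm, ← mul_assoc]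
      exact norm_shearInv_le hδ (hs₀.trans hs) (hkC s hs) (hρ1 s hs) hC _
    refine h1.trans (((isBigO_refl (fun s => Real.exp (δ * s)) atTop).mul (hZA m).norm_left).congr_right
      fun s => ?_)
    rw [← Real.exp_add]
    congr 1
    ring


/-! ### Bounded functions with continuous bounded derivative -/

/-- `f` and its derivative are continuous and bounded on `[s₀, ∞)`. -/
structure Tame (s₀ : ℝ) (f : ℝ → ℝ) : Prop where
  diff : ∀ s, s₀ ≤ s → DifferentiableAt ℝ f s
  cont_deriv : ContinuousOn (deriv f) (Set.Ici s₀)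
  bound : ∃ C, ∀ s, s₀ ≤ s → |f s| ≤ C
  bound_deriv : ∃ C, ∀ s, s₀ ≤ s → |deriv f s| ≤ C

namespace Tame

variable {s₀ : ℝ} {f g : ℝ → ℝ}

theorem continuousOn (hf : Tame s₀ f) : ContinuousOn f (Set.Ici s₀) := fun s hs =>
  (hf.diff s hs).continuousAt.continuousWithinAt

theorem mono (hf : Tame s₀ f) {s₁ : ℝ} (h : s₀ ≤ s₁) : Tame s₁ f where
  diff s hs := hf.diff s (h.trans hs)
  cont_deriv := hf.cont_deriv.mono (Set.Ici_subset_Ici.2 h)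
  bound := hf.bound.imp fun _ hC s hs => hC s (h.trans hs)
  bound_deriv := hf.bound_deriv.imp fun _ hC s hs => hC s (h.trans hs)

theorem const (c : ℝ) : Tame s₀ fun _ => c where
  diff _ _ := differentiableAt_const c
  cont_deriv := by simpa using continuousOn_const
  bound := ⟨|c|, fun _ _ => le_rfl⟩
  bound_deriv := ⟨0, by simp⟩

theorem add (hf : Tame s₀ f) (hg : Tame s₀ g) : Tame s₀ fun s => f s + g s where
  diff s hs := (hf.diff s hs).fun_add (hg.diff s hs)
  cont_deriv := (hf.cont_deriv.add hg.cont_deriv).congr fun s hs =>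
    deriv_fun_add (hf.diff s hs) (hg.diff s hs)
  bound := by
    obtain ⟨C, hC⟩ := hf.bound
    obtain ⟨C', hC'⟩ := hg.bound
    exact ⟨C + C', fun s hs => (abs_add_le _ _).trans (add_le_add (hC s hs) (hC' s hs))⟩
  bound_deriv := by
    obtain ⟨C, hC⟩ := hf.bound_deriv
    obtain ⟨C', hC'⟩ := hg.bound_deriv
    refine ⟨C + C', fun s hs => ?_⟩
    rw [deriv_fun_add (hf.diff s hs) (hg.diff s hs)]
    exact (abs_add_le _ _).trans (add_le_add (hC s hs) (hC' s hs))

theorem mul (hf : Tame s₀ f) (hg : Tame s₀ g) : Tame s₀ fun s => f s * g s := by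
  have hd : ∀ s, s₀ ≤ s → deriv (fun s => f s * g s) s = deriv f s * g s + f s * deriv g s :=
    fun s hs => deriv_fun_mul (hf.diff s hs) (hg.diff s hs)
  obtain ⟨A, hA⟩ := hf.bound
  obtain ⟨A', hA'⟩ := hf.bound_deriv
  obtain ⟨B, hB⟩ := hg.bound
  obtain ⟨B', hB'⟩ := hg.bound_deriv
  have hm : ∀ {x y X Y : ℝ}, |x| ≤ X → |y| ≤ Y → |x * y| ≤ X * Y := fun hx hy => by
    rw [abs_mul]
    exact mul_le_mul hx hy (abs_nonneg _) ((abs_nonneg _).trans hx)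
  refine ⟨fun s hs => (hf.diff s hs).fun_mul (hg.diff s hs),
    ((hf.cont_deriv.mul hg.continuousOn).add (hf.continuousOn.mul hg.cont_deriv)).congr hd,
    ⟨A * B, fun s hs => hm (hA s hs) (hB s hs)⟩, ⟨A' * B + A * B', fun s hs => ?_⟩⟩
  rw [hd s hs]
  exact (abs_add_le _ _).trans (add_le_add (hm (hA' s hs) (hB s hs)) (hm (hA s hs) (hB' s hs)))

theorem comp (hf : Tame s₀ f) {c : ℝ} {F F' : ℝ → ℝ} (hF : ∀ x, c ≤ x → HasDerivAt F (F' x) x)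
    (hF' : ContinuousOn F' (Set.Ici c)) (hc : ∀ s, s₀ ≤ s → c ≤ f s) : Tame s₀ fun s => F (f s) := by
  have hd : ∀ s, s₀ ≤ s → HasDerivAt (fun s => F (f s)) (F' (f s) * deriv f s) s := fun s hs =>
    (hF (f s) (hc s hs)).comp s (hf.diff s hs).hasDerivAt
  obtain ⟨A, hA⟩ := hf.bound
  obtain ⟨A', hA'⟩ := hf.bound_deriv
  have hmem : ∀ s, s₀ ≤ s → f s ∈ Set.Icc c A := fun s hs => ⟨hc s hs, (le_abs_self _).trans (hA s hs)⟩
  obtain ⟨B, hB⟩ := (isCompact_Icc (a := c) (b := A)).exists_bound_of_continuousOn (f := F)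
    fun x hx => (hF x hx.1).continuousAt.continuousWithinAt
  obtain ⟨B', hB'⟩ := (isCompact_Icc (a := c) (b := A)).exists_bound_of_continuousOn (f := F')
    (hF'.mono Set.Icc_subset_Ici_self)
  refine ⟨fun s hs => (hd s hs).differentiableAt,
    ((hF'.comp hf.continuousOn hc).mul hf.cont_deriv).congr fun s hs => (hd s hs).deriv,
    ⟨B, fun s hs => hB _ (hmem s hs)⟩, ⟨B' * A', fun s hs => ?_⟩⟩
  rw [(hd s hs).deriv, abs_mul]
  exact mul_le_mul (hB' _ (hmem s hs)) (hA' s hs) (abs_nonneg _)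
    ((norm_nonneg _).trans (hB' _ (hmem s hs)))

theorem exp_neg {a : ℝ} (ha : 0 ≤ a) : Tame 0 fun s => Real.exp (-(a * s)) := by
  have hd : ∀ s, HasDerivAt (fun s => Real.exp (-(a * s))) (-a * Real.exp (-(a * s))) s := fun s => by
    convert! ((hasDerivAt_id s).const_mul a).fun_neg.exp using 1
    simp only [id]
    ring
  have hle : ∀ s, 0 ≤ s → Real.exp (-(a * s)) ≤ 1 := fun s hs =>
    Real.exp_le_one_iff.2 (neg_nonpos.2 (mul_nonneg ha hs))
  refine ⟨fun s _ => (hd s).differentiableAt, ?_, ⟨1, fun s hs => ?_⟩, ⟨a, fun s hs => ?_⟩⟩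
  · rw [funext fun s => (hd s).deriv]
    fun_prop
  · rw [Real.abs_exp]
    exact hle s hs
  · rw [(hd s).deriv, abs_mul, abs_neg, abs_of_nonneg ha, Real.abs_exp]
    exact mul_le_of_le_one_right ha (hle s hs)

theorem comp_exp {F : ℝ → ℝ} (hF : ContDiff ℝ ∞ F) : Tame 0 fun s => F (Real.exp (-s)) := by
  have h1 := exp_neg zero_le_one
  simp only [one_mul] at h1
  exact h1.comp (F' := deriv F) (fun x (_ : 0 ≤ x) => (hF.differentiable (by simp) x).hasDerivAt)
    (hF.continuous_deriv (by simp)).continuousOn fun s _ => Real.exp_nonneg _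

theorem inv (hf : Tame s₀ f) {c : ℝ} (h0 : 0 < c) (hc : ∀ s, s₀ ≤ s → c ≤ f s) :
    Tame s₀ fun s => (f s)⁻¹ :=
  hf.comp (F' := fun x => -(x ^ 2)⁻¹) (fun _ hx => hasDerivAt_inv (h0.trans_le hx).ne')
    (((continuousOn_id.pow 2).inv₀ fun _ hx => (pow_pos (h0.trans_le hx) 2).ne').neg) hc

theorem sqrt (hf : Tame s₀ f) {c : ℝ} (h0 : 0 < c) (hc : ∀ s, s₀ ≤ s → c ≤ f s) :
    Tame s₀ fun s => Real.sqrt (f s) :=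
  hf.comp (F' := fun x => 1 / (2 * Real.sqrt x))
    (fun _ hx => Real.hasDerivAt_sqrt (h0.trans_le hx).ne')
    (continuousOn_const.div (by fun_prop) fun _ hx =>
      (mul_pos two_pos (Real.sqrt_pos.2 (h0.trans_le hx))).ne') hc

end Tame

/-! ### Coefficients of the normal form and the quadratic remainder -/

/-- The coefficients `k`, `ρ` of the change of variables that brings the linearization to the form
`planarLin`. -/
theorem exists_shear_coefficients {p q κ : ℝ → ℝ} {lam w : ℝ} (hp : Tame 0 p) (hq : Tame 0 q)
    (hκ : Tame 0 κ) (hpl : Tendsto p atTop (𝓝 lam)) (hql : Tendsto q atTop (𝓝 w))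
    (hκl : Tendsto κ atTop (𝓝 0)) (hw : 0 < w) {ς : ℝ} (hς : ς = 1 ∨ ς = -1) (hlam : 0 < ς * lam) :
    ∃ s₀, 0 ≤ s₀ ∧ ∃ k ρ : ℝ → ℝ, Tame s₀ k ∧ Tame s₀ ρ ∧ ∃ c, 0 < c ∧
      ∀ s, s₀ ≤ s → c ≤ q s ∧ c ≤ ρ s ∧ k s * q s = κ s ∧
        ς * (ρ s ^ 2 * q s) = p s + κ s * k s := by
  have hςς : ς * ς = 1 := by rcases hς with rfl | rfl <;> norm_num
  have hql' : Tendsto (fun s => (q s)⁻¹) atTop (𝓝 w⁻¹) := hql.inv₀ hw.ne'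
  have hP : Tendsto (fun s => ς * ((p s + κ s * (κ s * (q s)⁻¹)) * (q s)⁻¹)) atTop
      (𝓝 (ς * lam * w⁻¹)) := by
    have := ((hpl.add (hκl.mul (hκl.mul hql'))).mul hql').const_mul ς
    simpa [mul_assoc] using this
  have hpos : 0 < ς * lam * w⁻¹ := by positivity
  have hev := (hql.eventually (lt_mem_nhds (half_lt_self hw))).and
    (hP.eventually (lt_mem_nhds (half_lt_self hpos)))
  obtain ⟨s₀, hs₀⟩ := eventually_atTop.1 (hev.and (eventually_ge_atTop 0))
  have h0 : 0 ≤ s₀ := (hs₀ s₀ le_rfl).2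
  -- Half the limit of `ρ²`, which is positive because `ς` is the sign of `lam`. It bounds `ρ²` away
  -- from zero, so the square root is tame.
  set b := ς * lam * w⁻¹ / 2
  have hb : 0 < b := half_pos hpos
  have hqT := hq.mono h0
  have hqi : Tame s₀ fun s => (q s)⁻¹ := hqT.inv (half_pos hw) fun s hs => (hs₀ s hs).1.1.le
  have hκT := hκ.mono h0
  have hPT : Tame s₀ fun s => ς * ((p s + κ s * (κ s * (q s)⁻¹)) * (q s)⁻¹) :=
    (Tame.const ς).mul (((hp.mono h0).add (hκT.mul (hκT.mul hqi))).mul hqi)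
  refine ⟨s₀, h0, fun s => κ s * (q s)⁻¹, _, hκT.mul hqi,
    hPT.sqrt hb fun s hs => (hs₀ s hs).1.2.le, min (w / 2) (Real.sqrt b),
    lt_min (half_pos hw) (Real.sqrt_pos.2 hb), fun s hs => ?_⟩
  obtain ⟨⟨h1, h2⟩, -⟩ := hs₀ s hs
  have hq0 : q s ≠ 0 := ((half_pos hw).trans h1).ne'
  refine ⟨(min_le_left _ _).trans h1.le, (min_le_right _ _).trans (Real.sqrt_le_sqrt h2.le), ?_, ?_⟩
  · field_simp
  · rw [Real.sq_sqrt (hb.trans h2).le]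
    have : ς * (ς * ((p s + κ s * (κ s * (q s)⁻¹)) * (q s)⁻¹) * q s)
      = (ς * ς) * (p s + κ s * (κ s * (q s)⁻¹)) * ((q s)⁻¹ * q s) := by ring
    rw [this, hςς, inv_mul_cancel₀ hq0, one_mul, mul_one]

/-- The scaling `e^(-δs)` gives both off-diagonal entries the common size `g`. Subtracting `kφ`,
with `g k q` equal to half the difference of the diagonal entries, makes both diagonal entries equal
to the half-trace, and `ρ` makes the off-diagonal entries equal up to the sign `ς`. The leftover
terms come from differentiating `k` and `ρ`. -/
theorem shear_normalForm {δ s a d e p q g k k' ρ ρ' kh ς : ℝ} {kf ρf kf' ρf' : ℝ → ℝ}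
    (hkf : kf s = k) (hρf : ρf s = ρ) (hkf' : kf' s = k') (hρf' : ρf' s = ρ')
    (he : Real.exp (-(δ * s)) * e = g) (hk : k * q = kh) (had : a - δ - d = 2 * (g * kh))
    (hρ : ς * (ρ ^ 2 * q) = p + kh * k) (z : ℝ × ℝ) :
    shearDeriv δ kf' ρf' s z + shear δ kf ρf s
        (a * z.1 + e * p * z.2, g * Real.exp (-(δ * s)) * q * z.1 + d * z.2)
      = planarLin ς ((a - δ + d) / 2) (g * q * ρ) (shear δ kf ρf s z)
        + (-k' * z.2, ρ' * z.2) := by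
  ext
  · simp only [shearDeriv, shear, planarLin, hkf, hρf, hkf', hρf', Prod.mk_add_mk]
    linear_combination (p * z.2) * he - (z.2 * g) * hρ - (Real.exp (-(δ * s)) * z.1 * g) * hk
      + (Real.exp (-(δ * s)) * z.1 / 2 + k * z.2 / 2) * had
  · simp only [shearDeriv, shear, planarLin, hkf, hρf, hkf', hρf', Prod.mk_add_mk]
    linear_combination (g * ρ * z.2) * hk - (ρ * z.2 / 2) * had

/-- Second order Taylor estimate, uniform on bounded sets. -/
theorem exists_quadratic_bound {E : Type*} [NormedAddCommGroup E] [NormedSpace ℝ E] [ProperSpace E]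
    {P : E → ℝ} (hP : ContDiff ℝ ∞ P) (R r : ℝ) :
    ∃ C, 0 ≤ C ∧ ∀ x z w : E, ‖x‖ ≤ R → ∀ b ≤ r, ‖z‖ ≤ b → ‖w‖ ≤ b →
      ‖P (x + z) - P (x + w) - fderiv ℝ P x (z - w)‖ ≤ C * b * ‖z - w‖ := by
  have h1 : ContDiff ℝ 1 (fderiv ℝ P) := (contDiff_infty.1 hP 2).fderiv_right (by norm_num)
  obtain ⟨K, hK⟩ := h1.locallyLipschitz.locallyLipschitzOn.exists_lipschitzOnWith_of_compact
    (isCompact_closedBall (0 : E) (R + r))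
  refine ⟨K, K.2, fun x z w hx b hb hz hw => ?_⟩
  have hb0 : 0 ≤ b := (norm_nonneg z).trans hz
  have hx' : x ∈ Metric.closedBall (0 : E) (R + r) := by
    rw [mem_closedBall_zero_iff]; linarith
  have key := (convex_closedBall x b).norm_image_sub_le_of_norm_hasFDerivWithin_le' (f := P)
    (f' := fderiv ℝ P) (φ := fderiv ℝ P x) (C := K * b) (x := x + w) (y := x + z)
    (fun y _ => (hP.differentiable (by simp) y).hasFDerivAt.hasFDerivWithinAt)
    (fun y hy => by
      have hy' : ‖y - x‖ ≤ b := by simpa [dist_eq_norm] using hy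
      have : y ∈ Metric.closedBall (0 : E) (R + r) := by
        rw [mem_closedBall_zero_iff]
        have := norm_add_le (y - x) x
        rw [sub_add_cancel] at this
        linarith
      have h2 := hK.dist_le_mul y this x hx'
      rw [dist_eq_norm, dist_eq_norm] at h2
      exact h2.trans (by gcongr))
    (by simpa [dist_eq_norm] using hw) (by simpa [dist_eq_norm] using hz)
  simpa only [add_sub_add_left_eq_sub] using key

/-! ### The trace and the determinant of the linearization -/

theorem tendsto_exp_neg_mul {a : ℝ} (ha : 0 < a) :
    Tendsto (fun s : ℝ => Real.exp (-(a * s))) atTop (𝓝 0) :=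
  Real.tendsto_exp_neg_atTop_nhds_zero.comp (tendsto_id.const_mul_atTop ha)

theorem tendsto_exp_mul {a : ℝ} (ha : 0 < a) :
    Tendsto (fun s : ℝ => Real.exp (a * s)) atTop atTop :=
  Real.tendsto_exp_atTop.comp (tendsto_id.const_mul_atTop ha)

/-- For the saddle, the half-trace `t = g ε` is negligible against `G ≥ c g`, so the rates `t ± G`
diverge with opposite signs whatever the sign of `t`. -/
theorem tendsto_add_sub_of_dominated {t G g ε : ℝ → ℝ} {c : ℝ} (hc : 0 < c)
    (hg : Tendsto g atTop atTop) (hε : Tendsto ε atTop (𝓝 0)) (ht : ∀ s, t s = g s * ε s)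
    (hG : ∀ᶠ s in atTop, g s * c ≤ G s) :
    Tendsto (fun s => t s + G s) atTop atTop ∧ Tendsto (fun s => t s - G s) atTop atBot := by
  have hgc : Tendsto (fun s => g s * (c / 2)) atTop atTop := hg.atTop_mul_const (half_pos hc)
  have h := (hε.eventually (Ioo_mem_nhds (neg_lt_zero.2 (half_pos hc)) (half_pos hc))).and
    (hG.and (hg.eventually_ge_atTop 0))
  constructor
  · refine tendsto_atTop_mono' _ ?_ hgc
    filter_upwards [h] with s hs
    rw [ht]
    nlinarith [hs.1.1, hs.2.1, hs.2.2]
  · rw [← tendsto_neg_atTop_iff]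
    refine tendsto_atTop_mono' _ ?_ hgc
    filter_upwards [h] with s hs
    rw [ht]
    nlinarith [hs.1.2, hs.2.1, hs.2.2]

theorem exists_lower_bound {t : ℝ → ℝ} (ht : Continuous t) {C : ℝ} (h : ∀ᶠ s in atTop, -C ≤ t s)
    (s₀ : ℝ) : ∃ C, ∀ s, s₀ ≤ s → -C ≤ t s := by
  obtain ⟨s₁, hs₁⟩ := eventually_atTop.1 h
  obtain ⟨B, hB⟩ := (isCompact_Icc (a := s₀) (b := s₁)).exists_bound_of_continuousOn ht.continuousOn
  refine ⟨max B C, fun s hs => ?_⟩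
  rcases le_total s s₁ with h1 | h1
  · exact (neg_le_neg (le_max_left _ _)).trans (abs_le.1 (hB s ⟨hs, h1⟩)).1
  · exact (neg_le_neg (le_max_right _ _)).trans (hs₁ s h1)

/-- Either `S` vanishes at `0` to order `α`, and the product is bounded, or `S` has a leading term
`a η^i` with `i < α`, and the product behaves like `a e^((α-i)s)`, which tends to `+∞` or `-∞`. This
excludes oscillation of the half-trace when `ς = -1`. -/
theorem lower_bound_or_tendsto_atBot {S : ℝ → ℝ} (hS : ContDiff ℝ ∞ S) (α : ℕ) (b s₀ : ℝ) :
    (∃ C, ∀ s, s₀ ≤ s → -C ≤ b + Real.exp (α * s) * S (Real.exp (-s))) ∨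
      Tendsto (fun s => b + Real.exp (α * s) * S (Real.exp (-s))) atTop atBot := by
  have hc : Continuous fun s => b + Real.exp (α * s) * S (Real.exp (-s)) := by
    have := hS.continuous
    fun_prop
  have hexp : ∀ (s : ℝ) (k : ℕ), Real.exp (-s) ^ k = Real.exp (-(k * s)) := fun s k => by
    rw [← Real.exp_nat_mul]; ring_nf
  have h0 : Tendsto (fun s : ℝ => Real.exp (-s)) atTop (𝓝 0) := Real.tendsto_exp_neg_atTop_nhds_zero
  rcases isBigO_or_exists_leading hS α with h | ⟨i, hi, a, ha, h⟩
  · left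
    obtain ⟨C, hC⟩ := (h.comp_tendsto h0).bound
    refine exists_lower_bound hc (C := |b| + C) ?_ s₀
    filter_upwards [hC] with s hs
    simp only [Function.comp, hexp, Real.norm_eq_abs, Real.abs_exp] at hs
    have e : Real.exp (α * s) * Real.exp (-(α * s)) = 1 := by
      rw [← Real.exp_add, add_neg_cancel, Real.exp_zero]
    have h1 : Real.exp (α * s) * |S (Real.exp (-s))| ≤ C := by
      calc _ ≤ Real.exp (α * s) * (C * Real.exp (-(α * s))) := by gcongr
        _ = C * (Real.exp (α * s) * Real.exp (-(α * s))) := by ring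
        _ = C := by rw [e, mul_one]
    have h2 : |Real.exp (α * s) * S (Real.exp (-s))| ≤ C := by rwa [abs_mul, Real.abs_exp]
    linarith [(abs_le.1 h2).1, neg_abs_le b]
  · have hlim : Tendsto (fun s => Real.exp (i * s) * S (Real.exp (-s))) atTop (𝓝 a) := by
      have h1 := (h.comp_tendsto h0).tendsto_div_nhds_zero
      have h2 : Tendsto (fun s => Real.exp (i * s) * S (Real.exp (-s)) - a) atTop (𝓝 0) := by
        refine h1.congr fun s => ?_
        have e : Real.exp (i * s) * Real.exp (-(i * s)) = 1 := by
          rw [← Real.exp_add, add_neg_cancel, Real.exp_zero]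
        simp only [Function.comp, hexp, smul_eq_mul]
        rw [div_eq_iff (Real.exp_pos _).ne']
        linear_combination (-S (Real.exp (-s))) * e
      simpa using h2.add_const a
    have hi' : 0 < (α : ℝ) - i := by
      rw [sub_pos]
      exact_mod_cast hi
    have e : ∀ s, b + Real.exp (α * s) * S (Real.exp (-s))
        = Real.exp (((α : ℝ) - i) * s) * (Real.exp (i * s) * S (Real.exp (-s))) + b := fun s => by
      rw [← mul_assoc, ← Real.exp_add]
      ring_nf
    rcases lt_or_gt_of_ne ha with h1 | h1
    · right
      simp only [e]
      exact tendsto_atBot_add_const_right _ _ ((tendsto_exp_mul hi').atTop_mul_neg h1 hlim)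
    · left
      have : Tendsto (fun s => b + Real.exp (α * s) * S (Real.exp (-s))) atTop atTop := by
        simp only [e]
        exact tendsto_atTop_add_const_right _ _ ((tendsto_exp_mul hi').atTop_mul_pos h1 hlim)
      exact exists_lower_bound hc (C := 0) (this.eventually_ge_atTop (-0)) s₀


/-! ### Solutions of singular systems -/

/-- The right-hand side of `v' = κ v + e^(αs) P(e^(-s), v, φ)`, `φ' = e^(βs) Q(e^(-s), v, φ)`. -/
noncomputable def singularField (P Q : ℝ × ℝ × ℝ → ℝ) (κ : ℝ) (α β : ℕ) (s : ℝ) (x : ℝ × ℝ) : ℝ × ℝ :=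
  (κ * x.1 + Real.exp (α * s) * P (Real.exp (-s), x), Real.exp (β * s) * Q (Real.exp (-s), x))

theorem hasDerivAt_comp_exp_neg {x : ℝ → ℝ × ℝ} (hx : ContDiff ℝ ∞ x) (s : ℝ) :
    HasDerivAt (fun s => x (Real.exp (-s))) (-Real.exp (-s) • deriv x (Real.exp (-s))) s := by
  have h1 : HasDerivAt (fun s : ℝ => Real.exp (-s)) (-Real.exp (-s)) s := by
    simpa using (hasDerivAt_id s).fun_neg.exp
  exact (hx.differentiable (by simp) _).hasDerivAt.scomp s h1

/-- In the variable `s` the defect of the curve `x(e^(-s))` is its residual amplified by `e^(αs)`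
and `e^(βs)`, so partial sums must be longer than the accuracy wanted. -/
theorem sub_singularField_eq (P Q : ℝ × ℝ × ℝ → ℝ) (κ : ℝ) (α β : ℕ) (x : ℝ → ℝ × ℝ) (s : ℝ) :
    -Real.exp (-s) • deriv x (Real.exp (-s)) - singularField P Q κ α β s (x (Real.exp (-s)))
      = (-Real.exp (α * s) * (residual P Q κ α β x (Real.exp (-s))).1,
        -Real.exp (β * s) * (residual P Q κ α β x (Real.exp (-s))).2) := by
  have h : ∀ k : ℕ, Real.exp (k * s) * Real.exp (-s) ^ k = 1 := fun k => by
    rw [Real.exp_nat_mul, ← mul_pow, ← Real.exp_add, add_neg_cancel, Real.exp_zero, one_pow]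
  ext
  · simp only [singularField, residual, Prod.fst_sub, Prod.smul_fst, smul_eq_mul]
    linear_combination (κ * (x (Real.exp (-s))).1
      + Real.exp (-s) * (deriv x (Real.exp (-s))).1) * h α
  · simp only [singularField, residual, Prod.snd_sub, Prod.smul_snd, smul_eq_mul]
    linear_combination (Real.exp (-s) * (deriv x (Real.exp (-s))).2) * h β

theorem isBigO_comp_exp_neg {F : Type*} [NormedAddCommGroup F] {f : ℝ → F} {m : ℕ}
    (h : f =O[𝓝 0] fun η : ℝ => η ^ m) :
    (fun s => f (Real.exp (-s))) =O[atTop] fun s : ℝ => Real.exp (-(m * s)) := by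
  refine (h.comp_tendsto Real.tendsto_exp_neg_atTop_nhds_zero).congr_right fun s => ?_
  simp only [Function.comp]
  rw [← Real.exp_nat_mul, mul_neg]

theorem partialSum_sub_isBigO (c : ℕ → ℝ × ℝ) {m m' : ℕ} (h : m ≤ m') :
    (fun η => partialSum c m' η - partialSum c m η) =O[𝓝 0] fun η : ℝ => η ^ m := by
  induction m', h using Nat.le_induction with
  | base => simpa using isBigO_zero _ _
  | succ k hk ih =>
    have h1 : (fun η : ℝ => η ^ k • c k) =O[𝓝 0] fun η : ℝ => η ^ m := by
      have h2 : (fun η : ℝ => η ^ k) =O[𝓝 0] fun η : ℝ => η ^ m := by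
        rcases hk.eq_or_lt with rfl | hk
        · exact isBigO_refl _ _
        · exact (isLittleO_pow_pow_zero hk).isBigO
      have h3 : (fun η : ℝ => η ^ k • c k) =O[𝓝 0] fun η : ℝ => η ^ k :=
        IsBigO.of_bound ‖c k‖ (Eventually.of_forall fun x => by rw [norm_smul, mul_comm])
      exact h3.trans h2
    refine (ih.add h1).congr_left fun η => ?_
    rw [partialSum, partialSum, partialSum, Finset.sum_range_succ]
    abel

theorem fderiv_prod_apply (P : ℝ × ℝ × ℝ → ℝ) (z : ℝ × ℝ × ℝ) (d : ℝ × ℝ) :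
    fderiv ℝ P z (0, d) = fderiv ℝ P z (0, 1, 0) * d.1 + fderiv ℝ P z (0, 0, 1) * d.2 := by
  have : ((0, d) : ℝ × ℝ × ℝ) = d.1 • (0, 1, 0) + d.2 • (0, 0, 1) := by
    ext <;> simp
  rw [this, map_add, map_smul, map_smul, smul_eq_mul, smul_eq_mul]
  ring

/-- The factor `b` retains the smallness of both increments: for `b` of size `e^(-(α+δ)s)` it turns
the amplification `e^(αs)` into the factor `e^(-δs)` that `exists_solution_of_normalForm` requires.
-/
theorem singularField_quadratic {P Q : ℝ × ℝ × ℝ → ℝ} (hP : ContDiff ℝ ∞ P) (hQ : ContDiff ℝ ∞ Q)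
    (κ : ℝ) {α β : ℕ} (hβ : β ≤ α) {x : ℝ → ℝ × ℝ} (hx : Continuous x) (r : ℝ) :
    ∃ K, 0 ≤ K ∧ ∀ s, 0 ≤ s → ∀ b ≤ r, ∀ z w : ℝ × ℝ, ‖z‖ ≤ b → ‖w‖ ≤ b →
      ‖singularField P Q κ α β s (x (Real.exp (-s)) + z)
        - singularField P Q κ α β s (x (Real.exp (-s)) + w)
        - (κ * (z - w).1
            + Real.exp (α * s) * fderiv ℝ P (Real.exp (-s), x (Real.exp (-s))) (0, z - w),
          Real.exp (β * s) * fderiv ℝ Q (Real.exp (-s), x (Real.exp (-s))) (0, z - w))‖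
        ≤ K * Real.exp (α * s) * b * ‖z - w‖ := by
  obtain ⟨R, hR⟩ := (isCompact_Icc (a := (0 : ℝ)) (b := 1)).exists_bound_of_continuousOn
    (continuous_id.prodMk hx).continuousOn
  obtain ⟨A, hA0, hA⟩ := exists_quadratic_bound hP R r
  obtain ⟨B, hB0, hB⟩ := exists_quadratic_bound hQ R r
  refine ⟨max A B, le_max_of_le_left hA0, fun s hs b hb z w hz hw => ?_⟩
  have hb0 : 0 ≤ b := (norm_nonneg z).trans hz
  set η := Real.exp (-s) with hη
  have hη1 : ‖((η, x η) : ℝ × ℝ × ℝ)‖ ≤ R :=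
    hR η ⟨Real.exp_nonneg _, Real.exp_le_one_iff.2 (neg_nonpos.2 hs)⟩
  have hn : ∀ y : ℝ × ℝ, ‖((0, y) : ℝ × ℝ × ℝ)‖ = ‖y‖ := fun y => by simp [Prod.norm_def]
  have hadd : ∀ y : ℝ × ℝ, ((η, x η) : ℝ × ℝ × ℝ) + (0, y) = (η, x η + y) := fun y => by simp
  have hsub : ((0, z) : ℝ × ℝ × ℝ) - (0, w) = (0, z - w) := by simp
  have h1 := hA _ (0, z) (0, w) hη1 b hb (by rwa [hn]) (by rwa [hn])
  have h2 := hB _ (0, z) (0, w) hη1 b hb (by rwa [hn]) (by rwa [hn])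
  rw [hadd, hadd, hsub, hn] at h1 h2
  have hβα : Real.exp (β * s) ≤ Real.exp (α * s) := by gcongr
  refine max_le ?_ ?_
  · have e : κ * (x η + z).1 + Real.exp (α * s) * P (η, x η + z)
        - (κ * (x η + w).1 + Real.exp (α * s) * P (η, x η + w))
        - (κ * (z - w).1 + Real.exp (α * s) * fderiv ℝ P (η, x η) (0, z - w))
        = Real.exp (α * s) * (P (η, x η + z) - P (η, x η + w)
          - fderiv ℝ P (η, x η) (0, z - w)) := by
      simp only [Prod.fst_add, Prod.fst_sub]
      ring
    change ‖κ * (x η + z).1 + Real.exp (α * s) * P (η, x η + z)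
        - (κ * (x η + w).1 + Real.exp (α * s) * P (η, x η + w))
        - (κ * (z - w).1 + Real.exp (α * s) * fderiv ℝ P (η, x η) (0, z - w))‖ ≤ _
    rw [e, norm_mul, Real.norm_of_nonneg (Real.exp_nonneg _)]
    calc _ ≤ Real.exp (α * s) * (A * b * ‖z - w‖) := by gcongr
      _ ≤ Real.exp (α * s) * (max A B * b * ‖z - w‖) := by gcongr; exact le_max_left _ _
      _ = _ := by ring
  · have e : Real.exp (β * s) * Q (η, x η + z) - Real.exp (β * s) * Q (η, x η + w)
        - Real.exp (β * s) * fderiv ℝ Q (η, x η) (0, z - w)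
        = Real.exp (β * s) * (Q (η, x η + z) - Q (η, x η + w)
          - fderiv ℝ Q (η, x η) (0, z - w)) := by ring
    change ‖Real.exp (β * s) * Q (η, x η + z) - Real.exp (β * s) * Q (η, x η + w)
        - Real.exp (β * s) * fderiv ℝ Q (η, x η) (0, z - w)‖ ≤ _
    rw [e, norm_mul, Real.norm_of_nonneg (Real.exp_nonneg _)]
    calc _ ≤ Real.exp (α * s) * (B * b * ‖z - w‖) := by gcongr
      _ ≤ Real.exp (α * s) * (max A B * b * ‖z - w‖) := by gcongr; exact le_max_right _ _
      _ = _ := by ring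

/-- With `γ = (α + β)/2` and `δ = (α - β)/2`, the condition `β < α` means `δ > 0`, so that `e^(βs)
Q_φ` is small compared with `e^(γs)`. The condition `α < 2j + β` means `j > δ`, which says the same
of `e^(αs) P_v = O(e^((α-j)s))`. The off-diagonal entries therefore govern the linearization. -/
theorem exists_solution_singularField {P Q : ℝ × ℝ × ℝ → ℝ} (hP : ContDiff ℝ ∞ P)
    (hQ : ContDiff ℝ ∞ Q) (κ : ℝ) {α β j : ℕ} (hβ : β < α) (hj : α < 2 * j + β) {x₀ : ℝ × ℝ}
    (hP0 : P (0, x₀) = 0) (hQ0 : Q (0, x₀) = 0) {R : ℝ × ℝ × ℝ → ℝ} (hR : ContDiff ℝ ∞ R)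
    (hPv : ∀ z, fderiv ℝ P z (0, 1, 0) = z.1 ^ j * R z)
    (hPφ : fderiv ℝ P (0, x₀) (0, 0, 1) ≠ 0) (hQv : 0 < fderiv ℝ Q (0, x₀) (0, 1, 0)) :
    ∃ c : ℕ → ℝ × ℝ, c 0 = x₀ ∧ ∃ s₁ : ℝ, ∃ x : ℝ → ℝ × ℝ,
      (∀ s, s₁ < s → HasDerivAt x (singularField P Q κ α β s (x s)) s) ∧
      ∀ m : ℕ, (fun s => x s - partialSum c m (Real.exp (-s))) =O[atTop]
        fun s => Real.exp (-(m * s)) := by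
  have hj1 : j ≠ 0 := by rintro rfl; omega
  have hPv0 : fderiv ℝ P (0, x₀) (0, 1, 0) = 0 := by
    rw [hPv]
    simp [hj1]
  obtain ⟨c, hc0, hc⟩ := exists_formal_solution (β := β) hP hQ κ (by omega : 1 ≤ α) hP0 hQ0 hPv0 hPφ
    hQv.ne'
  refine ⟨c, hc0, ?_⟩
  set lam := fderiv ℝ P (0, x₀) (0, 0, 1) with hlam
  set w := fderiv ℝ Q (0, x₀) (0, 1, 0) with hw
  -- Long enough for `X m - X 0` to be `O(e^(-(α+2δ+1)s))`, since `α + 2δ = 2α - β`, and for the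
  -- residual to survive the amplification by `e^(αs)`.
  obtain ⟨m₁, hm₁⟩ : ∃ m₁ : ℕ, m₁ = 2 * α + 1 := ⟨_, rfl⟩
  set x : ℝ → ℝ × ℝ := partialSum c m₁ with hx
  have hxs : ContDiff ℝ ∞ x := contDiff_partialSum c m₁
  have hx0 : x 0 = x₀ := by
    rw [hx, hm₁, partialSum, Finset.sum_range_succ']
    simp [hc0]
  set y : ℝ → ℝ × ℝ × ℝ := fun η => (η, x η) with hy
  have hys : ContDiff ℝ ∞ y := contDiff_id.prodMk hxs
  have hy0 : y 0 = (0, x₀) := by rw [hy]; simp only [hx0]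
  have hsm : ∀ {S : ℝ × ℝ × ℝ → ℝ} (_ : ContDiff ℝ ∞ S) (v : ℝ × ℝ × ℝ),
      ContDiff ℝ ∞ fun η => fderiv ℝ S (y η) v := fun hS v =>
    ((hS.fderiv_right (by simp)).comp hys).clm_apply contDiff_const
  set p : ℝ → ℝ := fun η => fderiv ℝ P (y η) (0, 0, 1) with hp
  set q : ℝ → ℝ := fun η => fderiv ℝ Q (y η) (0, 1, 0) with hq
  set d : ℝ → ℝ := fun η => fderiv ℝ Q (y η) (0, 0, 1) with hd
  set a : ℝ → ℝ := fun η => R (y η) with ha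
  have hps : ContDiff ℝ ∞ p := hsm hP _
  have hqs : ContDiff ℝ ∞ q := hsm hQ _
  have hds : ContDiff ℝ ∞ d := hsm hQ _
  have has : ContDiff ℝ ∞ a := hR.comp hys
  have hexp0 : Tendsto (fun s : ℝ => Real.exp (-s)) atTop (𝓝 0) :=
    Real.tendsto_exp_neg_atTop_nhds_zero
  have hlim : ∀ {f : ℝ → ℝ}, ContDiff ℝ ∞ f →
      Tendsto (fun s => f (Real.exp (-s))) atTop (𝓝 (f 0)) := fun hf =>
    (hf.continuous.tendsto 0).comp hexp0
  have hp0 : p 0 = lam := by rw [hp]; simp only [hy0, hlam]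
  have hq0 : q 0 = w := by rw [hq]; simp only [hy0, hw]
  obtain ⟨γ, hγ⟩ : ∃ γ : ℝ, γ = ((α : ℝ) + β) / 2 := ⟨_, rfl⟩
  obtain ⟨δ, hδ⟩ : ∃ δ : ℝ, δ = ((α : ℝ) - β) / 2 := ⟨_, rfl⟩
  have hβα : (β : ℝ) < α := by exact_mod_cast hβ
  have hβ0 : (0 : ℝ) ≤ β := Nat.cast_nonneg β
  have hγ0 : 0 < γ := by linarith
  have hδ0 : 0 < δ := by linarith
  have hjδ : 0 < j - δ := by
    have : (α : ℝ) < 2 * j + β := by exact_mod_cast hj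
    linarith
  -- Half the difference of the diagonal entries after the scaling, divided by `g = e^(γs)`; `ε`
  -- below is the corresponding half-sum. Every summand of either decays, by `γ > 0`, `δ > 0` and `j
  -- > δ`.
  set kh : ℝ → ℝ := fun s => (1 / 2) * ((κ - δ) * Real.exp (-(γ * s))
    + (Real.exp (-((j - δ) * s)) * a (Real.exp (-s))
      + (-1) * (Real.exp (-(δ * s)) * d (Real.exp (-s))))) with hkh
  set ε : ℝ → ℝ := fun s => (1 / 2) * ((κ - δ) * Real.exp (-(γ * s))
    + (Real.exp (-((j - δ) * s)) * a (Real.exp (-s))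
      + Real.exp (-(δ * s)) * d (Real.exp (-s)))) with hε
  have hkhT : Tame 0 kh := (Tame.const _).mul (((Tame.const _).mul (Tame.exp_neg hγ0.le)).add
    (((Tame.exp_neg hjδ.le).mul (Tame.comp_exp has)).add
      ((Tame.const _).mul ((Tame.exp_neg hδ0.le).mul (Tame.comp_exp hds)))))
  have hkh0 : Tendsto kh atTop (𝓝 0) := by
    have := (((tendsto_exp_neg_mul hγ0).const_mul (κ - δ)).add
      (((tendsto_exp_neg_mul hjδ).mul (hlim has)).add
      (((tendsto_exp_neg_mul hδ0).mul (hlim hds)).const_mul (-1)))).const_mul (1 / 2)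
    simpa only [mul_zero, zero_mul, add_zero] using this
  have hε0 : Tendsto ε atTop (𝓝 0) := by
    have := (((tendsto_exp_neg_mul hγ0).const_mul (κ - δ)).add
      (((tendsto_exp_neg_mul hjδ).mul (hlim has)).add
      ((tendsto_exp_neg_mul hδ0).mul (hlim hds)))).const_mul (1 / 2)
    simpa only [mul_zero, zero_mul, add_zero] using this
  obtain ⟨ς, hς, hςlam⟩ : ∃ ς : ℝ, (ς = 1 ∨ ς = -1) ∧ 0 < ς * lam := by
    rcases lt_or_gt_of_ne hPφ with h | h
    · exact ⟨-1, Or.inr rfl, by linarith⟩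
    · exact ⟨1, Or.inl rfl, by linarith⟩
  obtain ⟨s₀, hs₀, k, ρ, hk, hρ, c₁, hc₁, hkρ⟩ := exists_shear_coefficients (Tame.comp_exp hps)
    (Tame.comp_exp hqs) hkhT (by simpa only [hp0] using hlim hps) (by simpa only [hq0] using hlim hqs)
    hkh0 hQv hς hςlam
  obtain ⟨C₁, hC₁⟩ := hk.bound
  obtain ⟨C₂, hC₂⟩ := hk.bound_deriv
  obtain ⟨C₃, hC₃⟩ := hρ.bound
  obtain ⟨C₄, hC₄⟩ := hρ.bound_deriv
  obtain ⟨C, hC⟩ : ∃ C, C = max (max (max C₁ C₂) (max C₃ C₄)) c₁⁻¹ := ⟨_, rfl⟩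
  have hC1 : C₁ ≤ C := by rw [hC]; exact (le_max_left _ _).trans ((le_max_left _ _).trans (le_max_left _ _))
  have hC2 : C₂ ≤ C := by rw [hC]; exact (le_max_right _ _).trans ((le_max_left _ _).trans (le_max_left _ _))
  have hC3 : C₃ ≤ C := by rw [hC]; exact (le_max_left _ _).trans ((le_max_right _ _).trans (le_max_left _ _))
  have hC4 : C₄ ≤ C := by rw [hC]; exact (le_max_right _ _).trans ((le_max_right _ _).trans (le_max_left _ _))
  have hC5 : c₁⁻¹ ≤ C := by rw [hC]; exact le_max_right _ _
  have hC0 : 0 < C := (inv_pos.2 hc₁).trans_le hC5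
  obtain ⟨K, hK0, hK⟩ := singularField_quadratic hP hQ κ hβ.le hxs.continuous (1 + C + C * C)
  set g : ℝ → ℝ := fun s => Real.exp (γ * s) with hg
  have hgc : Continuous g := by rw [hg]; fun_prop
  set t : ℝ → ℝ := fun s => (κ + Real.exp (α * s) * (Real.exp (-s) ^ j * a (Real.exp (-s))) - δ
    + Real.exp (β * s) * d (Real.exp (-s))) / 2 with ht
  have htc : Continuous t := by
    have := has.continuous
    have := hds.continuous
    rw [ht]
    fun_prop
  have hηj : ∀ s : ℝ, Real.exp (-s) ^ j = Real.exp (-(j * s)) := fun s => by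
    rw [← Real.exp_nat_mul, mul_neg]
  have e1 : ∀ s, Real.exp (α * s) * Real.exp (-s) ^ j = g s * Real.exp (-((j - δ) * s)) := fun s => by
    rw [hηj, hg, ← Real.exp_add, ← Real.exp_add]
    congr 1
    rw [hγ, hδ]
    ring
  have e2 : ∀ s, Real.exp (β * s) = g s * Real.exp (-(δ * s)) := fun s => by
    rw [hg, ← Real.exp_add]
    congr 1
    rw [hγ, hδ]
    ring
  have e3 : ∀ s, g s * Real.exp (-(γ * s)) = 1 := fun s => by
    rw [hg, ← Real.exp_add, add_neg_cancel, Real.exp_zero]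
  have e4 : ∀ s, Real.exp (-(δ * s)) * Real.exp (α * s) = g s := fun s => by
    rw [hg, ← Real.exp_add]
    congr 1
    rw [hγ, hδ]
    ring
  have ht1 : ∀ s, t s = g s * ε s := fun s => by
    simp only [ht, hε]
    linear_combination (a (Real.exp (-s)) / 2) * e1 s + (d (Real.exp (-s)) / 2) * e2 s
      - ((κ - δ) / 2) * e3 s
  -- The same half-trace written as a constant plus `e^(αs)` times a smooth function of `e^(-s)`,
  -- the form required by `lower_bound_or_tendsto_atBot`.
  have hSadd : ∀ s, t s = (κ - δ) / 2 + Real.exp (α * s) * ((1 / 2) * (Real.exp (-s) ^ j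
      * a (Real.exp (-s)) + Real.exp (-s) ^ (α - β) * d (Real.exp (-s)))) := fun s => by
    have e5 : Real.exp (α * s) * Real.exp (-s) ^ (α - β) = Real.exp (β * s) := by
      rw [← Real.exp_nat_mul, ← Real.exp_add, Nat.cast_sub hβ.le]
      congr 1
      ring
    simp only [ht]
    linear_combination (-d (Real.exp (-s)) / 2) * e5
  have hG : ∀ s, s₀ ≤ s → g s * (c₁ * c₁) ≤ g s * q (Real.exp (-s)) * ρ s := fun s hs => by
    obtain ⟨h1, h2, -, -⟩ := hkρ s hs
    have := Real.exp_pos (γ * s)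
    rw [mul_assoc]
    gcongr
    exact hc₁.le.trans h1
  set X : ℕ → ℝ → ℝ × ℝ := fun m s => partialSum c (m + m₁) (Real.exp (-s)) with hX
  set X' : ℕ → ℝ → ℝ × ℝ := fun m s =>
    -Real.exp (-s) • deriv (partialSum c (m + m₁)) (Real.exp (-s)) with hX'
  have hXd : ∀ m s, HasDerivAt (X m) (X' m s) s := fun m s =>
    hasDerivAt_comp_exp_neg (contDiff_partialSum c (m + m₁)) s
  have hX00 : ∀ s, X 0 s = x (Real.exp (-s)) := fun s => by simp only [hX, hx, zero_add]
  have hXX : ∀ {m m' : ℕ}, m ≤ m' → (fun s => partialSum c m' (Real.exp (-s))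
      - partialSum c m (Real.exp (-s))) =O[atTop] fun s : ℝ => Real.exp (-(m * s)) := fun h =>
    isBigO_comp_exp_neg (partialSum_sub_isBigO c h)
  have hm₁R : (m₁ : ℝ) = 2 * α + 1 := by rw [hm₁]; push_cast; ring
  -- The radius exponent is `α + 2δ`: undoing the shear enlarges `e^(-(α+2δ)s)` to order
  -- `e^(-(α+δ)s)`, and the factor `e^(αs)` of the quadratic estimate then leaves `e^(-δs)`.
  obtain ⟨s₁, -, z, hz, hzA⟩ := exists_solution_of_normalForm (F := singularField P Q κ α β)
    (δ := δ) (s₀ := s₀) (C := C) (K := K * (1 + C + C * C)) (κ := α + 2 * δ) (ς := ς) (k := k) (ρ := ρ)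
    (k' := deriv k) (ρ' := deriv ρ) (t := t) (G := fun s => g s * q (Real.exp (-s)) * ρ s)
    (J := fun s z => (κ * z.1 + Real.exp (α * s) * fderiv ℝ P (y (Real.exp (-s))) (0, z),
      Real.exp (β * s) * fderiv ℝ Q (y (Real.exp (-s))) (0, z))) (X := X) (X' := X')
    (by
      have := hP.continuous
      have := hQ.continuous
      unfold singularField
      fun_prop)
    hδ0.le hs₀ hC0 (fun s hs => (hk.diff s hs).hasDerivAt) (fun s hs => (hρ.diff s hs).hasDerivAt)
    hk.cont_deriv hρ.cont_deriv (fun s hs => (hC₁ s hs).trans hC1) (fun s hs => (hC₃ s hs).trans hC3)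
    (fun s hs => (hC₂ s hs).trans hC2) (fun s hs => (hC₄ s hs).trans hC4)
    (fun s hs => by
      calc (1 : ℝ) = c₁⁻¹ * c₁ := (inv_mul_cancel₀ hc₁.ne').symm
        _ ≤ C * ρ s := mul_le_mul hC5 (hkρ s hs).2.1 hc₁.le hC0.le)
    htc.continuousOn
    ((hgc.continuousOn.mul (Tame.comp_exp hqs |>.mono hs₀).continuousOn).mul hρ.continuousOn)
    (by
      rcases hς with rfl | rfl
      · left
        exact ⟨rfl, tendsto_add_sub_of_dominated (mul_pos hc₁ hc₁) (tendsto_exp_mul hγ0) hε0 ht1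
          ((eventually_ge_atTop s₀).mono hG)⟩
      · right
        refine ⟨rfl, ?_⟩
        rw [funext hSadd]
        exact lower_bound_or_tendsto_atBot (S := fun η => (1 / 2) * (η ^ j * a η + η ^ (α - β) * d η))
          (contDiff_const.mul (((contDiff_id.pow j).mul has).add ((contDiff_id.pow _).mul hds)))
          α ((κ - δ) / 2) s₀)
    (fun s hs v => by
      obtain ⟨-, -, h3, h4⟩ := hkρ s hs
      have := shear_normalForm (δ := δ) (s := s) (kf := k) (ρf := ρ) (kf' := deriv k)
        (ρf' := deriv ρ) rfl rfl rfl rfl (e4 s) h3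
        (a := κ + Real.exp (α * s) * (Real.exp (-s) ^ j * a (Real.exp (-s))))
        (d := Real.exp (β * s) * d (Real.exp (-s))) (by
          simp only [hkh]
          linear_combination (a (Real.exp (-s))) * e1 s - (d (Real.exp (-s))) * e2 s
            - (κ - δ) * e3 s) h4 v
      rw [← this]
      congr 2
      have e5 := fderiv_prod_apply P (y (Real.exp (-s))) v
      have e6 := fderiv_prod_apply Q (y (Real.exp (-s))) v
      rw [hPv] at e5
      ext
      · simp only [e5]
        ring
      · simp only [e6, ← e2]
        ring)
    (fun s hs u v hu hv => by
      rw [hX00]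
      have h0 : 0 ≤ s := hs₀.trans hs
      rw [mul_assoc, ← Real.exp_add] at hu hv
      have hb : (1 + C + C * C) * Real.exp (δ * s + -((α + 2 * δ) * s)) ≤ 1 + C + C * C := by
        refine mul_le_of_le_one_right (by positivity) (Real.exp_le_one_iff.2 ?_)
        have : 0 ≤ ((α : ℝ) + δ) * s := by positivity
        linarith
      refine (hK s h0 _ hb u v hu hv).trans (le_of_eq ?_)
      have : Real.exp (α * s) * Real.exp (δ * s + -((α + 2 * δ) * s)) = Real.exp (-(δ * s)) := by
        rw [← Real.exp_add]
        congr 1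
        ring
      linear_combination (K * (1 + C + C * C) * ‖u - v‖) * this)
    (fun m s _ => hXd m s)
    (fun m => by
      have := ((contDiff_infty_iff_deriv.1 (contDiff_partialSum c (m + m₁))).2).continuous
      rw [hX']
      fun_prop)
    (fun m => by
      have h1 := isBigO_comp_exp_neg (hc (m + m₁))
      have h2 : ∀ i : ℕ, i ≤ α → (fun s : ℝ => -Real.exp (i * s) * Real.exp (-((m + m₁ : ℕ) * s)))
          =O[atTop] fun s => Real.exp (-(m * s)) := fun i hi => by
        have hi' : (i : ℝ) ≤ α := by exact_mod_cast hi
        have h3 := isBigO_exp_neg (a := (m : ℝ)) (b := (m : ℝ) + m₁ - i) (by rw [hm₁R]; linarith)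
        refine (h3.neg_left).congr_left fun s => ?_
        rw [neg_mul, ← Real.exp_add]
        push_cast
        ring_nf
      simp only [hX, hX', sub_singularField_eq]
      exact (((isBigO_refl (fun s : ℝ => -Real.exp (α * s)) atTop).mul (isBigO_fst_prod'.trans h1)).trans
          (h2 α le_rfl)).prod_left
        (((isBigO_refl (fun s : ℝ => -Real.exp (β * s)) atTop).mul (isBigO_snd_prod'.trans h1)).trans
          (h2 β hβ.le)))
    (fun m => by
      simp only [hX, zero_add]
      exact (hXX (Nat.le_add_left m₁ m)).trans (isBigO_exp_neg (by rw [hm₁R]; linarith)))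
    (fun m m' h => (hXX (Nat.add_le_add_right h m₁)).trans (isBigO_exp_neg (by simp)))
  refine ⟨s₁, z, hz, fun m => ?_⟩
  -- Using index `m + α` pays for the lost factor `e^(δs)`, since `δ ≤ α`; the surplus terms of the
  -- partial sum are then `O(e^(-ms))`.
  have h1 := (hzA (m + α)).trans (isBigO_exp_neg (a := (m : ℝ)) (by push_cast; linarith))
  have h2 := hXX (m := m) (m' := m + α + m₁) (by omega)
  exact (h1.add h2).congr_left fun s => by simp only [hX]; abel


/-! ### The truncated averaged system in singular form -/

theorem hasDerivAt_snd_fst {P : ℝ × ℝ × ℝ → ℝ} (hP : ContDiff ℝ ∞ P) (η v φ : ℝ) :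
    HasDerivAt (fun v => P (η, v, φ)) (fderiv ℝ P (η, v, φ) (0, 1, 0)) v :=
  (hP.differentiable (by simp) (η, v, φ)).hasFDerivAt.comp_hasDerivAt v
    ((hasDerivAt_const v η).prodMk ((hasDerivAt_id v).prodMk (hasDerivAt_const v φ)))

theorem hasDerivAt_snd_snd {P : ℝ × ℝ × ℝ → ℝ} (hP : ContDiff ℝ ∞ P) (η v φ : ℝ) :
    HasDerivAt (fun φ => P (η, v, φ)) (fderiv ℝ P (η, v, φ) (0, 0, 1)) φ :=
  (hP.differentiable (by simp) (η, v, φ)).hasFDerivAt.comp_hasDerivAt φ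
    ((hasDerivAt_const φ η).prodMk ((hasDerivAt_const φ v).prodMk (hasDerivAt_id φ)))

namespace Data

variable (D : Data)

/-- `N ∑_{L ≤ K ≤ n} η^(K-L) Λ_K(η^M v, φ)` -/
noncomputable def singularLambda (ϰ L n : ℕ) (z : ℝ × ℝ × ℝ) : ℝ :=
  D.N * ∑ K ∈ Finset.Icc L n, z.1 ^ (K - L) * D.Lambda ϰ K (z.1 ^ D.M * z.2.1) z.2.2

/-- `N η^(-M) ∑_{K ≤ n} η^K Ω_K(η^M v, φ)`, where `Ω_K` is a multiple of `η^M v` for `K < M` -/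
noncomputable def singularOmega (ϰ n : ℕ) (z : ℝ × ℝ × ℝ) : ℝ :=
  D.N * ∑ K ∈ Finset.range (n + 1), if K < D.M then z.1 ^ K * (D.calQ ϰ K (z.1 ^ D.M * z.2.1) * z.2.1)
    else z.1 ^ (K - D.M) * D.Omega ϰ K (z.1 ^ D.M * z.2.1) z.2.2

/-- `∂_r Λ_K(η^M v, φ)` -/
noncomputable def dLambda (ϰ K : ℕ) (z : ℝ × ℝ × ℝ) : ℝ :=
  fderiv ℝ (fun y : ℝ × ℝ => D.Lambda ϰ K y.1 y.2) (z.1 ^ D.M * z.2.1, z.2.2) (1, 0)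

variable {D}

theorem contDiff_scaled : ContDiff ℝ ∞ fun z : ℝ × ℝ × ℝ => (z.1 ^ D.M * z.2.1, z.2.2) := by
  fun_prop

theorem contDiff_singularLambda (hD : D.Admissible) (ϰ L n : ℕ) :
    ContDiff ℝ ∞ (D.singularLambda ϰ L n) :=
  contDiff_const.mul (ContDiff.sum fun K _ => (contDiff_fst.pow _).mul
    ((contDiff_Lambda hD ϰ K).comp contDiff_scaled))

theorem contDiff_singularOmega (hD : D.Admissible) (ϰ n : ℕ) :
    ContDiff ℝ ∞ (D.singularOmega ϰ n) := by
  refine contDiff_const.mul (ContDiff.sum fun K _ => ?_)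
  split_ifs
  · exact (contDiff_fst.pow _).mul
      (((contDiff_calQ ϰ K).comp contDiff_scaled.fst).mul contDiff_snd.fst)
  · exact (contDiff_fst.pow _).mul ((contDiff_Omega hD ϰ K).comp contDiff_scaled)

theorem contDiff_dLambda (hD : D.Admissible) (ϰ K : ℕ) : ContDiff ℝ ∞ (D.dLambda ϰ K) :=
  (((contDiff_Lambda hD ϰ K).fderiv_right (by simp)).comp contDiff_scaled).clm_apply contDiff_const

theorem singularLambda_zero (hM : 1 ≤ D.M) (ϰ : ℕ) {L n : ℕ} (hn : L ≤ n) (v φ : ℝ) :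
    D.singularLambda ϰ L n (0, v, φ) = D.N * D.Lambda ϰ L 0 φ := by
  rw [singularLambda, Finset.sum_eq_single_of_mem L (Finset.mem_Icc.2 ⟨le_rfl, hn⟩)]
  · simp [show D.M ≠ 0 by omega]
  · intro K hK hKL
    have := (Finset.mem_Icc.1 hK).1
    simp [show K - L ≠ 0 by omega]

/-- At `η = 0` only the term `K = 0` depends on `v`: for `0 < K < M` the power `η^K` vanishes, and
for `K ≥ M` the variable `v` enters only through `η^M v`. -/
theorem singularOmega_zero (hM : 1 ≤ D.M) (ϰ n : ℕ) (v φ : ℝ) :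
    D.singularOmega ϰ n (0, v, φ) = D.N * D.calQ ϰ 0 0 * v + D.singularOmega ϰ n (0, 0, φ) := by
  simp only [singularOmega, Finset.sum_range_succ', show D.M ≠ 0 by omega, zero_pow, ne_eq,
    not_false_eq_true, zero_mul, show 0 < D.M from hM, if_true, pow_zero, mul_zero, add_zero, one_mul,
    Nat.add_eq_zero_iff, one_ne_zero, and_false]
  ring

theorem pow_mul_singularOmega (hM : D.M ≤ D.N) {ϰ : ℕ} (hϰ : 1 ≤ ϰ) (n : ℕ) (η v φ : ℝ) :
    η ^ D.M * D.singularOmega ϰ n (η, v, φ)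
      = D.N * ∑ K ∈ Finset.range (n + 1), η ^ K * D.Omega ϰ K (η ^ D.M * v) φ := by
  rw [singularOmega, mul_left_comm, Finset.mul_sum]
  congr 1
  refine Finset.sum_congr rfl fun K _ => ?_
  split_ifs with h
  · rw [Omega_eq_of_lt h hM hϰ]
    ring
  · rw [← mul_assoc, ← pow_add, Nat.add_sub_cancel' (not_lt.1 h)]

theorem fderiv_singularLambda (hD : D.Admissible) (ϰ L n : ℕ) (z : ℝ × ℝ × ℝ) :
    fderiv ℝ (D.singularLambda ϰ L n) z (0, 1, 0)
      = z.1 ^ D.M * (D.N * ∑ K ∈ Finset.Icc L n, z.1 ^ (K - L) * D.dLambda ϰ K z) := by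
  obtain ⟨η, v, φ⟩ := z
  refine (hasDerivAt_snd_fst (contDiff_singularLambda hD ϰ L n) η v φ).unique ?_
  have h : ∀ K, HasDerivAt (fun v => D.Lambda ϰ K (η ^ D.M * v) φ)
      (η ^ D.M * D.dLambda ϰ K (η, v, φ)) v := fun K => by
    have h1 := ((contDiff_Lambda hD ϰ K).differentiable (by simp)
      (η ^ D.M * v, φ)).hasFDerivAt.comp_hasDerivAt v
      (((hasDerivAt_id v).const_mul (η ^ D.M)).prodMk (hasDerivAt_const v φ))
    have h2 : ((η ^ D.M * 1, 0) : ℝ × ℝ) = η ^ D.M • (1, 0) := by simp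
    rw [h2, map_smul] at h1
    exact h1
  convert! (HasDerivAt.fun_sum fun K _ => (h K).const_mul (η ^ (K - L))).const_mul (D.N : ℝ) using 1
  rw [mul_left_comm, Finset.mul_sum]
  congr 1
  exact Finset.sum_congr rfl fun K _ => by ring

theorem dLambda_zero (hD : D.Admissible) (hσ : D.SigmaCondition) (ϰ : ℕ) (z : ℝ × ℝ × ℝ) :
    D.dLambda ϰ 0 z = 0 := by
  have h0 : HasDerivAt (fun r : ℝ => (r, z.2.2)) (1, 0) (z.1 ^ D.M * z.2.1) :=
    (hasDerivAt_id _).prodMk (hasDerivAt_const _ z.2.2)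
  have h1 := ((contDiff_Lambda hD ϰ 0).differentiable (by simp)
    (z.1 ^ D.M * z.2.1, z.2.2)).hasFDerivAt.comp_hasDerivAt (z.1 ^ D.M * z.2.1) h0
  refine h1.unique ?_
  have h2 : ((fun y : ℝ × ℝ => D.Lambda ϰ 0 y.1 y.2) ∘ fun r => (r, z.2.2))
      = fun _ => D.Lambda ϰ 0 0 z.2.2 := funext fun r => Lambda_zero_indep hD hσ ϰ _ _ _
  rw [h2]
  exact hasDerivAt_const _ _

/-- As `v` enters only through `η^M v`, the chain rule supplies `η^M`. For `L = 0` the term `K = 0`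
has no `r`-derivative and all others carry a further `η`. This is needed because with `j = M` and `L
= 0` the strict inequality `α < 2j + β` would be an equality. -/
theorem exists_fderiv_singularLambda_eq (hD : D.Admissible) (hσ : D.SigmaCondition) (ϰ L n : ℕ) :
    ∃ j, D.M ≤ j ∧ (L = 0 → D.M < j) ∧ ∃ R : ℝ × ℝ × ℝ → ℝ, ContDiff ℝ ∞ R ∧
      ∀ z, fderiv ℝ (D.singularLambda ϰ L n) z (0, 1, 0) = z.1 ^ j * R z := by
  have hR : ∀ L', ContDiff ℝ ∞ fun z : ℝ × ℝ × ℝ =>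
      D.N * ∑ K ∈ Finset.Icc L' n, z.1 ^ (K - L') * D.dLambda ϰ K z := fun L' =>
    contDiff_const.mul (ContDiff.sum fun K _ => (contDiff_fst.pow _).mul (contDiff_dLambda hD ϰ K))
  rcases Nat.eq_zero_or_pos L with rfl | hL
  · refine ⟨D.M + 1, Nat.le_succ _, fun _ => Nat.lt_succ_self _, _, hR 1, fun z => ?_⟩
    have h : ∑ K ∈ Finset.Icc 0 n, z.1 ^ (K - 0) * D.dLambda ϰ K z
        = z.1 * ∑ K ∈ Finset.Icc 1 n, z.1 ^ (K - 1) * D.dLambda ϰ K z := by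
      rw [← Finset.insert_Icc_succ_left_eq_Icc (Nat.zero_le n), Finset.sum_insert (by simp),
        dLambda_zero hD hσ, mul_zero, zero_add, Finset.mul_sum]
      refine Finset.sum_congr rfl fun K hK => ?_
      have hK1 : 1 ≤ K := (Finset.mem_Icc.1 hK).1
      rw [← mul_assoc, ← pow_succ', Nat.sub_add_cancel hK1, Nat.sub_zero]
    rw [fderiv_singularLambda hD, h]
    ring
  · exact ⟨D.M, le_rfl, fun h => by omega, _, hR L, fderiv_singularLambda hD ϰ L n⟩

theorem rpow_neg_div_eq {N : ℕ} {τ : ℝ} (hτ : 0 < τ) (k : ℕ) :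
    τ ^ (-(k : ℝ) / N) = Real.exp (-(Real.log τ / N)) ^ k := by
  rw [Real.rpow_def_of_pos hτ, ← Real.exp_nat_mul]
  congr 1
  ring

/-- The change of time has `dτ/ds = N η^(-N)`. In the equation for `v = η^(-M) ϱ` the power of `η`
left over is `η^(L-N)`, and in that for `φ` it is `η^(2M-N)`; differentiating `η^(-M)` produces the
term `M v`. -/
theorem isTruncatedSolution_of_singular (hM1 : 1 ≤ D.M) (hM : 2 * D.M ≤ D.N) {ϰ : ℕ} (hϰ : 1 ≤ ϰ)
    {L n : ℕ} (hL : L ≤ D.N) {s₁ : ℝ} {x : ℝ → ℝ × ℝ}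
    (hx : ∀ s, s₁ < s → HasDerivAt x (singularField (D.singularLambda ϰ L n) (D.singularOmega ϰ n)
      D.M (D.N - L) (D.N - 2 * D.M) s (x s)) s) :
    D.IsTruncatedSolution ϰ L n (Real.exp (D.N * s₁))
      (fun τ => Real.exp (-(Real.log τ / D.N)) ^ D.M * (x (Real.log τ / D.N)).1)
      (fun τ => (x (Real.log τ / D.N)).2) := by
  intro τ hτ
  have hN0 : (0 : ℝ) < D.N := by exact_mod_cast (by omega : 0 < D.N)
  have hτ0 : 0 < τ := (Real.exp_pos _).trans hτ
  obtain ⟨s, hs⟩ : ∃ s, s = Real.log τ / D.N := ⟨_, rfl⟩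
  have hs1 : s₁ < s := by
    rw [hs, lt_div_iff₀ hN0, mul_comm]
    exact (Real.lt_log_iff_exp_lt hτ0).2 hτ
  obtain ⟨η, hη⟩ : ∃ η, η = Real.exp (-s) := ⟨_, rfl⟩
  have hη0 : η ≠ 0 := by rw [hη]; exact (Real.exp_pos _).ne'
  have hητ : τ⁻¹ = η ^ D.N := by
    rw [hη, hs, ← Real.exp_nat_mul, mul_neg, mul_div_cancel₀ _ hN0.ne', Real.exp_neg, Real.exp_log hτ0]
  have hexp : ∀ k : ℕ, η ^ k * Real.exp (k * s) = 1 := fun k => by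
    rw [hη, ← Real.exp_nat_mul, ← Real.exp_add, mul_neg, neg_add_cancel, Real.exp_zero]
  have hlog : HasDerivAt (fun τ => Real.log τ / D.N) (τ⁻¹ / D.N) τ :=
    (Real.hasDerivAt_log hτ0.ne').div_const _
  have hxs := hx s hs1
  rw [hs] at hxs
  have hxτ := hxs.scomp τ hlog
  have h1 : HasDerivAt (fun τ => (x (Real.log τ / D.N)).1) _ τ := hxτ.fst
  have h2 : HasDerivAt (fun τ => (x (Real.log τ / D.N)).2) _ τ := hxτ.snd
  have h3 := (hlog.fun_neg.exp.fun_pow D.M).fun_mul h1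
  have hpow : ∀ K : ℕ, τ ^ (-((D.M : ℝ) + K) / D.N) = η ^ (D.M + K) := fun K => by
    rw [hη, hs, ← rpow_neg_div_eq hτ0]
    push_cast
    rfl
  rw [← hs, ← hη] at h3
  rw [← hs] at h2
  simp only [hpow, ← hs, ← hη]
  obtain ⟨v, hv⟩ : ∃ v, v = (x s).1 := ⟨_, rfl⟩
  obtain ⟨φ, hφ⟩ : ∃ φ, φ = (x s).2 := ⟨_, rfl⟩
  have hxe : x s = (v, φ) := by rw [hv, hφ]
  rw [← hs, hxe] at h1
  constructor
  · refine h3.congr_deriv ?_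
    rw [hxe]
    simp only [singularField, ← hη, Prod.smul_fst, smul_eq_mul]
    have hS : ∑ K ∈ Finset.Icc L n, η ^ (D.M + K) * D.Lambda ϰ K (η ^ D.M * v) φ
        = η ^ D.M * (η ^ L * ∑ K ∈ Finset.Icc L n, η ^ (K - L) * D.Lambda ϰ K (η ^ D.M * v) φ) := by
      rw [Finset.mul_sum, Finset.mul_sum]
      refine Finset.sum_congr rfl fun K hK => ?_
      have e : η ^ K = η ^ L * η ^ (K - L) := by
        rw [← pow_add, Nat.add_sub_cancel' (Finset.mem_Icc.1 hK).1]
      rw [pow_add, e]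
      ring
    have e1 : η ^ (D.M - 1) * η = η ^ D.M := pow_sub_one_mul (by omega) η
    have e2 : η ^ D.N = η ^ (D.N - L) * η ^ L := by rw [← pow_add, Nat.sub_add_cancel hL]
    rw [hS, singularLambda, hητ]
    generalize ∑ K ∈ Finset.Icc L n, η ^ (K - L) * D.Lambda ϰ K (η ^ D.M * v) φ = S
    have e3 := hexp (D.N - L)
    field_simp
    linear_combination (-D.M * η ^ D.N * v) * e1
      + (η ^ D.M * Real.exp ((D.N - L : ℕ) * s) * D.N * S) * e2
      + (η ^ D.M * η ^ L * D.N * S) * e3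
  · refine h2.congr_deriv ?_
    rw [hxe]
    simp only [singularField, ← hη, Prod.smul_snd, smul_eq_mul]
    have hS : ∑ K ∈ Finset.range (n + 1), η ^ (D.M + K) * D.Omega ϰ K (η ^ D.M * v) φ
        = η ^ D.M * ∑ K ∈ Finset.range (n + 1), η ^ K * D.Omega ϰ K (η ^ D.M * v) φ := by
      rw [Finset.mul_sum]
      exact Finset.sum_congr rfl fun K hK => by rw [pow_add, mul_assoc]
    have e1 := pow_mul_singularOmega (D := D) (by omega) hϰ n η v φ
    have e2 : η ^ D.N = η ^ (D.N - 2 * D.M) * (η ^ D.M * η ^ D.M) := by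
      rw [← pow_add, ← pow_add]
      congr 1
      omega
    have e3 := hexp (D.N - 2 * D.M)
    rw [hS, hητ, e2]
    generalize ∑ K ∈ Finset.range (n + 1), η ^ K * D.Omega ϰ K (η ^ D.M * v) φ = S at *
    rw [div_mul_eq_mul_div, div_eq_iff hN0.ne']
    linear_combination (η ^ D.M * η ^ D.M * D.singularOmega ϰ n (η, v, φ)) * e3 + η ^ D.M * e1

end Data

end PhaseLocking

/-! ### The phase-locked solution -/

open PhaseLocking PhaseLocking.Data in
theorem mainTheorem6 (D : PhaseLocking.Data) (hD : D.Admissible) (hσ : D.SigmaCondition)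
    (ϰ : ℕ) (hϰ : 1 ≤ ϰ) (L : ℕ) (hL : L ≤ min (D.N - D.M) (2 * D.M - 1))
    (hzero : ∀ K < L, ∀ ϱ φ, D.Lambda ϰ K ϱ φ = 0)
    (hne : ∃ ϱ φ, D.Lambda ϰ L ϱ φ ≠ 0)
    (φ₀ : ℝ) (hroot : D.Lambda ϰ L 0 φ₀ = 0)
    (hsimple : deriv (fun φ => D.Lambda ϰ L 0 φ) φ₀ ≠ 0)
    (n : ℕ) (hn : L ≤ n) :
    ∃ τ₀ : ℝ, 0 < τ₀ ∧ ∃ ϱ φ : ℝ → ℝ, D.IsTruncatedSolution ϰ L n τ₀ ϱ φ ∧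
      Tendsto φ atTop (𝓝 φ₀) ∧
      ∃ ϱc φc : ℕ → ℝ, φc 0 = φ₀ ∧
        (∀ m : ℕ, (fun τ : ℝ => ϱ τ
            - ∑ K ∈ Finset.range m, ϱc K * τ ^ (-((D.M : ℝ) + K) / D.N))
          =O[atTop] fun τ : ℝ => τ ^ (-((D.M : ℝ) + m) / D.N)) ∧
        (∀ m : ℕ, (fun τ : ℝ => φ τ - ∑ K ∈ Finset.range m, φc K * τ ^ (-(K : ℝ) / D.N))
          =O[atTop] fun τ : ℝ => τ ^ (-(m : ℝ) / D.N)) := by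
  have hM := one_le_M hD hσ
  have hMN := two_mul_M_le_N hD hσ
  have hL1 : L ≤ D.N - D.M := hL.trans (min_le_left _ _)
  have hL2 : L ≤ 2 * D.M - 1 := hL.trans (min_le_right _ _)
  have hN0 : (0 : ℝ) < D.N := by exact_mod_cast (by omega : 0 < D.N)
  have hq := calQ_zero_pos hD hσ hϰ 0
  have hPs := contDiff_singularLambda hD ϰ L n
  have hQs := contDiff_singularOmega hD ϰ n
  obtain ⟨w, hw⟩ : ∃ w, w = (D.N : ℝ) * D.calQ ϰ 0 0 := ⟨_, rfl⟩
  have hw0 : 0 < w := by rw [hw]; exact mul_pos hN0 hq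
  -- The zero of the affine function `v ↦ Q(0, v, φ₀)`, whose slope is `w`; it becomes the leading
  -- coefficient of `ϱ`.
  obtain ⟨v₀, hv₀⟩ : ∃ v₀, v₀ = -D.singularOmega ϰ n (0, 0, φ₀) / w := ⟨_, rfl⟩
  obtain ⟨j, hj1, hj2, R, hR, hPv⟩ := exists_fderiv_singularLambda_eq hD hσ ϰ L n
  have hQv : fderiv ℝ (D.singularOmega ϰ n) (0, v₀, φ₀) (0, 1, 0) = w := by
    refine (hasDerivAt_snd_fst hQs 0 v₀ φ₀).unique ?_
    have h : (fun v => D.singularOmega ϰ n (0, v, φ₀))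
        = fun v => w * v + D.singularOmega ϰ n (0, 0, φ₀) := funext fun v => by
      rw [singularOmega_zero hM, ← hw]
    rw [h]
    simpa using ((hasDerivAt_id v₀).const_mul w).add_const (D.singularOmega ϰ n (0, 0, φ₀))
  have hPφ : fderiv ℝ (D.singularLambda ϰ L n) (0, v₀, φ₀) (0, 0, 1)
      = D.N * deriv (fun φ => D.Lambda ϰ L 0 φ) φ₀ := by
    refine (hasDerivAt_snd_snd hPs 0 v₀ φ₀).unique ?_
    simp only [singularLambda_zero hM ϰ hn]
    exact (differentiableAt_of_deriv_ne_zero hsimple).hasDerivAt.const_mul _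
  obtain ⟨c, hc0, s₁, x, hx, hxc⟩ := exists_solution_singularField hPs hQs D.M
    (α := D.N - L) (β := D.N - 2 * D.M) (j := j) (x₀ := (v₀, φ₀)) (by omega)
    -- The inequality amounts to `2M - L < 2j`: for `L > 0` the bound `j ≥ M` suffices, while `L =
    -- 0` needs `j ≥ M + 1`.
    (by rcases Nat.eq_zero_or_pos L with h | h
        · have := hj2 h
          omega
        · omega)
    (by rw [singularLambda_zero hM ϰ hn, hroot, mul_zero])
    (by
      rw [singularOmega_zero hM, ← hw, hv₀]
      field_simp
      ring) hR hPv
    (by rw [hPφ]; exact mul_ne_zero hN0.ne' hsimple) (by rw [hQv]; exact hw0)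
  have hlog : Tendsto (fun τ => Real.log τ / D.N) atTop atTop :=
    Real.tendsto_log_atTop.atTop_div_const hN0
  have hexp : ∀ (m : ℕ) (τ : ℝ), Real.exp (-(m * (Real.log τ / D.N)))
      = Real.exp (-(Real.log τ / D.N)) ^ m := fun m τ => by rw [← Real.exp_nat_mul, mul_neg]
  have hxτ : ∀ m : ℕ, (fun τ => x (Real.log τ / D.N)
      - partialSum c m (Real.exp (-(Real.log τ / D.N)))) =O[atTop]
        fun τ => Real.exp (-(Real.log τ / D.N)) ^ m := fun m =>
    ((hxc m).comp_tendsto hlog).congr_right (hexp m)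
  have hφ : ∀ m : ℕ, (fun τ : ℝ => (x (Real.log τ / D.N)).2
      - ∑ K ∈ Finset.range m, (c K).2 * τ ^ (-(K : ℝ) / D.N))
      =O[atTop] fun τ : ℝ => τ ^ (-(m : ℝ) / D.N) := fun m => by
    refine (isBigO_snd_prod'.trans (hxτ m)).congr' ?_ ?_
    · filter_upwards [eventually_gt_atTop 0] with τ hτ
      simp only [Prod.snd_sub, partialSum, Prod.snd_sum, Prod.smul_snd, smul_eq_mul,
        rpow_neg_div_eq hτ, mul_comm]
    · filter_upwards [eventually_gt_atTop 0] with τ hτ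
      rw [rpow_neg_div_eq hτ]
  refine ⟨Real.exp (D.N * s₁), Real.exp_pos _, _, _,
    isTruncatedSolution_of_singular hM hMN hϰ (by omega) hx, ?_, fun K => (c K).1, fun K => (c K).2,
    by simp only [hc0], fun m => ?_, hφ⟩
  · have h1 := (hφ 1).trans_tendsto (by
      have := tendsto_rpow_neg_atTop (y := 1 / (D.N : ℝ)) (by positivity)
      simpa [neg_div] using this)
    simpa [hc0] using h1.add_const φ₀
  · have hp : ∀ {τ : ℝ}, 0 < τ → ∀ K : ℕ, τ ^ (-((D.M : ℝ) + K) / D.N)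
        = Real.exp (-(Real.log τ / D.N)) ^ D.M * Real.exp (-(Real.log τ / D.N)) ^ K :=
      fun hτ K => by
        rw [← pow_add, ← rpow_neg_div_eq hτ]
        push_cast
        rfl
    -- Since `ϱ = η^M v` with `η = τ^(-1/N)`, multiplying the expansion of `v` by `η^M` shifts every
    -- exponent and the error by `M`.
    refine ((isBigO_refl (fun τ => Real.exp (-(Real.log τ / D.N)) ^ D.M) atTop).mul
      (isBigO_fst_prod'.trans (hxτ m))).congr' ?_ ?_
    · filter_upwards [eventually_gt_atTop 0] with τ hτ
      simp only [Prod.fst_sub, partialSum, Prod.fst_sum, Prod.smul_fst, smul_eq_mul, hp hτ, mul_sub,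
        Finset.mul_sum]
      congr 1
      exact Finset.sum_congr rfl fun K _ => by ring
    · filter_upwards [eventually_gt_atTop 0] with τ hτ
      rw [hp hτ]
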